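/- For a locally compact Hausdorff space $X$ whose cohomology groups with compact supports $H^p_c(X;\mathbb Z)$ (coefficients in the constant sheaf $\mathbb Z$) are finitely generated and vanish for large $p$, let $\chi^c(X)=\sum_p(-1)^p\operatorname{rank}H^p_c(X;\mathbb Z)$ be its Euler characteristic with compact supports. For $d\ge 0$ and $n\ge 1$ let $\mathcal L_n=\{\gamma(t)=\mathbf a_1t+\cdots+\mathbf a_nt^n:\ \mathbf a_i\in\mathbb R^d\}\cong\mathbb R^{nd}$ be the space of truncated arcs at $0\in\mathbb R^d$. For a real analytic function germ $f:(\mathbb R^d,0)\to(\mathbb R,0)$ put $$\mathcal X_{n}(f)=\{\gamma\in\mathcal L_n:\ f(\gamma(t))=ct^n+\cdots,\ c\neq0\},$$ and let $\mathcal X_{n,+}(f)$, respectively $\mathcal X_{n,-}(f)$, be the subset where $c>0$, respectively $c<0$ (dots denote terms of order higher than $n$). Let $$Z_f(T)=\sum_{n\ge1}a_nT^n=\sum_{n\ge1}(-1)^{-nd}\chi^c(\mathcal X_n(f))\,T^n,\qquad Z_{f,\pm}(T)=\sum_{n\ge1}a_n^\pm T^n=\sum_{n\ge1}(-1)^{-nd}\chi^c(\mathcal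 X_{n,\pm}(f))\,T^n .$$ Put $A_n=1-\sum_{i=1}^na_i$, and define the modified zeta functions of $f$ by $$\widetilde Z_{f,\pm}(T)=\sum_{n\ge1}\tilde A_n^\pm T^n,\qquad \tilde A_n^\pm=A_n+a_n^\pm .$$ **Theorem (Thom–Sebastiani formulae).** Let $f:(\mathbb R^{d_1},0)\to(\mathbb R,0)$ and $g:(\mathbb R^{d_2},0)\to(\mathbb R,0)$ be real analytic function germs, and let $(f*g)(x,y)=f(x)+g(y)$ on $\mathbb R^{d_1}\times\mathbb R^{d_2}=\mathbb R^{d_1+d_2}$. Then all Euler characteristics with compact supports occurring in the zeta functions of $f$, $g$ and $f*g$ are defined, and, writing $\tilde A_n^\pm$, $\tilde B_n^\pm$, $\tilde C_n^\pm$ for the coefficients of the modified zeta functions of $f$, $g$ and $f*g$ respectively, for every $n\ge1$ $$\tilde C_n^+=\tilde A_n^+\,\tilde B_n^+,\qquad \tilde C_n^-=\tilde A_n^-\,\tilde B_n^- .$$ -/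

import Mathlib

open scoped Topology PowerSeries

noncomputable section

/-! ## Cohomology with compact supports

`H_c^p(X; ℤ)` is given by the complex of Alexander–Spanier cochains with compact support: functions
`f : X^{p+1} → ℤ` whose support (the set of points near which `f` is not zero on small tuples) is
compact, modulo the locally zero ones.  For a paracompact locally compact Hausdorff space, in
particular for a locally closed subset of some `ℝ^N`, these are the sections with compact support
of the Alexander–Spanier resolution (a resolution by soft sheaves) of the constant sheaf `ℤ`, and
the cohomology of the complex is the sheaf cohomology with compact supports. -/

namespace AlexanderSpanier

/-- The support of an Alexander–Spanier cochain: the points `x` such that `f` does not vanish on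
`V^{p+1}` for any neighbourhood `V` of `x`. -/
def support {X : Type*} [TopologicalSpace X] {p : ℕ} (f : (Fin (p + 1) → X) → ℤ) : Set X :=
  {x | ¬ ∃ V ∈ 𝓝 x, ∀ y : Fin (p + 1) → X, (∀ i, y i ∈ V) → f y = 0}

/-- The coboundary `(δf)(x₀, …, x_{p+1}) = ∑ᵢ (-1)ⁱ f(x₀, …, x̂ᵢ, …, x_{p+1})`. -/
def coboundary (X : Type*) (p : ℕ) :
    ((Fin (p + 1) → X) → ℤ) →ₗ[ℤ] ((Fin (p + 1 + 1) → X) → ℤ) where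
  toFun f := fun y => ∑ i : Fin (p + 2), (-1) ^ (i : ℕ) * f (fun j => y (i.succAbove j))
  map_add' f g := by
    funext y
    simp [mul_add, Finset.sum_add_distrib]
  map_smul' c f := by
    funext y
    simp only [Pi.smul_apply, smul_eq_mul, RingHom.id_apply, Finset.mul_sum]
    exact Finset.sum_congr rfl fun i _ => by ring

theorem isClosed_support {X : Type*} [TopologicalSpace X] {p : ℕ} (f : (Fin (p + 1) → X) → ℤ) :
    IsClosed (support f) := by
  rw [← isOpen_compl_iff, isOpen_iff_mem_nhds]
  intro x hx
  simp only [support, Set.mem_compl_iff, Set.mem_ofPred_eq, not_not] at hx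
  obtain ⟨V, hV, h⟩ := hx
  filter_upwards [eventually_mem_nhds_iff.2 hV] with z hz
  simp only [support, Set.mem_compl_iff, Set.mem_ofPred_eq, not_not]
  exact ⟨V, hz, h⟩

theorem support_add {X : Type*} [TopologicalSpace X] {p : ℕ} (f g : (Fin (p + 1) → X) → ℤ) :
    support (f + g) ⊆ support f ∪ support g := by
  intro x hx
  by_contra h
  simp only [support, Set.mem_union, Set.mem_ofPred_eq, not_or, not_not] at h
  obtain ⟨⟨V, hV, hf⟩, ⟨W, hW, hg⟩⟩ := h
  refine hx ⟨V ∩ W, Filter.inter_mem hV hW, fun y hy => ?_⟩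
  simp [hf y fun i => (hy i).1, hg y fun i => (hy i).2]

theorem support_zero {X : Type*} [TopologicalSpace X] {p : ℕ} :
    support (0 : (Fin (p + 1) → X) → ℤ) = ∅ := by
  ext x
  simp only [support, Set.mem_ofPred_eq, Set.mem_empty_iff_false, iff_false, not_not]
  exact ⟨Set.univ, Filter.univ_mem, fun _ _ => rfl⟩

theorem support_smul {X : Type*} [TopologicalSpace X] {p : ℕ} (c : ℤ)
    (f : (Fin (p + 1) → X) → ℤ) : support (c • f) ⊆ support f := by
  intro x hx ⟨V, hV, h⟩
  exact hx ⟨V, hV, fun y hy => by simp [h y hy]⟩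

theorem support_coboundary {X : Type*} [TopologicalSpace X] {p : ℕ}
    (f : (Fin (p + 1) → X) → ℤ) : support (coboundary X p f) ⊆ support f := by
  intro x hx ⟨V, hV, h⟩
  refine hx ⟨V, hV, fun y hy => ?_⟩
  change ∑ i : Fin (p + 2), (-1) ^ (i : ℕ) * f (fun j => y (i.succAbove j)) = 0
  exact Finset.sum_eq_zero fun i _ => by rw [h _ fun j => hy _, mul_zero]

theorem coboundary_coboundary (X : Type*) (p : ℕ) (f : (Fin (p + 1) → X) → ℤ) :
    coboundary X (p + 1) (coboundary X p f) = 0 := by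
  funext y
  simp only [coboundary, LinearMap.coe_mk, AddHom.coe_mk, Finset.mul_sum, Pi.zero_apply]
  rw [← Finset.sum_product']
  refine Finset.sum_involution
    (fun ij _ => (ij.1.succAbove ij.2, ij.2.predAbove ij.1)) ?_ ?_ ?_ ?_
  · rintro ⟨i, j⟩ -
    have h1 : (fun k => y (i.succAbove (j.succAbove k))) =
        fun k => y ((i.succAbove j).succAbove ((j.predAbove i).succAbove k)) := by
      funext k
      rw [Fin.succAbove_succAbove_succAbove_predAbove]
    simp only
    rw [← h1, ← mul_assoc, ← mul_assoc, ← add_mul, ← pow_add, ← pow_add]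
    rw [Fin.neg_one_pow_succAbove_add_predAbove]
    ring
  · rintro ⟨i, j⟩ - - h
    exact Fin.succAbove_ne i j (congrArg Prod.fst h)
  · intro _ _
    simp
  · rintro ⟨i, j⟩ -
    simp [Fin.succAbove_succAbove_predAbove, Fin.predAbove_predAbove_succAbove]

/-- Cochains of degree `p` with compact support. -/
def compactCochains (X : Type*) [TopologicalSpace X] (p : ℕ) :
    Submodule ℤ ((Fin (p + 1) → X) → ℤ) where
  carrier := {f | IsCompact (support f)}
  zero_mem' := by simp [support_zero]
  add_mem' {f g} hf hg := (hf.union hg).of_isClosed_subset (isClosed_support _) (support_add f g)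
  smul_mem' c f hf := hf.of_isClosed_subset (isClosed_support _) (support_smul c f)

/-- Locally zero cochains of degree `p`, i.e. those with empty support. -/
def locallyZero (X : Type*) [TopologicalSpace X] (p : ℕ) :
    Submodule ℤ (compactCochains X p) where
  carrier := {f | support (f : (Fin (p + 1) → X) → ℤ) = ∅}
  zero_mem' := support_zero
  add_mem' {f g} hf hg := by
    have h := support_add (f : (Fin (p + 1) → X) → ℤ) g
    rw [Set.mem_ofPred_eq] at hf hg
    rw [hf, hg, Set.union_empty] at h
    exact Set.subset_empty_iff.1 h
  smul_mem' c f hf :=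
    Set.subset_empty_iff.1 ((support_smul c (f : (Fin (p + 1) → X) → ℤ)).trans (Eq.subset hf))

/-- The coboundary on cochains with compact support. -/
def compactCoboundary (X : Type*) [TopologicalSpace X] (p : ℕ) :
    compactCochains X p →ₗ[ℤ] compactCochains X (p + 1) :=
  (coboundary X p).restrict fun f hf =>
    IsCompact.of_isClosed_subset hf (isClosed_support _) (support_coboundary f)

theorem locallyZero_le_comap (X : Type*) [TopologicalSpace X] (p : ℕ) :
    locallyZero X p ≤ (locallyZero X (p + 1)).comap (compactCoboundary X p) := fun f hf =>
  Set.subset_empty_iff.1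
    ((support_coboundary (f : (Fin (p + 1) → X) → ℤ)).trans (Eq.subset hf))

/-- The coboundary on cochains with compact support modulo locally zero cochains. -/
def differential (X : Type*) [TopologicalSpace X] (p : ℕ) :
    (compactCochains X p ⧸ locallyZero X p) →ₗ[ℤ]
      (compactCochains X (p + 1) ⧸ locallyZero X (p + 1)) :=
  (locallyZero X p).mapQ (locallyZero X (p + 1)) (compactCoboundary X p)
    (locallyZero_le_comap X p)

theorem differential_comp_differential (X : Type*) [TopologicalSpace X] (p : ℕ) :
    (differential X (p + 1)).comp (differential X p) = 0 := by
  apply LinearMap.ext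
  intro x
  induction x using Submodule.Quotient.induction_on with
  | H f =>
    have h : compactCoboundary X (p + 1) (compactCoboundary X p f) = 0 :=
      Subtype.ext (coboundary_coboundary X p f)
    simp [differential, Submodule.mapQ_apply, h]

/-- The complex of Alexander–Spanier cochains with compact support and integer coefficients. -/
def compactComplex (X : Type*) [TopologicalSpace X] : CochainComplex (ModuleCat ℤ) ℕ :=
  CochainComplex.of (fun p => ModuleCat.of ℤ (compactCochains X p ⧸ locallyZero X p))
    (fun p => ModuleCat.ofHom (differential X p))
    (fun p => by
      rw [← ModuleCat.ofHom_comp, differential_comp_differential]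
      rfl)

end AlexanderSpanier

/-- `H_c^p(X; ℤ)`, the cohomology with compact supports. -/
abbrev compactCohomology (X : Type*) [TopologicalSpace X] (p : ℕ) : ModuleCat ℤ :=
  (AlexanderSpanier.compactComplex X).homology p

/-- All `H_c^p(X; ℤ)` are finitely generated and they vanish for large `p`, so that the Euler
characteristic with compact supports is defined. -/
def HasEulerCharC (X : Type*) [TopologicalSpace X] : Prop :=
  (∀ p, Module.Finite ℤ (compactCohomology X p)) ∧
    ∃ N, ∀ p, N ≤ p → Subsingleton (compactCohomology X p)

/-- The Euler characteristic with compact supports `χ^c(X) = ∑ₚ (-1)ᵖ rank H_c^p(X; ℤ)`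
(meaningful when `HasEulerCharC X` holds). -/
def eulerCharC (X : Type*) [TopologicalSpace X] : ℤ :=
  ∑ᶠ p : ℕ, (-1) ^ p * (Module.finrank ℤ (compactCohomology X p) : ℤ)

/-! ## Arcs and zeta functions -/

/-- The truncated arc `t ↦ a₁ t + a₂ t² + ⋯ + aₙ tⁿ` in `ℝ^d`; the space `𝓛ₙ` of truncated arcs is
identified with the space `(ℝ^d)ⁿ` of coefficient vectors (`a k` is the coefficient at `t^{k+1}`). -/
def truncatedArc {d n : ℕ} (a : Fin n → Fin d → ℝ) (t : ℝ) : Fin d → ℝ :=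
  ∑ k : Fin n, t ^ ((k : ℕ) + 1) • a k

/-- The truncated arcs `γ ∈ 𝓛ₙ` with `f(γ(t)) = c tⁿ + ⋯` (higher order terms) and `c ∈ S`. -/
def arcsWithCoeff {d : ℕ} (f : (Fin d → ℝ) → ℝ) (n : ℕ) (S : Set ℝ) :
    Set (Fin n → Fin d → ℝ) :=
  {a | ∃ c ∈ S, ∃ h : ℝ → ℝ, AnalyticAt ℝ h 0 ∧
    ∀ᶠ t in 𝓝 (0 : ℝ), f (truncatedArc a t) = c * t ^ n + t ^ (n + 1) * h t}

/-- `𝓧_{n,+}(f)` -/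
def arcsPos {d : ℕ} (f : (Fin d → ℝ) → ℝ) (n : ℕ) : Set (Fin n → Fin d → ℝ) :=
  arcsWithCoeff f n {c | 0 < c}

/-- `𝓧_{n,-}(f)` -/
def arcsNeg {d : ℕ} (f : (Fin d → ℝ) → ℝ) (n : ℕ) : Set (Fin n → Fin d → ℝ) :=
  arcsWithCoeff f n {c | c < 0}

/-- `𝓧_n(f)` -/
def arcsNonzero {d : ℕ} (f : (Fin d → ℝ) → ℝ) (n : ℕ) : Set (Fin n → Fin d → ℝ) :=
  arcsWithCoeff f n {c | c ≠ 0}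

/-- All the Euler characteristics that occur in the zeta functions of `f` are defined. -/
def ZetaDefined {d : ℕ} (f : (Fin d → ℝ) → ℝ) : Prop :=
  ∀ n, 1 ≤ n →
    HasEulerCharC (arcsPos f n) ∧ HasEulerCharC (arcsNeg f n) ∧ HasEulerCharC (arcsNonzero f n)

/-- The positive zeta function `Z_{f,+}(T) = ∑_{n ≥ 1} (-1)^{-nd} χ^c(𝓧_{n,+}(f)) Tⁿ`
(note that `(-1)^{-nd} = (-1)^{nd}`). -/
def zetaPos {d : ℕ} (f : (Fin d → ℝ) → ℝ) : ℤ⟦X⟧ :=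
  PowerSeries.mk fun n => if n = 0 then 0 else (-1) ^ (n * d) * eulerCharC (arcsPos f n)

/-- The negative zeta function `Z_{f,-}(T)`. -/
def zetaNeg {d : ℕ} (f : (Fin d → ℝ) → ℝ) : ℤ⟦X⟧ :=
  PowerSeries.mk fun n => if n = 0 then 0 else (-1) ^ (n * d) * eulerCharC (arcsNeg f n)

/-- The total zeta function `Z_f(T)`. -/
def zetaTotal {d : ℕ} (f : (Fin d → ℝ) → ℝ) : ℤ⟦X⟧ :=
  PowerSeries.mk fun n => if n = 0 then 0 else (-1) ^ (n * d) * eulerCharC (arcsNonzero f n)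

/-- `A_n = 1 - ∑_{i=1}^n a_i`, where `Z_f(T) = ∑ a_i T^i`. -/
def zetaPartial {d : ℕ} (f : (Fin d → ℝ) → ℝ) (n : ℕ) : ℤ :=
  1 - ∑ i ∈ Finset.Icc 1 n, PowerSeries.coeff i (zetaTotal f)

/-- The modified positive zeta function `∑_{n ≥ 1} (A_n + a_n^+) Tⁿ`. -/
def modifiedZetaPos {d : ℕ} (f : (Fin d → ℝ) → ℝ) : ℤ⟦X⟧ :=
  PowerSeries.mk fun n =>
    if n = 0 then 0 else zetaPartial f n + PowerSeries.coeff n (zetaPos f)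

/-- The modified negative zeta function `∑_{n ≥ 1} (A_n + a_n^-) Tⁿ`. -/
def modifiedZetaNeg {d : ℕ} (f : (Fin d → ℝ) → ℝ) : ℤ⟦X⟧ :=
  PowerSeries.mk fun n =>
    if n = 0 then 0 else zetaPartial f n + PowerSeries.coeff n (zetaNeg f)

/-- `(f * g)(x, y) = f(x) + g(y)` on `ℝ^{d₁ + d₂} = ℝ^{d₁} × ℝ^{d₂}`. -/
def thomSebastianiSum {d₁ d₂ : ℕ} (f : (Fin d₁ → ℝ) → ℝ) (g : (Fin d₂ → ℝ) → ℝ) :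
    (Fin (d₁ + d₂) → ℝ) → ℝ :=
  fun z => f (fun i => z (Fin.castAdd d₂ i)) + g (fun j => z (Fin.natAdd d₁ j))

end

/-! Write χ for the Euler characteristic with compact supports. Replacing a germ by a Taylor
polynomial `F` of degree at most `n` changes no condition on the coefficients up to order `n` along
an arc (`ApproximatedBy.arcsWithCoeff_eq`). An arc in 𝓛_n of exact order `i` is such an arc in 𝓛_i
followed by `n - i` free vectors. Removing the orders 1, …, n from 𝓛_n shows that `A_n` is `(-1)^(n
* d)` times χ of the arcs of order above `n`. Adding `a_n^+` puts back those with positive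
coefficient at order `n`, so the modified coefficient is `(-1)^(n * d)` times χ of one closed set:
vanishing coefficients below `n`, non-negative coefficient at `n`
(`ApproximatedBy.coeff_modifiedZetaPos`).

For `F(x) + G(y)` this set consists of pairs of arcs, stratified by the order `i` of `F` along the
first arc. If `0 < i < n`, the reparametrization `t ↦ t + s t^(n-i+1)` of the first arc fixes all
coefficients below `n` and moves the one at `n` linearly and nontrivially in `s`. The stratum is
thus swept out by half-lines and has χ = 0 (`eulerCharC_arcPairs_order`). If `i ≥ n`, the
coefficients of `G` below `n` vanish too. Pairs whose coefficients at `n` have opposite signs are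
again swept out by half-lines, through rescaling one arc (`eulerCharC_arcPairsOpposite`); the
remaining pairs form the product of the two closed sets for `F` and `G`. The negative formula is the
positive one for `-f` and `-g`.

Three properties of χ are needed. Additivity over a closed subset and its complement follows from a
long exact sequence once closed subspaces are known to be taut (`exists_sub_mem_vanishingNear`).
Vanishing on `X × [0, ∞)` holds because a compactly supported cocycle can be shifted off its support
(`subsingleton_homology_halfLine`). Both rest on the prism homotopy for maps that need not be
continuous.

Finiteness of χ and multiplicativity for the sets of arcs come from a cylindrical decomposition of
real algebraic sets (`clopenMultiplicative_algebraic`): over a generic part of the base, the zeros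
of a separable polynomial are finitely many disjoint graphs, and the complementary pieces are
products with a line. The statement is carried for all clopen pieces, so that the condition `c > 0`
on the locus `c ≠ 0` is included without a theory of semialgebraic sets. -/

noncomputable section

open CategoryTheory

/-! ## Euler characteristics of graded abelian groups and of cochain complexes -/

section Graded

variable {R : Type*} [CommRing R]

variable (R) in
/-- All the modules are finitely generated and they vanish in large degrees. -/
def EulerFinite (A : ℕ → Type*) [∀ p, AddCommGroup (A p)]
    [∀ p, Module R (A p)] : Prop :=
  (∀ p, Module.Finite R (A p)) ∧ ∃ N, ∀ p, N ≤ p → Subsingleton (A p)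

variable (R) in
/-- The alternating sum of the ranks. -/
def eulerSum (A : ℕ → Type*) [∀ p, AddCommGroup (A p)]
    [∀ p, Module R (A p)] : ℤ :=
  ∑ᶠ p : ℕ, (-1) ^ p * (Module.finrank R (A p) : ℤ)

theorem eulerSum_eq_sum_range [Nontrivial R] {A : ℕ → Type*} [∀ p, AddCommGroup (A p)]
    [∀ p, Module R (A p)] {N : ℕ}
    (h : ∀ p, N ≤ p → Subsingleton (A p)) :
    eulerSum R A = ∑ p ∈ Finset.range N, (-1) ^ p * (Module.finrank R (A p) : ℤ) := by
  apply finsum_eq_sum_of_support_subset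
  intro p hp
  by_contra hN
  have := h p (by simpa using hN)
  exact hp (by simp [Module.finrank_zero_of_subsingleton])

theorem finite_of_exact [IsNoetherianRing R] {A B C : Type*} [AddCommGroup A] [AddCommGroup B] [AddCommGroup C]
    [Module R A] [Module R B] [Module R C]
    (f : A →ₗ[R] B) (g : B →ₗ[R] C) (h : Function.Exact f g) [Module.Finite R A]
    [Module.Finite R C] : Module.Finite R B := by
  have h1 : (LinearMap.ker g).FG := by
    rw [h.linearMap_ker_eq, LinearMap.range_eq_map]
    exact Submodule.FG.map _ (Module.Finite.fg_top)
  have h2 : (LinearMap.range g).FG := IsNoetherian.noetherian _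
  constructor
  refine Submodule.fg_of_fg_map_of_fg_inf_ker g ?_ ?_
  · rwa [← LinearMap.range_eq_map]
  · rwa [top_inf_eq]

theorem subsingleton_of_exact {A B C : Type*} [AddCommGroup A] [AddCommGroup B] [AddCommGroup C]
    [Module R A] [Module R B] [Module R C]
    (f : A →ₗ[R] B) (g : B →ₗ[R] C) (h : Function.Exact f g) [Subsingleton A]
    [Subsingleton C] : Subsingleton B := by
  refine ⟨fun x y => ?_⟩
  have key : ∀ x : B, x = 0 := fun x => by
    obtain ⟨a, rfl⟩ := (h x).1 (Subsingleton.elim _ _)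
    rw [Subsingleton.elim a 0, map_zero]
  rw [key x, key y]

theorem finrank_eq_of_exact [IsDomain R] {A B C : Type*} [AddCommGroup A] [AddCommGroup B] [AddCommGroup C]
    [Module R A] [Module R B] [Module R C]
    (f : A →ₗ[R] B) (g : B →ₗ[R] C) (h : Function.Exact f g) [Module.Finite R B] :
    Module.finrank R B =
      Module.finrank R (LinearMap.range f) + Module.finrank R (LinearMap.range g) := by
  have h1 := Submodule.finrank_quotient_add_finrank (LinearMap.ker g)
  rw [← h1, h.linearMap_ker_eq, add_comm, ← g.quotKerEquivRange.finrank_eq, h.linearMap_ker_eq]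

section LongExact

variable {A B C : ℕ → Type*} [∀ p, AddCommGroup (A p)]
    [∀ p, Module R (A p)] [∀ p, AddCommGroup (B p)]
  [∀ p, AddCommGroup (C p)]
  [∀ p, Module R (B p)] [∀ p, Module R (C p)] (f : ∀ p, A p →ₗ[R] B p) (g : ∀ p, B p →ₗ[R] C p)
  (δ : ∀ p, C p →ₗ[R] A (p + 1))

theorem EulerFinite.middle [IsNoetherianRing R] (hfg : ∀ p, Function.Exact (f p) (g p))
    (hA : EulerFinite R A) (hC : EulerFinite R C) : EulerFinite R B := by
  obtain ⟨hA, N, hN⟩ := hA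
  obtain ⟨hC, M, hM⟩ := hC
  refine ⟨fun p => finite_of_exact _ _ (hfg p), max N M, fun p hp => ?_⟩
  have := hN p ((le_max_left _ _).trans hp)
  have := hM p ((le_max_right _ _).trans hp)
  exact subsingleton_of_exact _ _ (hfg p)

theorem EulerFinite.right [IsNoetherianRing R] (hgδ : ∀ p, Function.Exact (g p) (δ p))
    (hA : EulerFinite R A) (hB : EulerFinite R B) : EulerFinite R C := by
  obtain ⟨hA, N, hN⟩ := hA
  obtain ⟨hB, M, hM⟩ := hB
  refine ⟨fun p => finite_of_exact _ _ (hgδ p), max N M, fun p hp => ?_⟩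
  have := hN (p + 1) (((le_max_left _ _).trans hp).trans p.le_succ)
  have := hM p ((le_max_right _ _).trans hp)
  exact subsingleton_of_exact _ _ (hgδ p)

/-- Degree `p + 1` sits between `C p` and `B (p + 1)`, which accounts for the extra 1 in the
vanishing bound. No connecting map reaches degree 0; the injectivity of `f 0` replaces it. -/
theorem EulerFinite.left [IsNoetherianRing R] (hδf : ∀ p, Function.Exact (δ p) (f (p + 1)))
    (h0 : Function.Injective (f 0)) (hB : EulerFinite R B) (hC : EulerFinite R C) :
    EulerFinite R A := by
  obtain ⟨hB, N, hN⟩ := hB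
  obtain ⟨hC, M, hM⟩ := hC
  refine ⟨fun p => ?_, max N M + 1, fun p hp => ?_⟩
  · cases p with
    | zero => exact Module.Finite.of_injective _ h0
    | succ p => exact finite_of_exact _ _ (hδf p)
  · obtain ⟨p, rfl⟩ : ∃ q, p = q + 1 := ⟨p - 1, by omega⟩
    have := hN (p + 1) (by omega)
    have := hM p (by omega)
    exact subsingleton_of_exact _ _ (hδf p)

/-- By rank–nullity at each spot of the sequence, the alternating sums truncated after degree `n`
fail to be additive exactly by `(-1)^n` times the rank of `δ n`, and this rank is zero once `C n`
vanishes. -/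
theorem eulerSum_add_of_longExact [IsDomain R] (hfg : ∀ p, Function.Exact (f p) (g p))
    (hgδ : ∀ p, Function.Exact (g p) (δ p)) (hδf : ∀ p, Function.Exact (δ p) (f (p + 1)))
    (h0 : Function.Injective (f 0)) (hA : EulerFinite R A) (hB : EulerFinite R B)
    (hC : EulerFinite R C) : eulerSum R B = eulerSum R A + eulerSum R C := by
  obtain ⟨hA, N₁, hN₁⟩ := hA
  obtain ⟨hB, N₂, hN₂⟩ := hB
  obtain ⟨hC, N₃, hN₃⟩ := hC
  set N := max N₁ (max N₂ N₃)
  have h₁ : N₁ ≤ N := le_max_left _ _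
  have h₂ : N₂ ≤ N := (le_max_left _ _).trans (le_max_right _ _)
  have h₃ : N₃ ≤ N := (le_max_right _ _).trans (le_max_right _ _)
  rw [eulerSum_eq_sum_range (fun p hp => hN₁ p (h₁.trans hp)),
    eulerSum_eq_sum_range (fun p hp => hN₂ p (h₂.trans hp)),
    eulerSum_eq_sum_range (fun p hp => hN₃ p (h₃.trans hp))]
  have hA0 : Module.finrank R (A 0) = Module.finrank R (LinearMap.range (f 0)) :=
    (LinearMap.finrank_range_of_inj h0).symm
  have key : ∀ n, ∑ p ∈ Finset.range (n + 1), (-1 : ℤ) ^ p * (Module.finrank R (B p) : ℤ) =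
      ∑ p ∈ Finset.range (n + 1), (-1) ^ p * (Module.finrank R (A p) : ℤ) +
      ∑ p ∈ Finset.range (n + 1), (-1) ^ p * (Module.finrank R (C p) : ℤ)
      - (-1) ^ n * (Module.finrank R (LinearMap.range (δ n)) : ℤ) := by
    intro n
    induction n with
    | zero =>
      have hb := finrank_eq_of_exact _ _ (hfg 0)
      have hc := finrank_eq_of_exact _ _ (hgδ 0)
      simp only [zero_add, Finset.range_one, Finset.sum_singleton, pow_zero, one_mul, hA0, hb, hc]
      push_cast
      ring
    | succ n ih =>
      have ha := finrank_eq_of_exact _ _ (hδf n)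
      have hb := finrank_eq_of_exact _ _ (hfg (n + 1))
      have hc := finrank_eq_of_exact _ _ (hgδ (n + 1))
      rw [Finset.sum_range_succ, ih, Finset.sum_range_succ _ (n + 1),
        Finset.sum_range_succ _ (n + 1), ha, hb, hc]
      push_cast
      ring
  have hz : Module.finrank R (LinearMap.range (δ N)) = 0 := by
    have := hN₃ N h₃
    rw [LinearMap.range_eq_bot.2 (LinearMap.ext fun x => by
      rw [Subsingleton.elim x 0, map_zero, map_zero])]
    exact finrank_bot _ _
  have h := key N
  rw [hz] at h
  simp only [Finset.sum_range_succ _ N] at h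
  have := hN₁ N h₁
  have := hN₂ N h₂
  have := hN₃ N h₃
  simpa [Module.finrank_zero_of_subsingleton] using h

end LongExact

end Graded

universe v u

variable {R : Type v} [CommRing R]

/-- The complex has finitely generated cohomology, zero in large degrees. -/
def EulerDefined (K : CochainComplex (ModuleCat.{u} R) ℕ) : Prop :=
  EulerFinite R fun p => K.homology p

/-- The Euler characteristic of a cochain complex. -/
def complexEuler (K : CochainComplex (ModuleCat.{u} R) ℕ) : ℤ :=
  eulerSum R fun p => K.homology p

theorem EulerDefined.of_iso {K L : CochainComplex (ModuleCat.{u} R) ℕ} (e : K ≅ L)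
    (h : EulerDefined K) : EulerDefined L := by
  let e' : ∀ p, K.homology p ≃ₗ[R] L.homology p := fun p =>
    ((HomologicalComplex.homologyFunctor _ _ p).mapIso e).toLinearEquiv
  obtain ⟨h1, N, hN⟩ := h
  refine ⟨fun p => Module.Finite.equiv (e' p), N, fun p hp => ?_⟩
  have := hN p hp
  exact (e' p).symm.toEquiv.subsingleton

theorem complexEuler_congr {K L : CochainComplex (ModuleCat.{u} R) ℕ} (e : K ≅ L) :
    complexEuler K = complexEuler L := by
  let e' : ∀ p, K.homology p ≃ₗ[R] L.homology p := fun p =>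
    ((HomologicalComplex.homologyFunctor _ _ p).mapIso e).toLinearEquiv
  exact finsum_congr fun p => by congr 2; exact LinearEquiv.finrank_eq (e' p)

theorem subsingleton_homology_of_exact (K : CochainComplex (ModuleCat.{u} R) ℕ)
    (h0 : ∀ x : K.X 0, K.d 0 1 x = 0 → x = 0)
    (h : ∀ p, ∀ x : K.X (p + 1), K.d (p + 1) (p + 2) x = 0 → ∃ y : K.X p, K.d p (p + 1) y = x)
    (p : ℕ) : Subsingleton (K.homology p) := by
  rw [← ModuleCat.isZero_iff_subsingleton, ← HomologicalComplex.exactAt_iff_isZero_homology]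
  cases p with
  | zero =>
    rw [K.exactAt_iff' 0 0 1 (by simp) (by simp), ShortComplex.moduleCat_exact_iff]
    intro x hx
    exact ⟨0, by rw [map_zero]; exact (h0 x hx).symm⟩
  | succ p =>
    rw [K.exactAt_iff' p (p + 1) (p + 2) (by simp) (by simp), ShortComplex.moduleCat_exact_iff]
    exact h p

theorem eulerDefined_of_acyclic {K : CochainComplex (ModuleCat.{u} R) ℕ}
    (h : ∀ p, Subsingleton (K.homology p)) : EulerDefined K :=
  ⟨fun _ => inferInstance, 0, fun p _ => h p⟩

theorem complexEuler_of_acyclic [Nontrivial R] {K : CochainComplex (ModuleCat.{u} R) ℕ}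
    (h : ∀ p, Subsingleton (K.homology p)) : complexEuler K = 0 := by
  rw [complexEuler, eulerSum_eq_sum_range (N := 0) fun p _ => h p]
  simp

section ShortExact

variable {S : ShortComplex (CochainComplex (ModuleCat.{u} R) ℕ)} (hS : S.ShortExact)

include hS

/-- No differential enters degree 0, so homology there is the module of cycles, on which a
monomorphism stays injective. -/
theorem homologyMap_zero_injective :
    Function.Injective (HomologicalComplex.homologyMap S.f 0) := by
  have := hS.mono_f
  rw [← ModuleCat.mono_iff_injective]
  have h1 := S.X₁.isIso_homologyπ 0 0 (by simp) (by simp)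
  have h2 := S.X₂.isIso_homologyπ 0 0 (by simp) (by simp)
  have h3 := HomologicalComplex.homologyπ_naturality S.f 0
  rw [← IsIso.eq_inv_comp] at h3
  rw [h3]
  infer_instance

theorem EulerDefined.middle [IsNoetherianRing R] (h1 : EulerDefined S.X₁) (h3 : EulerDefined S.X₃) :
    EulerDefined S.X₂ :=
  EulerFinite.middle (fun p => (HomologicalComplex.homologyMap S.f p).hom)
    (fun p => (HomologicalComplex.homologyMap S.g p).hom)
    (fun p => (ShortComplex.ShortExact.moduleCat_exact_iff_function_exact _).1
      (hS.homology_exact₂ p)) h1 h3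

theorem EulerDefined.right [IsNoetherianRing R] (h1 : EulerDefined S.X₁) (h2 : EulerDefined S.X₂) :
    EulerDefined S.X₃ :=
  EulerFinite.right 
    (fun p => (HomologicalComplex.homologyMap S.g p).hom)
    (fun p => (hS.δ p (p + 1) rfl).hom)
    (fun p => (ShortComplex.ShortExact.moduleCat_exact_iff_function_exact _).1
      (hS.homology_exact₃ p (p + 1) rfl)) h1 h2

theorem EulerDefined.left [IsNoetherianRing R] (h2 : EulerDefined S.X₂) (h3 : EulerDefined S.X₃) :
    EulerDefined S.X₁ :=
  EulerFinite.left (fun p => (HomologicalComplex.homologyMap S.f p).hom)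
    (fun p => (hS.δ p (p + 1) rfl).hom)
    (fun p => (ShortComplex.ShortExact.moduleCat_exact_iff_function_exact _).1
      (hS.homology_exact₁ p (p + 1) rfl)) (homologyMap_zero_injective hS) h2 h3

theorem complexEuler_add [IsDomain R] (h1 : EulerDefined S.X₁) (h2 : EulerDefined S.X₂)
    (h3 : EulerDefined S.X₃) : complexEuler S.X₂ = complexEuler S.X₁ + complexEuler S.X₃ :=
  eulerSum_add_of_longExact (fun p => (HomologicalComplex.homologyMap S.f p).hom)
    (fun p => (HomologicalComplex.homologyMap S.g p).hom)
    (fun p => (hS.δ p (p + 1) rfl).hom)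
    (fun p => (ShortComplex.ShortExact.moduleCat_exact_iff_function_exact _).1
      (hS.homology_exact₂ p))
    (fun p => (ShortComplex.ShortExact.moduleCat_exact_iff_function_exact _).1
      (hS.homology_exact₃ p (p + 1) rfl))
    (fun p => (ShortComplex.ShortExact.moduleCat_exact_iff_function_exact _).1
      (hS.homology_exact₁ p (p + 1) rfl)) (homologyMap_zero_injective hS) h1 h2 h3

end ShortExact

end

/-! ### Quotients of a complex by subcomplexes -/

noncomputable section

open CategoryTheory

universe v u

section RelComplex

variable {R : Type v} [CommRing R] (M : ℕ → Type u) [∀ p, AddCommGroup (M p)] [∀ p, Module R (M p)]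
  (d : ∀ p, M p →ₗ[R] M (p + 1)) (hd : ∀ p, (d (p + 1)).comp (d p) = 0)

/-- The quotient `M / S` of a complex of abelian groups by a subcomplex. -/
def relComplex (S : ∀ p, Submodule R (M p)) (hS : ∀ p, S p ≤ (S (p + 1)).comap (d p)) :
    CochainComplex (ModuleCat.{u} R) ℕ :=
  CochainComplex.of (fun p => ModuleCat.of R (M p ⧸ S p))
    (fun p => ModuleCat.ofHom ((S p).mapQ (S (p + 1)) (d p) (hS p)))
    (fun p => by
      rw [← ModuleCat.ofHom_comp, ← Submodule.mapQ_comp]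
      congr 1
      refine Submodule.linearMap_qext _ (LinearMap.ext fun x => ?_)
      simp [hd])

variable {M} {d} {hd}

theorem relComplex_d_mk {S : ∀ p, Submodule R (M p)} {hS : ∀ p, S p ≤ (S (p + 1)).comap (d p)}
    (p : ℕ) (x : M p) : (relComplex M d hd S hS).d p (p + 1) ((S p).mkQ x) =
      (S (p + 1)).mkQ (d p x) := by
  simp only [relComplex]
  rw [CochainComplex.of_d]
  rfl

/-- Relative cocycles and coboundaries are expressed through representatives, so that the acyclicity
proofs below can work with actual cochains. -/
theorem subsingleton_homology_relComplex {S : ∀ p, Submodule R (M p)}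
    {hS : ∀ p, S p ≤ (S (p + 1)).comap (d p)} (h0 : ∀ x, d 0 x ∈ S 1 → x ∈ S 0)
    (h : ∀ p x, d (p + 1) x ∈ S (p + 2) → ∃ y, x - d p y ∈ S (p + 1)) (p : ℕ) :
    Subsingleton ((relComplex M d hd S hS).homology p) := by
  refine subsingleton_homology_of_exact _ (fun x hx => ?_) (fun p x hx => ?_) p
  · obtain ⟨x, rfl⟩ := (S 0).mkQ_surjective x
    rw [relComplex_d_mk] at hx
    exact (Submodule.Quotient.mk_eq_zero _).2 (h0 x ((Submodule.Quotient.mk_eq_zero _).1 hx))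
  · obtain ⟨x, rfl⟩ := (S _).mkQ_surjective x
    rw [relComplex_d_mk] at hx
    obtain ⟨y, hy⟩ := h p x ((Submodule.Quotient.mk_eq_zero _).1 hx)
    refine ⟨(S p).mkQ y, ?_⟩
    rw [relComplex_d_mk]
    exact ((Submodule.Quotient.eq _).2 hy).symm

section Map

variable {M' : ℕ → Type u} [∀ p, AddCommGroup (M' p)] [∀ p, Module R (M' p)]
  {d' : ∀ p, M' p →ₗ[R] M' (p + 1)} {hd' : ∀ p, (d' (p + 1)).comp (d' p) = 0}
  {S : ∀ p, Submodule R (M p)} {hS : ∀ p, S p ≤ (S (p + 1)).comap (d p)}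
  {S' : ∀ p, Submodule R (M' p)} {hS' : ∀ p, S' p ≤ (S' (p + 1)).comap (d' p)}
  (φ : ∀ p, M p →ₗ[R] M' p) (hφ : ∀ p, (φ (p + 1)).comp (d p) = (d' p).comp (φ p))
  (hφS : ∀ p, S p ≤ (S' p).comap (φ p))

/-- The map of quotient complexes induced by a map of complexes. -/
def relComplexMap : relComplex M d hd S hS ⟶ relComplex M' d' hd' S' hS' :=
  CochainComplex.ofHom
    (fun p => ModuleCat.ofHom ((S p).mapQ (S' p) (φ p) (hφS p)))
    (fun p => by
      refine ModuleCat.hom_ext (LinearMap.ext fun x => ?_)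
      obtain ⟨x, rfl⟩ := (S p).mkQ_surjective x
      change (relComplex M' d' hd' S' hS').d p (p + 1) ((S' p).mkQ (φ p x)) =
        (S (p + 1)).mapQ (S' (p + 1)) (φ (p + 1)) (hφS (p + 1))
          ((relComplex M d hd S hS).d p (p + 1) ((S p).mkQ x))
      rw [relComplex_d_mk, relComplex_d_mk, Submodule.mkQ_apply, Submodule.mkQ_apply,
        Submodule.mapQ_apply]
      exact congrArg _ (DFunLike.congr_fun (hφ p) x).symm)

theorem relComplexMap_mk (p : ℕ) (x : M p) :
    (relComplexMap (hd := hd) (hd' := hd') (hS := hS) (hS' := hS') φ hφ hφS).f p ((S p).mkQ x) =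
      (S' p).mkQ (φ p x) := rfl

/-- A map of quotient complexes that is bijective in each degree is an isomorphism. -/
def relComplexIso (hinj : ∀ p x, φ p x ∈ S' p → x ∈ S p)
    (hsurj : ∀ p y, ∃ x, y - φ p x ∈ S' p) :
    relComplex M d hd S hS ≅ relComplex M' d' hd' S' hS' := by
  have : ∀ p, IsIso ((relComplexMap (hd := hd) (hd' := hd') (hS := hS) (hS' := hS') φ hφ hφS).f p) := by
    intro p
    rw [ConcreteCategory.isIso_iff_bijective]
    constructor
    · refine (injective_iff_map_eq_zero _).2 fun x hx => ?_
      obtain ⟨x, rfl⟩ := (S _).mkQ_surjective x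
      rw [relComplexMap_mk] at hx
      exact (Submodule.Quotient.mk_eq_zero _).2 (hinj p x ((Submodule.Quotient.mk_eq_zero _).1 hx))
    · intro y
      obtain ⟨y, rfl⟩ := (S' _).mkQ_surjective y
      obtain ⟨x, hx⟩ := hsurj p y
      refine ⟨(S p).mkQ x, ?_⟩
      rw [relComplexMap_mk]
      exact ((Submodule.Quotient.eq _).2 hx).symm
  exact HomologicalComplex.Hom.isoOfComponents
    (fun p => asIso ((relComplexMap (hd := hd) (hd' := hd') (hS := hS) (hS' := hS') φ hφ hφS).f p))
    (fun i j _ => (relComplexMap (hd := hd) (hd' := hd') (hS := hS) (hS' := hS') φ hφ hφS).comm i j)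

end Map

section ShortExact

variable {S T : ∀ p, Submodule R (M p)} (hS : ∀ p, S p ≤ (S (p + 1)).comap (d p))
  (hT : ∀ p, T p ≤ (T (p + 1)).comap (d p)) (hST : ∀ p, S p ≤ T p)

variable (d hd) in
/-- The subcomplex `T / S` of `M / S`. -/
def subRelComplex (S : ∀ p, Submodule R (M p)) {T : ∀ p, Submodule R (M p)}
    (hS : ∀ p, S p ≤ (S (p + 1)).comap (d p)) (hT : ∀ p, T p ≤ (T (p + 1)).comap (d p)) :
    CochainComplex (ModuleCat.{u} R) ℕ :=
  relComplex (fun p => T p) (fun p => (d p).restrict (hT p))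
    (fun p => by
      ext x
      exact DFunLike.congr_fun (hd p) (x : M p))
    (fun p => (S p).comap (T p).subtype) (fun p _ hx => hS p hx)

/-- The short exact sequence `0 → T / S → M / S → M / T → 0`. -/
def relShortComplex : ShortComplex (CochainComplex (ModuleCat.{u} R) ℕ) where
  X₁ := subRelComplex d hd S hS hT
  X₂ := relComplex M d hd S hS
  X₃ := relComplex M d hd T hT
  f := relComplexMap (fun p => (T p).subtype) (fun _ => rfl) (fun _ => le_rfl)
  g := relComplexMap (fun _ => LinearMap.id) (fun _ => rfl) hST
  zero := by
    refine HomologicalComplex.hom_ext _ _ fun p => ModuleCat.hom_ext (LinearMap.ext fun x => ?_)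
    obtain ⟨x, rfl⟩ := Submodule.mkQ_surjective _ x
    exact (Submodule.Quotient.mk_eq_zero _).2 x.2

theorem relShortComplex_shortExact :
    (relShortComplex (hd := hd) hS hT hST).ShortExact := by
  apply HomologicalComplex.shortExact_of_degreewise_shortExact
  intro p
  refine ModuleCat.shortComplex_shortExact _ ?_ ?_ ?_
  · intro x
    obtain ⟨x, rfl⟩ := (S p).mkQ_surjective x
    constructor
    · intro hx
      have hx : x ∈ T p := (Submodule.Quotient.mk_eq_zero _).1 hx
      exact ⟨Submodule.mkQ _ ⟨x, hx⟩, rfl⟩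
    · rintro ⟨y, hy⟩
      obtain ⟨y, rfl⟩ := Submodule.mkQ_surjective _ y
      rw [← hy]
      exact (Submodule.Quotient.mk_eq_zero _).2 y.2
  · refine (injective_iff_map_eq_zero _).2 fun x hx => ?_
    obtain ⟨x, rfl⟩ := Submodule.mkQ_surjective _ x
    have hx : (S p).mkQ (x : M p) = 0 := hx
    exact (Submodule.Quotient.mk_eq_zero _).2 ((Submodule.Quotient.mk_eq_zero (S p)).1 hx)
  · intro x
    obtain ⟨x, rfl⟩ := (T p).mkQ_surjective x
    exact ⟨(S p).mkQ x, rfl⟩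

end ShortExact

end RelComplex

end

/-! ### The prism homotopy on Alexander–Spanier cochains -/

noncomputable section

open CategoryTheory

namespace AlexanderSpanier

universe u

section Prism

variable {X : Type*}

/-- The prism operator of a (not necessarily continuous) self-map `r`, a cochain homotopy between
the identity and the pullback by `r`. -/
def prism (r : X → X) : ∀ p : ℕ, ((Fin (p + 1 + 1) → X) → ℤ) → ((Fin (p + 1) → X) → ℤ)
  | 0, f => fun y => f (Fin.cons (y 0) (fun _ => r (y 0)))
  | p + 1, f => fun y => f (Fin.cons (y 0) (fun i => r (y i))) -
      prism r p (fun z => f (Fin.cons (y 0) z)) (Fin.tail y)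

theorem prism_succ (r : X → X) (p : ℕ) (f : (Fin (p + 1 + 1 + 1) → X) → ℤ)
    (y : Fin (p + 1 + 1) → X) : prism r (p + 1) f y = f (Fin.cons (y 0) (fun i => r (y i))) -
      prism r p (fun z => f (Fin.cons (y 0) z)) (Fin.tail y) := rfl

theorem coboundary_apply (p : ℕ) (f : (Fin (p + 1) → X) → ℤ) (y : Fin (p + 2) → X) :
    coboundary X p f y = ∑ i : Fin (p + 2), (-1) ^ (i : ℕ) * f (fun j => y (i.succAbove j)) := rfl

/-- Deleting `x` gives `f y`; every other face keeps `x`, and its index is shifted by one, whence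
the minus sign. This makes inductions on the number of vertices possible. -/
theorem coboundary_cons (p : ℕ) (f : (Fin (p + 1 + 1) → X) → ℤ) (x : X) (y : Fin (p + 2) → X) :
    coboundary X (p + 1) f (Fin.cons x y) =
      f y - coboundary X p (fun z => f (Fin.cons x z)) y := by
  rw [coboundary_apply, coboundary_apply, Fin.sum_univ_succ, sub_eq_add_neg,
    ← Finset.sum_neg_distrib]
  congr 1
  · simp
  · refine Finset.sum_congr rfl fun i _ => ?_
    rw [Fin.val_succ, pow_succ]
    have : (fun j => (Fin.cons x y : Fin (p + 3) → X) (i.succ.succAbove j)) =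
        Fin.cons x (fun j => y (i.succAbove j)) := by
      funext j
      refine Fin.cases ?_ (fun j => ?_) j
      · simp
      · simp
    rw [this]
    ring

theorem coboundary_zero_apply (f : (Fin (0 + 1) → X) → ℤ) (y : Fin 2 → X) :
    coboundary X 0 f y = f (fun _ => y 1) - f (fun _ => y 0) := by
  rw [coboundary_apply, Fin.sum_univ_two, sub_eq_add_neg]
  congr 1
  · rw [Fin.val_zero, pow_zero, one_mul]
    congr 1
    funext j
    fin_cases j
    rfl
  · rw [Fin.val_one, pow_one, neg_one_mul]
    congr 2
    funext j
    fin_cases j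
    rfl

theorem prism_sub (r : X → X) : ∀ (p : ℕ) (f g : (Fin (p + 1 + 1) → X) → ℤ)
    (y : Fin (p + 1) → X), prism r p (f - g) y = prism r p f y - prism r p g y
  | 0, f, g, y => by simp [prism]
  | p + 1, f, g, y => by
    have := prism_sub r p (fun z => f (Fin.cons (y 0) z)) (fun z => g (Fin.cons (y 0) z))
      (Fin.tail y)
    simp only [prism, Pi.sub_apply]
    rw [show (fun z => f (Fin.cons (y 0) z) - g (Fin.cons (y 0) z)) =
      (fun z => f (Fin.cons (y 0) z)) - (fun z => g (Fin.cons (y 0) z)) from rfl, this]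
    ring

/-- Unfolded, the prism is the alternating sum of `f` over the tuples `(y₀, …, yᵢ, r yᵢ, …, r yₚ)`.
Fixing the first vertex, `coboundary_cons` reduces the identity in degree `p + 1` to that for the
slice of `f` in degree `p`; the remaining terms cancel in pairs. -/
theorem coboundary_prism (r : X → X) : ∀ (p : ℕ) (f : (Fin (p + 1 + 1) → X) → ℤ)
    (y : Fin (p + 2) → X), coboundary X p (prism r p f) y +
      prism r (p + 1) (coboundary X (p + 1) f) y = f (fun i => r (y i)) - f y
  | 0, f, y => by
    obtain ⟨a, b, rfl⟩ : ∃ a b, y = Fin.cons a (fun _ => b) := by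
      refine ⟨y 0, y 1, ?_⟩
      funext i
      fin_cases i <;> rfl
    have e : (fun i => r ((Fin.cons a (fun _ => b) : Fin 2 → X) i)) =
        Fin.cons (r a) (fun _ => r b) := by
      funext i
      fin_cases i <;> rfl
    have e' : Fin.tail (Fin.cons a (fun _ => b) : Fin 2 → X) = fun _ => b := by
      funext i
      rfl
    rw [coboundary_zero_apply]
    simp only [prism, Fin.cons_zero, e']
    rw [coboundary_cons, coboundary_cons, coboundary_zero_apply, e]
    have e1 : (Fin.cons a (fun _ => b) : Fin 2 → X) 1 = b := rfl
    have e2 : (fun z => coboundary X 0 (fun z => f (Fin.cons a z)) z) =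
      coboundary X 0 (fun z => f (Fin.cons a z)) := rfl
    simp only [e1, coboundary_zero_apply]
    simp only [Fin.cons_zero]
    have e3 : ∀ c : X, (Fin.cons b (fun _ => c) : Fin 2 → X) 1 = c := fun _ => rfl
    simp only [e3]
    ring
  | p + 1, f, y => by
    obtain ⟨a, y, rfl⟩ : ∃ a z, y = Fin.cons a z := ⟨y 0, Fin.tail y, by simp⟩
    have ih := coboundary_prism r p (fun z => f (Fin.cons a z)) y
    have e : (fun i => r ((Fin.cons a y : Fin (p + 3) → X) i)) =
        Fin.cons (r a) (fun i => r (y i)) := by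
      funext i
      refine Fin.cases ?_ (fun j => ?_) i <;> simp
    rw [coboundary_cons, prism_succ r (p + 1) _ (Fin.cons a y), Fin.cons_zero, Fin.tail_cons, coboundary_cons, e]
    have h1 : (fun z => coboundary X (p + 2) f (Fin.cons a z)) =
        f - coboundary X (p + 1) (fun z => f (Fin.cons a z)) := by
      funext z
      exact coboundary_cons _ _ _ _
    have h2 : (fun z => prism r (p + 1) f (Fin.cons a z)) =
        (fun z => f (Fin.cons a (Fin.cons (r a) (fun i => r (z i))))) -
          prism r p (fun z => f (Fin.cons a z)) := by
      funext z
      have e : (fun i => r ((Fin.cons a z : Fin (p + 2) → X) i)) =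
          Fin.cons (r a) (fun i => r (z i)) := by
        funext i
        refine Fin.cases ?_ (fun j => ?_) i <;> simp
      rw [prism_succ, Fin.cons_zero, Fin.tail_cons, e]
      rfl
    rw [h1, prism_sub, h2, map_sub, Pi.sub_apply, coboundary_cons]
    have h3 : coboundary X p (fun z => f (Fin.cons a (Fin.cons (r a) (fun i => r (z i))))) y =
        coboundary X p (fun z => f (Fin.cons a (Fin.cons (r a) z))) (fun i => r (y i)) := rfl
    rw [h3]
    linear_combination ih

/-- Locality of the prism: it evaluates `f` only on tuples of points `y i` and `r (y i)` that begin
with `y 0`. No continuity of `r` enters, and the clause on the first vertex serves to control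
supports. -/
theorem prism_eq_zero (r : X → X) : ∀ (p : ℕ) (f : (Fin (p + 1 + 1) → X) → ℤ)
    (y : Fin (p + 1) → X),
    (∀ z, z 0 = y 0 → (∀ j, ∃ i, z j = y i ∨ z j = r (y i)) → f z = 0) → prism r p f y = 0
  | 0, f, y, h => by
    refine h _ rfl fun j => ?_
    fin_cases j
    · exact ⟨0, Or.inl rfl⟩
    · exact ⟨0, Or.inr rfl⟩
  | p + 1, f, y, h => by
    rw [prism_succ, h _ rfl, prism_eq_zero r p, sub_zero]
    · intro z _ hz
      refine h _ rfl fun j => ?_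
      refine Fin.cases ⟨0, Or.inl rfl⟩ (fun j => ?_) j
      obtain ⟨i, hi⟩ := hz j
      exact ⟨i.succ, by simpa [Fin.tail] using hi⟩
    · intro j
      refine Fin.cases ⟨0, Or.inl rfl⟩ (fun j => ?_) j
      exact ⟨j, Or.inr (by simp)⟩

end Prism

/-! ### Supports and functoriality -/

section Support

variable {X : Type*} [TopologicalSpace X] {p : ℕ}

theorem notMem_support {f : (Fin (p + 1) → X) → ℤ} {x : X} :
    x ∉ support f ↔ ∃ V ∈ 𝓝 x, ∀ y : Fin (p + 1) → X, (∀ i, y i ∈ V) → f y = 0 := by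
  simp [support]

theorem support_eq_empty {f : (Fin (p + 1) → X) → ℤ} :
    support f = ∅ ↔
      ∀ x, ∃ V ∈ 𝓝 x, ∀ y : Fin (p + 1) → X, (∀ i, y i ∈ V) → f y = 0 := by
  simp_rw [Set.eq_empty_iff_forall_notMem, notMem_support]

theorem mem_locallyZero {f : compactCochains X p} :
    f ∈ locallyZero X p ↔ ∀ x, ∃ V ∈ 𝓝 x, ∀ y : Fin (p + 1) → X, (∀ i, y i ∈ V) →
      (f : (Fin (p + 1) → X) → ℤ) y = 0 :=
  support_eq_empty

theorem support_subset_of_isClosed {f : (Fin (p + 1) → X) → ℤ} {K : Set X} (hK : IsClosed K)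
    (h : ∀ y, (∃ i, y i ∉ K) → f y = 0) : support f ⊆ K := by
  intro x hx
  by_contra hxK
  exact notMem_support.2 ⟨Kᶜ, hK.isOpen_compl.mem_nhds hxK, fun y hy => h y ⟨0, hy 0⟩⟩ hx

theorem mem_compactCochains_of_isCompact [T2Space X] {f : (Fin (p + 1) → X) → ℤ} {K : Set X}
    (hK : IsCompact K) (h : ∀ y, (∃ i, y i ∉ K) → f y = 0) : f ∈ compactCochains X p :=
  hK.of_isClosed_subset (isClosed_support f) (support_subset_of_isClosed hK.isClosed h)

theorem compactCoboundary_comp (X : Type*) [TopologicalSpace X] (p : ℕ) :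
    (compactCoboundary X (p + 1)).comp (compactCoboundary X p) = 0 :=
  LinearMap.ext fun f => Subtype.ext (coboundary_coboundary X p f)

theorem compactComplex_eq (X : Type u) [TopologicalSpace X] :
    compactComplex X = relComplex (fun p => compactCochains X p) (compactCoboundary X)
      (compactCoboundary_comp X) (locallyZero X) (locallyZero_le_comap X) := rfl

variable {Y : Type*} [TopologicalSpace Y]

theorem support_comp_subset {φ : Y → X} (hφ : Continuous φ) (f : (Fin (p + 1) → X) → ℤ) :
    support (fun y => f (fun i => φ (y i))) ⊆ φ ⁻¹' support f := by
  intro y hy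
  by_contra h
  obtain ⟨V, hV, h⟩ := notMem_support.1 (show φ y ∉ support f from h)
  exact notMem_support.2 ⟨φ ⁻¹' V, hφ.continuousAt hV, fun z hz => h _ hz⟩ hy

/-- Pullback of cochains with compact support by a continuous map such that preimages of compact
sets are compact. -/
def compactPullback (φ : Y → X) (hφ : Continuous φ)
    (hc : ∀ K, IsCompact K → IsCompact (φ ⁻¹' K)) (p : ℕ) :
    compactCochains X p →ₗ[ℤ] compactCochains Y p where
  toFun f := ⟨fun y => (f : (Fin (p + 1) → X) → ℤ) (fun i => φ (y i)),
    (hc _ f.2).of_isClosed_subset (isClosed_support _) (support_comp_subset hφ _)⟩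
  map_add' _ _ := rfl
  map_smul' _ _ := rfl

theorem locallyZero_le_comap_compactPullback (φ : Y → X) (hφ : Continuous φ)
    (hc : ∀ K, IsCompact K → IsCompact (φ ⁻¹' K)) (p : ℕ) :
    locallyZero X p ≤ (locallyZero Y p).comap (compactPullback φ hφ hc p) := by
  intro f hf
  refine Set.subset_empty_iff.1 ((support_comp_subset hφ _).trans ?_)
  rw [show support (f : (Fin (p + 1) → X) → ℤ) = ∅ from hf, Set.preimage_empty]

end Support

/-- A homeomorphism induces an isomorphism of the complexes of cochains with compact support. -/
def compactComplexCongr {X Y : Type u} [TopologicalSpace X] [TopologicalSpace Y] (e : Y ≃ₜ X) :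
    compactComplex X ≅ compactComplex Y :=
  relComplexIso (hd := compactCoboundary_comp X) (hd' := compactCoboundary_comp Y)
    (hS := locallyZero_le_comap X) (hS' := locallyZero_le_comap Y)
    (fun p => compactPullback e e.continuous (fun _ hK => e.isCompact_preimage.2 hK) p)
    (fun _ => rfl) (fun p => locallyZero_le_comap_compactPullback e e.continuous _ p)
    (fun p f hf => by
      have h := locallyZero_le_comap_compactPullback e.symm e.symm.continuous
        (fun _ hK => e.symm.isCompact_preimage.2 hK) p hf
      refine (congrArg (· ∈ locallyZero X p) ?_).mp h
      ext y
      exact congrArg _ (funext fun i => e.apply_symm_apply (y i)))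
    (fun p f => ⟨compactPullback e.symm e.symm.continuous
        (fun _ hK => e.symm.isCompact_preimage.2 hK) p f, by
      refine (congrArg (· ∈ locallyZero Y p) ?_).mp (locallyZero Y p).zero_mem
      rw [eq_comm, sub_eq_zero]
      ext y
      exact congrArg _ (funext fun i => (e.symm_apply_apply (y i)).symm)⟩)

/-! ### Closed subspaces and their complements -/

section ClosedOpen

variable {X : Type u} [TopologicalSpace X] (Z : Set X)

/-- The cochains whose support does not meet `Z`. -/
def vanishingNear (p : ℕ) : Submodule ℤ (compactCochains X p) where
  carrier := {f | ∀ x ∈ Z, x ∉ support (f : (Fin (p + 1) → X) → ℤ)}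
  zero_mem' x _ := by
    change x ∉ support (0 : (Fin (p + 1) → X) → ℤ)
    simp [support_zero]
  add_mem' {f g} hf hg x hx h := (support_add _ _ h).elim (hf x hx) (hg x hx)
  smul_mem' c f hf x hx h := hf x hx (support_smul _ _ h)

theorem vanishingNear_le_comap (p : ℕ) :
    vanishingNear Z p ≤ (vanishingNear Z (p + 1)).comap (compactCoboundary X p) :=
  fun _ hf x hx h => hf x hx (support_coboundary _ h)

theorem locallyZero_le_vanishingNear (p : ℕ) : locallyZero X p ≤ vanishingNear Z p :=
  fun _ hf x _ h => Set.notMem_empty x (hf ▸ h)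

variable {Z} (hZ : IsClosed Z)

/-- Restriction of cochains to a closed subspace. -/
abbrev restrictClosed (p : ℕ) : compactCochains X p →ₗ[ℤ] compactCochains Z p :=
  compactPullback Subtype.val continuous_subtype_val
    (fun _ hK => hZ.isClosedEmbedding_subtypeVal.isCompact_preimage hK) p

/-- The cochains whose restriction to `Z` is locally zero. -/
def vanishingOn (p : ℕ) : Submodule ℤ (compactCochains X p) :=
  (locallyZero Z p).comap (restrictClosed hZ p)

theorem vanishingOn_le_comap (p : ℕ) :
    vanishingOn hZ p ≤ (vanishingOn hZ (p + 1)).comap (compactCoboundary X p) :=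
  fun _ hf => locallyZero_le_comap Z p hf

theorem vanishingNear_le_vanishingOn (p : ℕ) : vanishingNear Z p ≤ vanishingOn hZ p := by
  intro f hf
  refine mem_locallyZero.2 fun x => ?_
  obtain ⟨V, hV, h⟩ := notMem_support.1 (hf x x.2)
  exact ⟨Subtype.val ⁻¹' V, continuous_subtype_val.continuousAt hV, fun y hy => h _ hy⟩

open Classical in
-- Extension by zero to tuples not contained in `Z`. As `Z` is closed, no point outside it enters
-- the support, which stays inside a compact image.
theorem exists_restrictClosed_eq [T2Space X] (p : ℕ) (f : compactCochains Z p) :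
    ∃ F, restrictClosed hZ p F = f := by
  set F : (Fin (p + 1) → X) → ℤ := fun y =>
    if h : ∀ i, y i ∈ Z then (f : (Fin (p + 1) → Z) → ℤ) (fun i => ⟨y i, h i⟩) else 0 with hF
  have hs : support F ⊆ Subtype.val '' support (f : (Fin (p + 1) → Z) → ℤ) := by
    intro x hx
    by_contra hxf
    refine notMem_support.2 ?_ hx
    by_cases hxZ : x ∈ Z
    · have : (⟨x, hxZ⟩ : Z) ∉ support (f : (Fin (p + 1) → Z) → ℤ) :=
        fun h => hxf ⟨_, h, rfl⟩
      obtain ⟨V, hV, h⟩ := notMem_support.1 this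
      obtain ⟨W, hW, hWV⟩ := mem_nhds_subtype _ _ _ |>.1 hV
      refine ⟨W, hW, fun y hy => ?_⟩
      simp only [hF]
      split_ifs with h'
      · exact h _ fun i => hWV (hy i)
      · rfl
    · refine ⟨Zᶜ, hZ.isOpen_compl.mem_nhds hxZ, fun y hy => ?_⟩
      simp only [hF]
      rw [dif_neg fun h' => hy 0 (h' 0)]
  refine ⟨⟨F, ((f.2 : IsCompact _).image continuous_subtype_val).of_isClosed_subset
    (isClosed_support _) hs⟩, ?_⟩
  ext y
  change F (fun i => y i) = _
  simp only [hF]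
  rw [dif_pos fun i => (y i).2]

/-- Cochains modulo those vanishing on `Z` compute the cohomology of `Z`. -/
def quotientVanishingOnIso [T2Space X] :
    relComplex (fun p => compactCochains X p) (compactCoboundary X)
      (compactCoboundary_comp X) (vanishingOn hZ) (vanishingOn_le_comap hZ) ≅ compactComplex Z :=
  relComplexIso (hd' := compactCoboundary_comp Z) (hS' := locallyZero_le_comap Z)
    (fun p => restrictClosed hZ p) (fun _ => rfl) (fun _ => le_rfl)
    (fun _ _ h => h) (fun p f => by
      obtain ⟨F, rfl⟩ := exists_restrictClosed_eq hZ p f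
      exact ⟨F, by rw [sub_self]; exact zero_mem _⟩)

/-- Restriction to the open complement of cochains whose support does not meet `Z`. -/
def restrictOpen (p : ℕ) : vanishingNear Z p →ₗ[ℤ] compactCochains (Zᶜ : Set X) p where
  toFun f := ⟨fun y => (f : compactCochains X p).1 (fun i => y i), by
    refine IsCompact.of_isClosed_subset ?_ (isClosed_support _)
      (support_comp_subset continuous_subtype_val _)
    rw [Topology.IsInducing.subtypeVal.isCompact_preimage_iff]
    · exact f.1.2
    · rw [Subtype.range_val]
      exact fun x hx hxZ => f.2 x hxZ hx⟩
  map_add' _ _ := rfl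
  map_smul' _ _ := rfl

open Classical in
-- Plain extension by zero may create support along `Z`, since the neighbourhoods on which `f`
-- vanishes can shrink towards `Z`. Cutting `f` off outside a compact neighbourhood of its support
-- prevents this and changes `f` only by a locally zero cochain.
theorem exists_restrictOpen_sub_mem [T2Space X] [LocallyCompactSpace X] (hZ : IsClosed Z) (p : ℕ)
    (f : compactCochains (Zᶜ : Set X) p) :
    ∃ F : vanishingNear Z p, f - restrictOpen p F ∈ locallyZero (Zᶜ : Set X) p := by
  have : LocallyCompactSpace (Zᶜ : Set X) := hZ.isOpen_compl.locallyCompactSpace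
  obtain ⟨K, hK, hfK⟩ := exists_compact_superset f.2
  set F : (Fin (p + 1) → X) → ℤ := fun y =>
    if h : ∀ i, ∃ h : y i ∈ Zᶜ, (⟨y i, h⟩ : (Zᶜ : Set X)) ∈ K then
      (f : (Fin (p + 1) → (Zᶜ : Set X)) → ℤ) (fun i => ⟨y i, (h i).1⟩) else 0 with hF
  have hF0 : ∀ y, (∃ i, y i ∉ Subtype.val '' K) → F y = 0 := by
    rintro y ⟨i, hi⟩
    simp only [hF]
    rw [dif_neg]
    exact fun h => hi ⟨_, (h i).2, rfl⟩
  have hK' : IsCompact (Subtype.val '' K) := hK.image continuous_subtype_val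
  refine ⟨⟨⟨F, mem_compactCochains_of_isCompact hK' hF0⟩, fun x hx hxs => ?_⟩, ?_⟩
  · obtain ⟨x', _, rfl⟩ := support_subset_of_isClosed hK'.isClosed hF0 hxs
    exact x'.2 hx
  · refine mem_locallyZero.2 fun x => ?_
    by_cases hx : x ∈ interior K
    · refine ⟨K, mem_interior_iff_mem_nhds.1 hx, fun y hy => ?_⟩
      change f.1 y - F (fun i => y i) = 0
      simp only [hF]
      rw [dif_pos fun i => ⟨(y i).2, hy i⟩]
      exact sub_self _
    · obtain ⟨V, hV, h⟩ := notMem_support.1 (fun h => hx (hfK h))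
      refine ⟨V, hV, fun y hy => ?_⟩
      change f.1 y - F (fun i => y i) = 0
      rw [h y hy]
      simp only [hF]
      split_ifs with h'
      · rw [zero_sub, neg_eq_zero]
        exact h y hy
      · rfl

/-- The cochains with support off `Z` compute the cohomology of the open complement of `Z`. -/
def vanishingNearIso [T2Space X] [LocallyCompactSpace X] (hZ : IsClosed Z) :
    subRelComplex (compactCoboundary X) (compactCoboundary_comp X) (locallyZero X)
      (locallyZero_le_comap X) (vanishingNear_le_comap Z) ≅ compactComplex (Zᶜ : Set X) :=
  relComplexIso (hd' := compactCoboundary_comp _) (hS' := locallyZero_le_comap _)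
    (fun p => restrictOpen p) (fun _ => rfl)
    (fun p f hf => by
      refine mem_locallyZero.2 fun x => ?_
      obtain ⟨V, hV, h⟩ := mem_locallyZero.1 hf x
      exact ⟨Subtype.val ⁻¹' V, continuous_subtype_val.continuousAt hV, fun y hy => h _ hy⟩)
    (fun p f hf => by
      refine mem_locallyZero.2 fun x => ?_
      by_cases hx : x ∈ Z
      · exact notMem_support.1 (f.2 x hx)
      · obtain ⟨V, hV, h⟩ := mem_locallyZero.1 hf ⟨x, hx⟩
        rw [nhds_subtype_eq_comap, Filter.mem_comap] at hV
        obtain ⟨W, hW, hWV⟩ := hV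
        exact ⟨W ∩ Zᶜ, Filter.inter_mem hW (hZ.isOpen_compl.mem_nhds hx), fun y hy =>
          h (fun i => ⟨y i, (hy i).2⟩) fun i => hWV (hy i).1⟩)
    (fun p f => exists_restrictOpen_sub_mem hZ p f)

end ClosedOpen

end AlexanderSpanier

end

/-! ### Tautness of closed subspaces and acyclicity of half-cylinders -/

noncomputable section

open CategoryTheory

namespace AlexanderSpanier

universe u

/-- For a nonempty closed subset of a metric space there is a retraction onto it, continuous at its
points. -/
theorem exists_retraction {X : Type*} [MetricSpace X] {Z : Set X} (hZ : IsClosed Z)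
    (hne : Z.Nonempty) : ∃ r : X → X, (∀ x, r x ∈ Z) ∧ (∀ x ∈ Z, r x = x) ∧
      ∀ x ∈ Z, ContinuousAt r x := by
  -- A point of `Z` that is nearest up to a factor 2. For `x ∈ Z` this gives `dist (r y) x ≤ 3 *
  -- dist y x`, hence the `ε / 3` below.
  have h : ∀ x, ∃ z ∈ Z, x ∉ Z → dist x z < 2 * Metric.infDist x Z := by
    intro x
    by_cases hx : x ∈ Z
    · exact ⟨x, hx, fun h => (h hx).elim⟩
    · have hpos := (hZ.notMem_iff_infDist_pos hne).1 hx
      obtain ⟨z, hz, hd⟩ := (Metric.infDist_lt_iff hne (r := 2 * Metric.infDist x Z)).1 (by linarith)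
      exact ⟨z, hz, fun _ => hd⟩
  choose r hrZ hr using h
  classical
  refine ⟨fun x => if x ∈ Z then x else r x, fun x => ?_, fun x hx => if_pos hx, fun x hx => ?_⟩
  · dsimp only
    split_ifs with h
    exacts [h, hrZ x]
  · rw [Metric.continuousAt_iff]
    intro ε hε
    refine ⟨ε / 3, by positivity, fun y hy => ?_⟩
    rw [if_pos hx]
    split_ifs with h
    · linarith
    · have h1 := hr y h
      have h2 := Metric.infDist_le_dist_of_mem (x := y) hx
      have h3 := dist_triangle (r y) y x
      rw [dist_comm (r y) y] at h3
      linarith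

section Taut

variable {X : Type u} [MetricSpace X] [LocallyCompactSpace X] {Z : Set X} (hZ : IsClosed Z)

open Classical in
-- Tautness of `Z`. For a retraction `r` onto `Z` the prism identity reads `f + δ (prism f) = f ∘ r
-- - prism (δ f)`. Near a point of `Z` both terms on the right vanish: the first since `r` has
-- values in `Z`, the second since `δ f` is zero near `Z`. Continuity of `r` at the points of `Z`
-- keeps all the tuples small.
theorem exists_sub_mem_vanishingNear (p : ℕ) (f : compactCochains X (p + 1))
    (hf : f ∈ vanishingOn hZ (p + 1))
    (hδ : compactCoboundary X (p + 1) f ∈ vanishingNear Z (p + 2)) :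
    ∃ g ∈ vanishingOn hZ p, f - compactCoboundary X p g ∈ vanishingNear Z (p + 1) := by
  rcases Z.eq_empty_or_nonempty with rfl | hne
  · exact ⟨0, zero_mem _, fun x hx => hx.elim⟩
  obtain ⟨r, hrZ, hr, hrc⟩ := exists_retraction hZ hne
  obtain ⟨K, hK, hfK⟩ := exists_compact_superset f.2
  have hfZ : ∀ z ∈ Z, ∃ V ∈ 𝓝 z, ∀ y : Fin (p + 1 + 1) → X, (∀ i, y i ∈ V) → (∀ i, y i ∈ Z) →
      f.1 y = 0 := by
    intro z hz
    obtain ⟨V, hV, h⟩ := mem_locallyZero.1 hf ⟨z, hz⟩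
    rw [nhds_subtype_eq_comap, Filter.mem_comap] at hV
    obtain ⟨W, hW, hWV⟩ := hV
    exact ⟨W, hW, fun y hy hyZ => h (fun i => ⟨y i, hyZ i⟩) fun i => hWV (hy i)⟩
  -- The cutoff by `K` makes the primitive compactly supported, and the sign is that of the prism
  -- identity.
  set g : (Fin (p + 1) → X) → ℤ := fun y =>
    if ∀ i, y i ∈ K then - prism r p f.1 y else 0 with hg
  have hg0 : ∀ y, (∃ i, y i ∉ K) → g y = 0 := fun y ⟨i, hi⟩ => if_neg fun h => hi (h i)
  have hgD : ∀ y, prism r p f.1 y = 0 → g y = 0 := by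
    intro y hy
    simp only [hg, hy, neg_zero, ite_self]
  refine ⟨⟨g, mem_compactCochains_of_isCompact hK hg0⟩, ?_, fun z hz => ?_⟩
  · refine mem_locallyZero.2 fun z => ?_
    obtain ⟨V, hV, h⟩ := hfZ z z.2
    refine ⟨Subtype.val ⁻¹' V, continuous_subtype_val.continuousAt hV, fun y hy => hgD _ ?_⟩
    refine prism_eq_zero r p _ _ fun w _ hw => h w (fun j => ?_) fun j => ?_
    · obtain ⟨i, hi | hi⟩ := hw j
      · rw [hi]; exact hy i
      · rw [hi, hr _ (y i).2]; exact hy i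
    · obtain ⟨i, hi | hi⟩ := hw j
      · rw [hi]; exact (y i).2
      · rw [hi]; exact hrZ _
  -- In the interior of `K` the cutoff is invisible. Elsewhere `z` is off the support of `f`, and
  -- `f` and its prism are both zero on small tuples near `z`.
  · by_cases hzK : z ∈ interior K
    · obtain ⟨V₁, hV₁, h₁⟩ := hfZ z hz
      obtain ⟨V₂, hV₂, h₂⟩ := notMem_support.1 (hδ z hz)
      have hV : K ∩ V₁ ∩ V₂ ∈ 𝓝 z :=
        Filter.inter_mem (Filter.inter_mem (mem_interior_iff_mem_nhds.1 hzK) hV₁) hV₂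
      have hrV := hrc z hz (show K ∩ V₁ ∩ V₂ ∈ 𝓝 (r z) by rwa [hr z hz])
      refine notMem_support.2 ⟨_, Filter.inter_mem hV hrV, fun y hy => ?_⟩
      change f.1 y - coboundary X p g y = 0
      have e1 : coboundary X p g y = - coboundary X p (prism r p f.1) y := by
        rw [coboundary_apply, coboundary_apply, ← Finset.sum_neg_distrib]
        refine Finset.sum_congr rfl fun i _ => ?_
        simp only [hg]
        rw [if_pos fun j => (hy _).1.1.1]
        ring
      have e2 : f.1 (fun i => r (y i)) = 0 := h₁ _ (fun i => (hy i).2.1.2) fun i => hrZ _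
      have e3 : prism r (p + 1) (coboundary X (p + 1) f.1) y = 0 := by
        refine prism_eq_zero r _ _ _ fun w _ hw => h₂ w fun j => ?_
        obtain ⟨i, hi | hi⟩ := hw j
        · rw [hi]; exact (hy i).1.2
        · rw [hi]; exact (hy i).2.2
      have := coboundary_prism r p f.1 y
      rw [e1]
      linear_combination this + e2 - e3
    · obtain ⟨V, hV, h⟩ := notMem_support.1 (fun h => hzK (hfK h))
      have hrV := hrc z hz (show V ∈ 𝓝 (r z) by rwa [hr z hz])
      refine notMem_support.2 ⟨_, Filter.inter_mem hV hrV, fun y hy => ?_⟩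
      change f.1 y - coboundary X p g y = 0
      rw [h y fun i => (hy i).1, coboundary_apply, Finset.sum_eq_zero, sub_zero]
      intro i _
      rw [hgD, mul_zero]
      refine prism_eq_zero r p _ _ fun w _ hw => h w fun j => ?_
      obtain ⟨i, hi | hi⟩ := hw j
      · rw [hi]; exact (hy _).1
      · rw [hi]; exact (hy _).2

omit [LocallyCompactSpace X] in
-- In degree 0 a cochain with vanishing coboundary near `z` is constant near `z`, and its value at
-- `z ∈ Z` is zero.
theorem mem_vanishingNear_zero (f : compactCochains X 0) (hf : f ∈ vanishingOn hZ 0)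
    (hδ : compactCoboundary X 0 f ∈ vanishingNear Z 1) : f ∈ vanishingNear Z 0 := by
  intro z hz
  obtain ⟨V, hV, h⟩ := mem_locallyZero.1 hf ⟨z, hz⟩
  obtain ⟨W, hW, h'⟩ := notMem_support.1 (hδ z hz)
  have hz0 : f.1 (fun _ => z) = 0 := h (fun _ => ⟨z, hz⟩) fun _ => mem_of_mem_nhds hV
  refine notMem_support.2 ⟨W, hW, fun y hy => ?_⟩
  have := h' (Fin.cons z y) fun i => by
    refine Fin.cases ?_ (fun i => ?_) i
    · exact mem_of_mem_nhds hW
    · exact hy i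
  change coboundary X 0 f.1 _ = 0 at this
  rw [coboundary_zero_apply] at this
  have e : (fun _ => (Fin.cons z y : Fin 2 → X) 1 : Fin (0 + 1) → X) = y := by
    funext i; fin_cases i; rfl
  rw [e, show (fun _ => (Fin.cons z y : Fin 2 → X) 0 : Fin (0 + 1) → X) = fun _ => z from rfl,
    hz0, sub_zero] at this
  exact this

end Taut

section HalfLine

variable {Y : Type*} [MetricSpace Y]

/-- A cocycle that vanishes on tuples meeting the complement of a compact set satisfies the cocycle
condition on all sufficiently small tuples. -/
theorem exists_uniform_coboundary_eq_zero {p : ℕ} {f : (Fin (p + 1) → Y) → ℤ} {K : Set Y}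
    (hK : IsCompact K) (hfK : ∀ y, (∃ i, y i ∉ K) → f y = 0)
    (hδ : ∀ x, ∃ V ∈ 𝓝 x, ∀ y : Fin (p + 2) → Y, (∀ i, y i ∈ V) → coboundary Y p f y = 0) :
    ∃ ε > 0, ∀ y : Fin (p + 2) → Y, (∀ i j, dist (y i) (y j) < ε) → coboundary Y p f y = 0 := by
  choose V hV h using hδ
  -- A Lebesgue number makes the condition uniform for tuples meeting `K`; for tuples that miss `K`,
  -- every face already gives zero.
  obtain ⟨ε, hε, hL⟩ := lebesgue_number_lemma_of_metric (s := K) (c := fun x => interior (V x)) hK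
    (fun _ => isOpen_interior) (fun x _ => Set.mem_iUnion.2 ⟨x, mem_interior_iff_mem_nhds.2 (hV x)⟩)
  refine ⟨ε, hε, fun y hy => ?_⟩
  by_cases hyK : ∃ i, y i ∈ K
  · obtain ⟨i, hi⟩ := hyK
    obtain ⟨x, hx⟩ := hL _ hi
    exact h x y fun j => interior_subset (hx (Metric.mem_ball.2 (hy j i)))
  · push Not at hyK
    rw [coboundary_apply]
    exact Finset.sum_eq_zero fun i _ => by rw [hfK _ ⟨0, hyK _⟩, mul_zero]

/-- If a cocycle can be moved off its support by iterating a self-map with small displacement, it is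
a coboundary. -/
theorem exists_coboundary_of_shift {p : ℕ} {f : (Fin (p + 1 + 1) → Y) → ℤ} {K : Set Y}
    (hfK : ∀ y, (∃ i, y i ∉ K) → f y = 0) {ε : ℝ}
    (hε : ∀ y : Fin (p + 1 + 2) → Y, (∀ i j, dist (y i) (y j) < ε) →
      coboundary Y (p + 1) f y = 0) (s : Y → Y) (hs : ∀ x y, dist (s x) (s y) ≤ dist x y)
    (hsd : ∀ x, dist x (s x) ≤ ε / 2) (hsK : ∀ x, s x ∈ K → x ∈ K) (N : ℕ)
    (hN : ∀ x, s^[N] x ∉ K) :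
    ∃ g : (Fin (p + 1) → Y) → ℤ, (∀ y, y 0 ∉ K → g y = 0) ∧
      ∀ y : Fin (p + 2) → Y, (∀ i j, dist (y i) (y j) < ε / 2) → f y = coboundary Y p g y := by
  have hsi : ∀ k x y, dist (s^[k] x) (s^[k] y) ≤ dist x y := by
    intro k
    induction k with
    | zero => exact fun _ _ => le_rfl
    | succ k ih =>
        intro x y
        rw [Function.iterate_succ_apply, Function.iterate_succ_apply]
        exact (ih _ _).trans (hs _ _)
  have hsKi : ∀ k x, s^[k] x ∈ K → x ∈ K := by
    intro k
    induction k with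
    | zero => exact fun _ h => h
    | succ k ih => exact fun x hx => hsK _ (ih _ hx)
  -- The pullbacks of `f` by the iterates of `s`. Consecutive ones differ by the coboundary of a
  -- prism, at least on tuples of size below `ε / 2`: adding the points `s (y i)` then keeps all
  -- distances below `ε`.
  set F : ℕ → (Fin (p + 1 + 1) → Y) → ℤ := fun k y => f (fun i => s^[k] (y i)) with hF
  have step : ∀ k, ∀ y : Fin (p + 2) → Y, (∀ i j, dist (y i) (y j) < ε / 2) →
      F (k + 1) y - F k y = coboundary Y p (prism s p (F k)) y := by
    intro k y hy
    have h := coboundary_prism s p (F k) y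
    have h0 : prism s (p + 1) (coboundary Y (p + 1) (F k)) y = 0 := by
      refine prism_eq_zero s _ _ _ fun w _ hw => ?_
      have hwd : ∀ i j, dist (w i) (w j) < ε := by
        intro i j
        have hpos : 0 < ε / 2 := (dist_self (y 0)) ▸ hy 0 0
        obtain ⟨a, ha | ha⟩ := hw i <;> obtain ⟨b, hb | hb⟩ := hw j <;> rw [ha, hb]
        · linarith [hy a b]
        · linarith [hy a b, hsd (y b), dist_triangle (y a) (y b) (s (y b))]
        · linarith [hy a b, hsd (y a), dist_triangle (s (y a)) (y a) (y b),
            dist_comm (s (y a)) (y a)]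
        · linarith [hy a b, hs (y a) (y b)]
      exact hε (fun i => s^[k] (w i)) fun i j => (hsi _ _ _).trans_lt (hwd i j)
    rw [h0, add_zero] at h
    rw [h]
    simp only [hF, Function.iterate_succ_apply]
  -- The differences telescope to `F N - F 0`, which is `-f` because the `N`-th iterate avoids `K`.
  refine ⟨fun y => - ∑ k ∈ Finset.range N, prism s p (F k) y, fun y hy => ?_, fun y hy => ?_⟩
  · rw [neg_eq_zero]
    refine Finset.sum_eq_zero fun k _ => prism_eq_zero s _ _ _ fun w hw _ => ?_
    exact hfK _ ⟨0, fun h => hy (by rw [← hw]; exact hsKi k _ h)⟩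
  · have e : coboundary Y p (fun y => - ∑ k ∈ Finset.range N, prism s p (F k) y) y =
        - ∑ k ∈ Finset.range N, coboundary Y p (prism s p (F k)) y := by
      have : (fun y => - ∑ k ∈ Finset.range N, prism s p (F k) y) =
          - ∑ k ∈ Finset.range N, prism s p (F k) := by
        funext y; simp
      rw [this, map_neg, map_sum]
      simp
    rw [e, ← Finset.sum_congr rfl fun k _ => step k y hy,
      Finset.sum_range_sub (fun k => F k y),
      show F N y = 0 from hfK _ ⟨0, hN _⟩]
    simp [hF]

/-- In degree 0 the cocycle condition on the small pair `(x, s x)` makes `f` invariant under `s`,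
and the iterates of `s` end outside `K`. -/
theorem eq_zero_of_shift {f : (Fin (0 + 1) → Y) → ℤ} {K : Set Y}
    (hfK : ∀ y, (∃ i, y i ∉ K) → f y = 0) {ε : ℝ} (hpos : 0 < ε)
    (hε : ∀ y : Fin (0 + 2) → Y, (∀ i j, dist (y i) (y j) < ε) →
      coboundary Y 0 f y = 0) (s : Y → Y)
    (hsd : ∀ x, dist x (s x) ≤ ε / 2) (N : ℕ) (hN : ∀ x, s^[N] x ∉ K) (y : Fin 1 → Y) :
    f y = 0 := by
  have step : ∀ x, f (fun _ => s x) = f (fun _ => x) := by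
    intro x
    have := hε (Fin.cons x fun _ => s x) fun i j => by
      have h := hsd x
      have h' := dist_comm x (s x)
      fin_cases i <;> fin_cases j
      · change dist x x < ε; rw [dist_self]; exact hpos
      · change dist x (s x) < ε; linarith
      · change dist (s x) x < ε; linarith
      · change dist (s x) (s x) < ε; rw [dist_self]; exact hpos
    rw [coboundary_zero_apply] at this
    exact sub_eq_zero.1 this
  have iter : ∀ k x, f (fun _ => s^[k] x) = f (fun _ => x) := by
    intro k
    induction k with
    | zero => exact fun _ => rfl
    | succ k ih => exact fun x => by rw [Function.iterate_succ_apply, ih, step]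
  have e : y = fun _ => y 0 := by funext i; fin_cases i; rfl
  rw [e, ← iter N]
  exact hfK _ ⟨0, hN _⟩

open Classical in
-- The larger compact set `L` is left free because the shifting argument needs one of a special
-- shape.
theorem exists_cutoff [LocallyCompactSpace Y] {p : ℕ} (f : compactCochains Y p) :
    ∃ K, IsCompact K ∧ ∀ L, IsCompact L → K ⊆ L → ∃ f' : compactCochains Y p,
      f - f' ∈ locallyZero Y p ∧ ∀ y, (∃ i, y i ∉ L) → f'.1 y = 0 := by
  obtain ⟨K, hK, hfK⟩ := exists_compact_superset f.2
  refine ⟨K, hK, fun L hL hKL => ?_⟩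
  have h0 : ∀ y, (∃ i, y i ∉ L) → (if ∀ i, y i ∈ L then f.1 y else 0) = 0 :=
    fun y ⟨i, hi⟩ => if_neg fun h => hi (h i)
  refine ⟨⟨fun y => if ∀ i, y i ∈ L then f.1 y else 0, mem_compactCochains_of_isCompact hL h0⟩,
    mem_locallyZero.2 fun x => ?_, h0⟩
  by_cases hx : x ∈ interior K
  · refine ⟨K, mem_interior_iff_mem_nhds.1 hx, fun y hy => ?_⟩
    change f.1 y - (if ∀ i, y i ∈ L then f.1 y else 0) = 0
    rw [if_pos fun i => hKL (hy i), sub_self]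
  · obtain ⟨V, hV, h⟩ := notMem_support.1 (fun h => hx (hfK h))
    refine ⟨V, hV, fun y hy => ?_⟩
    change f.1 y - (if ∀ i, y i ∈ L then f.1 y else 0) = 0
    rw [h y hy, ite_self, sub_self]

/-- The data needed to move a compactly supported cocycle on `X × [0, ∞)` to infinity. -/
theorem exists_cutoff_halfLine {X : Type*} [MetricSpace X] [LocallyCompactSpace X] {p : ℕ}
    (f : compactCochains (X × NNReal) p)
    (hδ : compactCoboundary (X × NNReal) p f ∈ locallyZero (X × NNReal) (p + 1)) :
    ∃ (f' : compactCochains (X × NNReal) p) (L : Set (X × NNReal)) (ε : ℝ)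
      (s : X × NNReal → X × NNReal) (N : ℕ), f - f' ∈ locallyZero (X × NNReal) p ∧
      IsCompact L ∧ (∀ y, (∃ i, y i ∉ L) → f'.1 y = 0) ∧ 0 < ε ∧
      (∀ y : Fin (p + 2) → X × NNReal, (∀ i j, dist (y i) (y j) < ε) →
        coboundary _ p f'.1 y = 0) ∧
      (∀ x y, dist (s x) (s y) ≤ dist x y) ∧ (∀ x, dist x (s x) ≤ ε / 2) ∧
      (∀ x, s x ∈ L → x ∈ L) ∧ ∀ x, s^[N] x ∉ L := by
  obtain ⟨K, hK, h⟩ := exists_cutoff f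
  obtain ⟨M, hM⟩ := (hK.image continuous_snd).bddAbove
  -- A box reaching down to height 0 is stable under lowering the second coordinate, so a point that
  -- is shifted into it was already in it.
  have hL : IsCompact ((Prod.fst '' K) ×ˢ Set.Icc (0 : NNReal) M) :=
    (hK.image continuous_fst).prod isCompact_Icc
  obtain ⟨f', hf', h0⟩ := h _ hL fun x hx => ⟨⟨x, hx, rfl⟩, bot_le, hM ⟨x, hx, rfl⟩⟩
  have hδ' : compactCoboundary (X × NNReal) p f' ∈ locallyZero (X × NNReal) (p + 1) := by
    have := locallyZero_le_comap _ p hf'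
    rw [Submodule.mem_comap, map_sub] at this
    have := sub_mem hδ this
    rwa [sub_sub_cancel] at this
  obtain ⟨ε, hε, hu⟩ := exists_uniform_coboundary_eq_zero hL h0 (mem_locallyZero.1 hδ')
  -- `N` upward shifts by `ε / 2` leave the box of height `M`.
  obtain ⟨N, hN⟩ := exists_nat_gt (M / (ε / 2))
  set η : NNReal := ⟨ε / 2, by positivity⟩ with hη
  have iter : ∀ (k : ℕ) (x : X × NNReal),
      (fun x : X × NNReal => (x.1, x.2 + η))^[k] x = (x.1, x.2 + k * η) := by
    intro k
    induction k with
    | zero => intro x; simp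
    | succ k ih =>
      intro x
      rw [Function.iterate_succ_apply, ih]
      ext
      · rfl
      · push_cast; ring
  refine ⟨f', _, ε, fun x => (x.1, x.2 + η), N, hf', hL, h0, hε, hu, fun x y => ?_, fun x => ?_,
    fun x hx => ⟨hx.1, bot_le, le_self_add.trans hx.2.2⟩, fun x hx => ?_⟩
  · simp [Prod.dist_eq, NNReal.dist_eq]
  · simp only [Prod.dist_eq, dist_self, NNReal.dist_eq, NNReal.coe_add]
    have : |(x.2 : ℝ) - (x.2 + η)| = ε / 2 := by
      rw [sub_add_cancel_left, abs_neg]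
      exact abs_of_pos (half_pos hε)
    rw [this]
    exact max_le (by positivity) le_rfl
  · rw [iter] at hx
    have h1 : ((x.2 + N * η : NNReal) : ℝ) ≤ M := NNReal.coe_le_coe.2 hx.2.2
    have h2 : (M : ℝ) < N * (ε / 2) := (div_lt_iff₀ (half_pos hε)).1 hN
    rw [NNReal.coe_add, NNReal.coe_mul, NNReal.coe_natCast] at h1
    change (x.2 : ℝ) + N * (ε / 2) ≤ M at h1
    linarith [x.2.2]

/-- Small steps along the half-line move any compactly supported cocycle to infinity. The primitive
built from the prisms vanishes unless its first vertex lies in the compact box, so it has compact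
support as well. -/
theorem subsingleton_homology_halfLine (X : Type u) [MetricSpace X] [LocallyCompactSpace X]
    (p : ℕ) : Subsingleton ((compactComplex (X × NNReal)).homology p) := by
  rw [compactComplex_eq]
  refine subsingleton_homology_relComplex (fun f hf => ?_) (fun p f hf => ?_) p
  · obtain ⟨f', L, ε, s, N, hf', -, h0, hpos, hu, -, hsd, -, hN⟩ := exists_cutoff_halfLine f hf
    have : f' = 0 := Subtype.ext (funext fun y => eq_zero_of_shift h0 hpos hu s hsd N hN y)
    rwa [this, sub_zero] at hf'
  · obtain ⟨f', L, ε, s, N, hf', hL, h0, hpos, hu, hs, hsd, hsL, hN⟩ := exists_cutoff_halfLine f hf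
    obtain ⟨g, hg0, hg⟩ := exists_coboundary_of_shift h0 hu s hs hsd hsL N hN
    have hgs : support g ⊆ L := by
      intro x hx
      by_contra hxL
      exact notMem_support.2 ⟨Lᶜ, hL.isClosed.isOpen_compl.mem_nhds hxL,
        fun y hy => hg0 y (hy 0)⟩ hx
    refine ⟨⟨g, hL.of_isClosed_subset (isClosed_support _) hgs⟩, ?_⟩
    rw [← sub_add_sub_cancel f f']
    -- Tuples in a ball of radius `ε / 4` have mutual distances below `ε / 2`, the range in which
    -- `f'` is the coboundary of `g`.
    refine add_mem hf' (mem_locallyZero.2 fun x => ⟨Metric.ball x (ε / 4),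
      Metric.ball_mem_nhds _ (by positivity), fun y hy => ?_⟩)
    refine sub_eq_zero.2 (hg y fun i j => ?_)
    have h1 := Metric.mem_ball.1 (hy i)
    have h2 := Metric.mem_ball'.1 (hy j)
    linarith [dist_triangle (y i) x (y j)]

end HalfLine

end AlexanderSpanier

/-! ### Additivity of the Euler characteristic with compact supports -/

open AlexanderSpanier

universe u

section EulerChar

variable {X : Type u} [TopologicalSpace X]

theorem eulerCharC_eq : eulerCharC X = complexEuler (compactComplex X) := rfl

theorem HasEulerCharC.congr {Y : Type u} [TopologicalSpace Y] (e : X ≃ₜ Y)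
    (h : HasEulerCharC X) : HasEulerCharC Y :=
  EulerDefined.of_iso (compactComplexCongr e.symm) h

theorem eulerCharC_congr {Y : Type u} [TopologicalSpace Y] (e : X ≃ₜ Y) :
    eulerCharC X = eulerCharC Y :=
  complexEuler_congr (compactComplexCongr e.symm)

section ClosedOpen

variable [TopologicalSpace.MetrizableSpace X] [LocallyCompactSpace X] {Z : Set X}
  (hZ : IsClosed Z)

include hZ

/-- `Q` is the quotient by the cochains supported off `Z`, and these compute the complement.
Restriction makes `Q` surject onto the complex of `Z`; the kernel is acyclic by tautness, so `Q` and
`Z` have the same Euler characteristic. -/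
theorem exists_quotient_complex : ∃ Q : CochainComplex (ModuleCat.{u} ℤ) ℕ,
    (∃ S : ShortComplex (CochainComplex (ModuleCat.{u} ℤ) ℕ), S.ShortExact ∧
      Nonempty (S.X₁ ≅ compactComplex (Zᶜ : Set X)) ∧ Nonempty (S.X₂ ≅ compactComplex X) ∧
      Nonempty (S.X₃ ≅ Q)) ∧
    (EulerDefined Q ↔ EulerDefined (compactComplex Z)) ∧
    (EulerDefined Q → complexEuler Q = complexEuler (compactComplex Z)) := by
  let := TopologicalSpace.metrizableSpaceMetric X
  have hS := relShortComplex_shortExact (hd := compactCoboundary_comp X)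
    (locallyZero_le_comap X) (vanishingNear_le_comap Z) (locallyZero_le_vanishingNear Z)
  have hS' := relShortComplex_shortExact (hd := compactCoboundary_comp X)
    (vanishingNear_le_comap Z) (vanishingOn_le_comap hZ) (vanishingNear_le_vanishingOn hZ)
  have hac : ∀ p, Subsingleton ((subRelComplex (compactCoboundary X) (compactCoboundary_comp X)
      (vanishingNear Z) (vanishingNear_le_comap Z) (vanishingOn_le_comap hZ)).homology p) := by
    refine subsingleton_homology_relComplex (fun f hf => ?_) (fun p f hf => ?_)
    · exact mem_vanishingNear_zero hZ f.1 f.2 hf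
    · obtain ⟨g, hg, h⟩ := exists_sub_mem_vanishingNear hZ p f.1 f.2 hf
      exact ⟨⟨g, hg⟩, h⟩
  have hac1 := eulerDefined_of_acyclic hac
  have hac0 := complexEuler_of_acyclic hac
  have e := quotientVanishingOnIso hZ
  refine ⟨_, ⟨_, hS, ⟨vanishingNearIso hZ⟩, ⟨Iso.refl _⟩, ⟨Iso.refl _⟩⟩,
    ⟨fun h => (EulerDefined.right hS' hac1 h).of_iso e,
      fun h => EulerDefined.middle hS' hac1 (h.of_iso e.symm)⟩, fun h => ?_⟩
  have h1 := complexEuler_add hS' hac1 h (EulerDefined.right hS' hac1 h)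
  rw [← complexEuler_congr e]
  refine h1.trans ?_
  rw [show complexEuler (relShortComplex (hd := compactCoboundary_comp X)
    (vanishingNear_le_comap Z) (vanishingOn_le_comap hZ) (vanishingNear_le_vanishingOn hZ)).X₁ = 0
    from hac0, zero_add]
  rfl

theorem HasEulerCharC.of_closed_of_compl (h1 : HasEulerCharC Z)
    (h2 : HasEulerCharC (Zᶜ : Set X)) : HasEulerCharC X := by
  obtain ⟨Q, ⟨S, hS, ⟨e1⟩, ⟨e2⟩, ⟨e3⟩⟩, hQ, -⟩ := exists_quotient_complex hZ
  exact (EulerDefined.middle hS (EulerDefined.of_iso e1.symm h2)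
    ((hQ.2 h1).of_iso e3.symm)).of_iso e2

theorem HasEulerCharC.compl (h1 : HasEulerCharC Z) (h : HasEulerCharC X) :
    HasEulerCharC (Zᶜ : Set X) := by
  obtain ⟨Q, ⟨S, hS, ⟨e1⟩, ⟨e2⟩, ⟨e3⟩⟩, hQ, -⟩ := exists_quotient_complex hZ
  exact (EulerDefined.left hS (EulerDefined.of_iso e2.symm h)
    ((hQ.2 h1).of_iso e3.symm)).of_iso e1

theorem eulerCharC_eq_add_compl (h1 : HasEulerCharC Z) (h2 : HasEulerCharC (Zᶜ : Set X)) :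
    eulerCharC X = eulerCharC Z + eulerCharC (Zᶜ : Set X) := by
  have h := HasEulerCharC.of_closed_of_compl hZ h1 h2
  obtain ⟨Q, ⟨S, hS, ⟨e1⟩, ⟨e2⟩, ⟨e3⟩⟩, hQ, hQ'⟩ := exists_quotient_complex hZ
  have := complexEuler_add hS (EulerDefined.of_iso e1.symm h2) (EulerDefined.of_iso e2.symm h)
    ((hQ.2 h1).of_iso e3.symm)
  rw [complexEuler_congr e1, complexEuler_congr e2, complexEuler_congr e3, hQ' (hQ.2 h1)] at this
  rw [eulerCharC_eq, eulerCharC_eq, eulerCharC_eq, this, add_comm]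

end ClosedOpen

theorem hasEulerCharC_halfLine (X : Type u) [TopologicalSpace X]
    [TopologicalSpace.MetrizableSpace X] [LocallyCompactSpace X] : HasEulerCharC (X × NNReal) := by
  let := TopologicalSpace.metrizableSpaceMetric X
  exact eulerDefined_of_acyclic (subsingleton_homology_halfLine X)

theorem eulerCharC_halfLine (X : Type u) [TopologicalSpace X]
    [TopologicalSpace.MetrizableSpace X] [LocallyCompactSpace X] : eulerCharC (X × NNReal) = 0 := by
  let := TopologicalSpace.metrizableSpaceMetric X
  exact complexEuler_of_acyclic (subsingleton_homology_halfLine X)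

end EulerChar

end

/-! ### Points, lines and products -/

noncomputable section

open CategoryTheory AlexanderSpanier TopologicalSpace

universe u

section Point

variable (P : Type u) [TopologicalSpace P] [Unique P]

omit [TopologicalSpace P] in
-- All `p + 2` faces coincide, so only the alternating sum of their signs remains. The complex of a
-- point therefore alternates between zero maps and isomorphisms.
theorem coboundary_of_unique (p : ℕ) (f : (Fin (p + 1) → P) → ℤ) (y : Fin (p + 2) → P) :
    coboundary P p f y = if Even p then 0 else f default := by
  have e : ∀ i : Fin (p + 2), (fun j => y (i.succAbove j)) = (default : Fin (p + 1) → P) :=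
    fun i => Subsingleton.elim _ _
  rw [coboundary_apply]
  simp only [e]
  rw [← Finset.sum_mul, Fin.sum_neg_one_pow]
  by_cases h : Even p
  · simp [h, Nat.even_add]
  · simp [h, Nat.even_add]

theorem mem_locallyZero_of_unique {p : ℕ} {f : compactCochains P p} :
    f ∈ locallyZero P p ↔ f.1 default = 0 := by
  rw [mem_locallyZero]
  constructor
  · intro h
    obtain ⟨V, hV, h⟩ := h default
    exact h _ fun i => by
      rw [Subsingleton.elim ((default : Fin (p + 1) → P) i) default]
      exact mem_of_mem_nhds hV
  · exact fun h x => ⟨Set.univ, Filter.univ_mem, fun y _ => by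
      rw [Subsingleton.elim y default, h]⟩

theorem mem_compactCochains_of_unique {p : ℕ} (f : (Fin (p + 1) → P) → ℤ) :
    f ∈ compactCochains P p :=
  Set.Finite.isCompact (Set.toFinite (α := P) (support f))

theorem subsingleton_compactCohomology_succ_of_unique (p : ℕ) :
    Subsingleton (compactCohomology P (p + 1)) := by
  rw [← ModuleCat.isZero_iff_subsingleton, compactCohomology,
    ← HomologicalComplex.exactAt_iff_isZero_homology,
    HomologicalComplex.exactAt_iff' _ p (p + 1) (p + 2) (by simp) (by simp),
    ShortComplex.moduleCat_exact_iff, compactComplex_eq]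
  intro x hx
  obtain ⟨x, rfl⟩ := (locallyZero P (p + 1)).mkQ_surjective x
  have hx : (relComplex (fun p => compactCochains P p) (compactCoboundary P)
      (compactCoboundary_comp P) (locallyZero P) (locallyZero_le_comap P)).d (p + 1) (p + 1 + 1)
        ((locallyZero P (p + 1)).mkQ x) = 0 := hx
  rw [relComplex_d_mk] at hx
  have hx := (mem_locallyZero_of_unique P).1 ((Submodule.Quotient.mk_eq_zero _).1 hx)
  change coboundary P (p + 1) x.1 default = 0 at hx
  rw [coboundary_of_unique] at hx
  refine ⟨(locallyZero P p).mkQ ⟨fun _ => x.1 default, mem_compactCochains_of_unique P _⟩, ?_⟩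
  refine Eq.trans (relComplex_d_mk (hd := compactCoboundary_comp P)
    (hS := locallyZero_le_comap P) _ _) ((Submodule.Quotient.eq _).2 ?_)
  refine (mem_locallyZero_of_unique P).2 ?_
  change coboundary P p _ default - x.1 default = 0
  rw [coboundary_of_unique]
  by_cases h : Even p
  · have h' : ¬ Even (p + 1) := by simpa [Nat.even_add_one] using h
    rw [if_neg h'] at hx
    rw [if_pos h, hx, sub_zero]
  · rw [if_neg h]
    exact sub_self _

/-- The cohomology of a point in degree zero. -/
def compactCohomologyZeroOfUnique : compactCohomology P 0 ≃ₗ[ℤ] ℤ := by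
  have hd : (compactComplex P).d 0 1 = 0 := by
    refine ModuleCat.hom_ext (LinearMap.ext fun x => ?_)
    obtain ⟨x, rfl⟩ := (locallyZero P 0).mkQ_surjective x
    refine Eq.trans (relComplex_d_mk (hd := compactCoboundary_comp P)
      (hS := locallyZero_le_comap P) _ _) ((Submodule.Quotient.mk_eq_zero _).2 ?_)
    refine (mem_locallyZero_of_unique P).2 ?_
    change coboundary P 0 _ default = 0
    rw [coboundary_of_unique, if_pos Even.zero]
  have h1 := (compactComplex P).isIso_iCycles 0 1 (by simp) hd
  have h2 := (compactComplex P).isIso_homologyπ 0 0 (by simp) (by simp)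
  let e : compactCohomology P 0 ≅ (compactComplex P).X 0 :=
    (asIso ((compactComplex P).homologyπ 0)).symm ≪≫ asIso ((compactComplex P).iCycles 0)
  let φ : compactCochains P 0 →ₗ[ℤ] ℤ :=
    { toFun := fun f => f.1 default
      map_add' := fun _ _ => rfl
      map_smul' := fun _ _ => rfl }
  have hφ : Function.Surjective φ := fun n => ⟨⟨fun _ => n, mem_compactCochains_of_unique P _⟩, rfl⟩
  have hk : locallyZero P 0 = LinearMap.ker φ := by
    ext f
    exact mem_locallyZero_of_unique P
  exact e.toLinearEquiv.trans ((Submodule.quotEquivOfEq _ _ hk).trans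
    (φ.quotKerEquivOfSurjective hφ))

theorem hasEulerCharC_of_unique : HasEulerCharC P := by
  refine ⟨fun p => ?_, 1, fun p hp => ?_⟩
  · cases p with
    | zero => exact Module.Finite.equiv (compactCohomologyZeroOfUnique P).symm
    | succ p =>
      have := subsingleton_compactCohomology_succ_of_unique P p
      infer_instance
  · obtain ⟨q, rfl⟩ : ∃ q, p = q + 1 := ⟨p - 1, by omega⟩
    exact subsingleton_compactCohomology_succ_of_unique P q

theorem eulerCharC_of_unique : eulerCharC P = 1 := by
  rw [eulerCharC_eq, complexEuler, eulerSum_eq_sum_range (N := 1) fun p hp => ?_]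
  · rw [Finset.sum_range_one, pow_zero, one_mul,
      LinearEquiv.finrank_eq (compactCohomologyZeroOfUnique P), Module.finrank_self]
    rfl
  · obtain ⟨q, rfl⟩ : ∃ q, p = q + 1 := ⟨p - 1, by omega⟩
    exact subsingleton_compactCohomology_succ_of_unique P q

theorem subsingleton_compactCohomology_of_isEmpty (E : Type u) [TopologicalSpace E] [IsEmpty E]
    (p : ℕ) : Subsingleton (compactCohomology E p) := by
  have h : ∀ p (f : compactCochains E p), f ∈ locallyZero E p :=
    fun p f => mem_locallyZero.2 fun x => isEmptyElim x
  exact subsingleton_homology_relComplex (hd := compactCoboundary_comp E)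
    (hS := locallyZero_le_comap E) (fun f _ => h 0 f) (fun p f _ => ⟨0, h _ _⟩) p

theorem hasEulerCharC_of_isEmpty (E : Type u) [TopologicalSpace E] [IsEmpty E] :
    HasEulerCharC E :=
  eulerDefined_of_acyclic (subsingleton_compactCohomology_of_isEmpty E)

theorem eulerCharC_of_isEmpty (E : Type u) [TopologicalSpace E] [IsEmpty E] :
    eulerCharC E = 0 :=
  complexEuler_of_acyclic (subsingleton_compactCohomology_of_isEmpty E)

end Point

section Line

variable (X : Type u) [TopologicalSpace X]

/-- The open half-cylinder is a cylinder. -/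
def halfCylinderHomeo : ({p : X × NNReal | p.2 = 0}ᶜ : Set (X × NNReal)) ≃ₜ X × ℝ where
  toFun p := (p.1.1, Real.log p.1.2)
  invFun q := ⟨(q.1, ⟨Real.exp q.2, (Real.exp_pos _).le⟩), fun h =>
    (Real.exp_pos q.2).ne' (congrArg NNReal.toReal h)⟩
  left_inv := by
    rintro ⟨⟨x, t⟩, ht⟩
    have : 0 < (t : ℝ) := NNReal.coe_pos.2 (pos_iff_ne_zero.2 ht)
    ext
    · rfl
    · exact Real.exp_log this
  right_inv := by
    rintro ⟨x, t⟩
    exact Prod.ext rfl (Real.log_exp t)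
  continuous_toFun := by
    refine Continuous.prodMk (by fun_prop) (Continuous.log (by fun_prop) ?_)
    rintro ⟨⟨x, t⟩, ht⟩ h
    exact ht (NNReal.coe_eq_zero.1 h)
  continuous_invFun := by
    refine Continuous.subtype_mk (Continuous.prodMk (by fun_prop) ?_) _
    exact Continuous.subtype_mk (by fun_prop) _

/-- The boundary of the half-cylinder. -/
def halfCylinderBoundaryHomeo : ({p : X × NNReal | p.2 = 0} : Set (X × NNReal)) ≃ₜ X where
  toFun p := p.1.1
  invFun x := ⟨(x, 0), rfl⟩
  left_inv := by
    rintro ⟨⟨x, t⟩, rfl : t = 0⟩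
    rfl
  right_inv _ := rfl
  continuous_toFun := by fun_prop
  continuous_invFun := by fun_prop

variable {X}

theorem isClosed_halfCylinderBoundary : IsClosed {p : X × NNReal | p.2 = 0} :=
  isClosed_eq continuous_snd continuous_const

variable [MetrizableSpace X] [LocallyCompactSpace X]

theorem HasEulerCharC.prod_real (h : HasEulerCharC X) : HasEulerCharC (X × ℝ) :=
  (HasEulerCharC.compl isClosed_halfCylinderBoundary
    (h.congr (halfCylinderBoundaryHomeo X).symm) (hasEulerCharC_halfLine X)).congr
    (halfCylinderHomeo X)

/-- `X × [0, ∞)` has Euler characteristic 0 and splits into the closed copy `X × {0}` and the open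
part `X × (0, ∞)`, which is `X × ℝ` by the logarithm. -/
theorem eulerCharC_prod_real (h : HasEulerCharC X) : eulerCharC (X × ℝ) = - eulerCharC X := by
  have h1 := h.congr (halfCylinderBoundaryHomeo X).symm
  have := eulerCharC_eq_add_compl isClosed_halfCylinderBoundary h1
    (HasEulerCharC.compl isClosed_halfCylinderBoundary h1 (hasEulerCharC_halfLine X))
  rw [eulerCharC_halfLine, eulerCharC_congr (halfCylinderBoundaryHomeo X),
    eulerCharC_congr (halfCylinderHomeo X)] at this
  linarith

end Line

/-- The Euler characteristic with compact supports of `X` is defined and multiplicative in products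
with arbitrary spaces whose Euler characteristic is defined. -/
def EulerMultiplicative (X : Type) [TopologicalSpace X] : Prop :=
  ∀ (W : Type) [TopologicalSpace W] [MetrizableSpace W] [LocallyCompactSpace W],
    HasEulerCharC W → HasEulerCharC (X × W) ∧ eulerCharC (X × W) = eulerCharC X * eulerCharC W

namespace EulerMultiplicative

variable {X Y : Type} [TopologicalSpace X] [TopologicalSpace Y]

theorem hasEulerCharC (h : EulerMultiplicative X) : HasEulerCharC X :=
  (h Unit (hasEulerCharC_of_unique Unit)).1.congr (Homeomorph.prodPUnit X)

theorem congr (e : X ≃ₜ Y) (h : EulerMultiplicative X) : EulerMultiplicative Y := by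
  intro W _ _ _ hW
  obtain ⟨h1, h2⟩ := h W hW
  refine ⟨h1.congr (e.prodCongr (Homeomorph.refl W)), ?_⟩
  rw [← eulerCharC_congr e, ← h2, eulerCharC_congr (e.prodCongr (Homeomorph.refl W))]

theorem of_isEmpty (X : Type) [TopologicalSpace X] [IsEmpty X] : EulerMultiplicative X := by
  intro W _ _ _ _
  refine ⟨hasEulerCharC_of_isEmpty _, ?_⟩
  rw [eulerCharC_of_isEmpty, eulerCharC_of_isEmpty, zero_mul]

theorem of_unique (X : Type) [TopologicalSpace X] [Unique X] : EulerMultiplicative X := by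
  intro W _ _ _ hW
  refine ⟨hW.congr (Homeomorph.uniqueProd X W).symm, ?_⟩
  rw [eulerCharC_congr (Homeomorph.uniqueProd X W), eulerCharC_of_unique X, one_mul]

theorem prod_real [MetrizableSpace X] [LocallyCompactSpace X] (h : EulerMultiplicative X) :
    EulerMultiplicative (X × ℝ) := by
  intro W _ _ _ hW
  obtain ⟨h1, h2⟩ := h W hW
  let e : (X × W) × ℝ ≃ₜ (X × ℝ) × W :=
    (Homeomorph.prodAssoc X W ℝ).trans (((Homeomorph.refl X).prodCongr
      (Homeomorph.prodComm W ℝ)).trans (Homeomorph.prodAssoc X ℝ W).symm)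
  refine ⟨h1.prod_real.congr e, ?_⟩
  rw [← eulerCharC_congr e, eulerCharC_prod_real h1, eulerCharC_prod_real h.hasEulerCharC, h2,
    neg_mul]

/-- The part of a product over a subset of the first factor. -/
def _root_.preimageFstHomeo (Z : Set X) (W : Type) [TopologicalSpace W] :
    (Prod.fst ⁻¹' Z : Set (X × W)) ≃ₜ Z × W where
  toFun p := (⟨p.1.1, p.2⟩, p.1.2)
  invFun q := ⟨(q.1, q.2), q.1.2⟩
  left_inv _ := rfl
  right_inv _ := rfl
  continuous_toFun := by fun_prop
  continuous_invFun := by fun_prop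

theorem of_closed_of_compl [MetrizableSpace X] [LocallyCompactSpace X] {Z : Set X}
    (hZ : IsClosed Z) (h1 : EulerMultiplicative Z) (h2 : EulerMultiplicative (Zᶜ : Set X)) :
    EulerMultiplicative X := by
  intro W _ _ _ hW
  obtain ⟨hZ1, hZ2⟩ := h1 W hW
  obtain ⟨hU1, hU2⟩ := h2 W hW
  have hc : IsClosed (Prod.fst ⁻¹' Z : Set (X × W)) := hZ.preimage continuous_fst
  have a1 := hZ1.congr (preimageFstHomeo Z W).symm
  have a2 : HasEulerCharC ((Prod.fst ⁻¹' Z)ᶜ : Set (X × W)) :=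
    hU1.congr (preimageFstHomeo Zᶜ W).symm
  refine ⟨HasEulerCharC.of_closed_of_compl hc a1 a2, ?_⟩
  rw [eulerCharC_eq_add_compl hc a1 a2, eulerCharC_congr (preimageFstHomeo Z W),
    eulerCharC_congr (X := ((Prod.fst ⁻¹' Z)ᶜ : Set (X × W))) (preimageFstHomeo Zᶜ W), hZ2, hU2,
    eulerCharC_eq_add_compl hZ h1.hasEulerCharC h2.hasEulerCharC, add_mul]

end EulerMultiplicative

section Sets

variable {E : Type} [TopologicalSpace E]

/-- The intersection with a subspace, seen in the ambient space. -/
def preimageValHomeo (S T : Set E) : (Subtype.val ⁻¹' T : Set S) ≃ₜ (S ∩ T : Set E) :=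
  (Topology.IsEmbedding.subtypeVal.homeomorphImage _).trans
    (Homeomorph.setCongr (Subtype.image_preimage_coe S T))

variable [MetrizableSpace E] {S : Set E} [LocallyCompactSpace S] {C : Set E}

theorem EulerMultiplicative.of_inter_of_diff (hC : IsClosed C)
    (h1 : EulerMultiplicative (S ∩ C : Set E)) (h2 : EulerMultiplicative (S \ C : Set E)) :
    EulerMultiplicative S :=
  of_closed_of_compl (hC.preimage continuous_subtype_val) (h1.congr (preimageValHomeo S C).symm)
    (h2.congr (preimageValHomeo S Cᶜ).symm)

theorem HasEulerCharC.of_inter_of_diff (hC : IsClosed C)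
    (h1 : HasEulerCharC (S ∩ C : Set E)) (h2 : HasEulerCharC (S \ C : Set E)) :
    HasEulerCharC S :=
  of_closed_of_compl (hC.preimage continuous_subtype_val) (h1.congr (preimageValHomeo S C).symm)
    (h2.congr (preimageValHomeo S Cᶜ).symm)

theorem eulerCharC_eq_inter_add_diff (hC : IsClosed C)
    (h1 : HasEulerCharC (S ∩ C : Set E)) (h2 : HasEulerCharC (S \ C : Set E)) :
    eulerCharC S = eulerCharC (S ∩ C : Set E) + eulerCharC (S \ C : Set E) := by
  rw [eulerCharC_eq_add_compl (hC.preimage continuous_subtype_val)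
    (h1.congr (preimageValHomeo S C).symm) (h2.congr (preimageValHomeo S Cᶜ).symm),
    eulerCharC_congr (preimageValHomeo S C)]
  congr 1
  exact eulerCharC_congr (preimageValHomeo S Cᶜ)

end Sets

end

/-! ### Clopen pieces and finite unions of disjoint graphs -/

noncomputable section

open TopologicalSpace

/-- Every clopen subspace has a defined and multiplicative Euler characteristic. -/
def ClopenMultiplicative (X : Type) [TopologicalSpace X] : Prop :=
  ∀ E : Set X, IsClopen E → EulerMultiplicative E

namespace ClopenMultiplicative

variable {X Y : Type} [TopologicalSpace X] [TopologicalSpace Y]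

theorem eulerMultiplicative (h : ClopenMultiplicative X) : EulerMultiplicative X :=
  (h Set.univ isClopen_univ).congr (Homeomorph.Set.univ X)

theorem congr (e : X ≃ₜ Y) (h : ClopenMultiplicative X) : ClopenMultiplicative Y :=
  fun E hE => (h _ (hE.preimage e.continuous)).congr
    ((e.image (e ⁻¹' E)).trans (Homeomorph.setCongr (e.image_preimage E)))

theorem of_isEmpty (X : Type) [TopologicalSpace X] [IsEmpty X] : ClopenMultiplicative X :=
  fun _ _ => EulerMultiplicative.of_isEmpty _

theorem of_unique (X : Type) [TopologicalSpace X] [Unique X] : ClopenMultiplicative X := by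
  intro E _
  rcases Set.eq_empty_or_nonempty E with rfl | ⟨x, hx⟩
  · exact EulerMultiplicative.of_isEmpty _
  · let := Unique.mk' E (h₁ := ⟨⟨x, hx⟩⟩)
    exact EulerMultiplicative.of_unique _

theorem of_isClopen (h : ClopenMultiplicative X) {D : Set X} (hD : IsClopen D) :
    ClopenMultiplicative D := fun E hE =>
  (h _ ⟨hD.1.isClosedEmbedding_subtypeVal.isClosedMap _ hE.1,
    hD.2.isOpenEmbedding_subtypeVal.isOpenMap _ hE.2⟩).congr
    (Topology.IsEmbedding.subtypeVal.homeomorphImage E).symm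

/-- The two ways to see an intersection of subspaces. -/
def _root_.interHomeo (S T : Set X) :
    (Subtype.val ⁻¹' T : Set S) ≃ₜ (Subtype.val ⁻¹' S : Set T) :=
  (preimageValHomeo S T).trans ((Homeomorph.setCongr (Set.inter_comm S T)).trans
    (preimageValHomeo T S).symm)

theorem of_closed_of_compl [MetrizableSpace X] [LocallyCompactSpace X] {Z : Set X}
    (hZ : IsClosed Z) (h1 : ClopenMultiplicative Z) (h2 : ClopenMultiplicative (Zᶜ : Set X)) :
    ClopenMultiplicative X := by
  intro E hE
  have := hE.1.locallyCompactSpace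
  refine EulerMultiplicative.of_closed_of_compl (hZ.preimage continuous_subtype_val)
    ((h1 _ (hE.preimage continuous_subtype_val)).congr (interHomeo Z E)) ?_
  exact (h2 _ (hE.preimage continuous_subtype_val)).congr (interHomeo Zᶜ E)

theorem of_inter_of_diff [MetrizableSpace X] {S C : Set X} [LocallyCompactSpace S]
    (hC : IsClosed C) (h1 : ClopenMultiplicative (S ∩ C : Set X))
    (h2 : ClopenMultiplicative (S \ C : Set X)) : ClopenMultiplicative S :=
  of_closed_of_compl (hC.preimage continuous_subtype_val) (h1.congr (preimageValHomeo S C).symm)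
    (h2.congr (preimageValHomeo S Cᶜ).symm)

/-- As `ℝ` is connected, a clopen subset of `X × ℝ` is a union of whole lines, hence the product of
`ℝ` with its slice at 0. -/
theorem prod_real [MetrizableSpace X] [LocallyCompactSpace X] (h : ClopenMultiplicative X) :
    ClopenMultiplicative (X × ℝ) := by
  intro E hE
  set D : Set X := {x | (x, (0 : ℝ)) ∈ E} with hD
  have hDc : IsClopen D := hE.preimage (Continuous.prodMk continuous_id continuous_const)
  have hED : E = Prod.fst ⁻¹' D := by
    ext ⟨x, t⟩
    have : IsClopen {t : ℝ | (x, t) ∈ E} :=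
      hE.preimage (Continuous.prodMk continuous_const continuous_id)
    rcases isClopen_iff.1 this with h | h
    · have h1 : t ∉ {t : ℝ | (x, t) ∈ E} := h ▸ Set.notMem_empty t
      have h2 : (0 : ℝ) ∉ {t : ℝ | (x, t) ∈ E} := h ▸ Set.notMem_empty _
      exact iff_of_false h1 h2
    · have h1 : t ∈ {t : ℝ | (x, t) ∈ E} := h ▸ Set.mem_univ t
      have h2 : (0 : ℝ) ∈ {t : ℝ | (x, t) ∈ E} := h ▸ Set.mem_univ _
      exact iff_of_true h1 h2
  have := hDc.1.locallyCompactSpace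
  rw [hED]
  exact (h D hDc).prod_real.congr (preimageFstHomeo D ℝ).symm

end ClopenMultiplicative

section Bands

variable {D : Type*} [TopologicalSpace D] (E : Set D) {ξ η : D → ℝ}

/-- The graph of a continuous function over `E`. -/
def graphHomeo (hξ : Continuous ξ) : {p : D × ℝ | p.1 ∈ E ∧ p.2 = ξ p.1} ≃ₜ E where
  toFun p := ⟨p.1.1, p.2.1⟩
  invFun y := ⟨(y, ξ y), y.2, rfl⟩
  left_inv := by
    rintro ⟨⟨y, t⟩, hy, rfl : t = ξ y⟩
    rfl
  right_inv _ := rfl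
  continuous_toFun := by fun_prop
  continuous_invFun := by fun_prop

/-- The region above the graph of a continuous function over `E`. -/
def aboveHomeo (hξ : Continuous ξ) : {p : D × ℝ | p.1 ∈ E ∧ ξ p.1 < p.2} ≃ₜ E × ℝ where
  toFun p := (⟨p.1.1, p.2.1⟩, Real.log (p.1.2 - ξ p.1.1))
  invFun q := ⟨(q.1, ξ q.1 + Real.exp q.2), q.1.2, lt_add_of_pos_right _ (Real.exp_pos _)⟩
  left_inv := by
    rintro ⟨⟨y, t⟩, hy, ht⟩
    ext
    · rfl
    · change ξ y + Real.exp (Real.log (t - ξ y)) = t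
      rw [Real.exp_log (sub_pos.2 ht)]
      ring
  right_inv := by
    rintro ⟨y, t⟩
    refine Prod.ext rfl ?_
    change Real.log (ξ y + Real.exp t - ξ y) = t
    rw [add_sub_cancel_left, Real.log_exp]
  continuous_toFun := by
    refine Continuous.prodMk (by fun_prop) (Continuous.log (by fun_prop) ?_)
    rintro ⟨⟨y, t⟩, hy, ht⟩
    exact (sub_pos.2 ht).ne'
  continuous_invFun := by fun_prop

/-- The region below the graph of a continuous function over `E`. -/
def belowHomeo (hξ : Continuous ξ) : {p : D × ℝ | p.1 ∈ E ∧ p.2 < ξ p.1} ≃ₜ E × ℝ where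
  toFun p := (⟨p.1.1, p.2.1⟩, Real.log (ξ p.1.1 - p.1.2))
  invFun q := ⟨(q.1, ξ q.1 - Real.exp q.2), q.1.2, sub_lt_self _ (Real.exp_pos _)⟩
  left_inv := by
    rintro ⟨⟨y, t⟩, hy, ht⟩
    ext
    · rfl
    · change ξ y - Real.exp (Real.log (ξ y - t)) = t
      rw [Real.exp_log (sub_pos.2 ht)]
      ring
  right_inv := by
    rintro ⟨y, t⟩
    refine Prod.ext rfl ?_
    change Real.log (ξ y - (ξ y - Real.exp t)) = t
    rw [sub_sub_cancel, Real.log_exp]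
  continuous_toFun := by
    refine Continuous.prodMk (by fun_prop) (Continuous.log (by fun_prop) ?_)
    rintro ⟨⟨y, t⟩, hy, ht⟩
    exact (sub_pos.2 ht).ne'
  continuous_invFun := by fun_prop

/-- The band between the graphs of two continuous functions over `E`. -/
def bandHomeo (hξ : Continuous ξ) (hη : Continuous η) (h : ∀ y ∈ E, ξ y < η y) :
    {p : D × ℝ | p.1 ∈ E ∧ ξ p.1 < p.2 ∧ p.2 < η p.1} ≃ₜ E × ℝ where
  toFun p := (⟨p.1.1, p.2.1⟩, Real.log ((p.1.2 - ξ p.1.1) / (η p.1.1 - p.1.2)))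
  invFun q := ⟨(q.1, (ξ q.1 + η q.1 * Real.exp q.2) / (1 + Real.exp q.2)), q.1.2, by
    have h1 := h _ q.1.2
    have h2 := Real.exp_pos q.2
    constructor
    · change ξ q.1 < (ξ q.1 + η q.1 * Real.exp q.2) / (1 + Real.exp q.2)
      rw [lt_div_iff₀ (by positivity)]
      nlinarith
    · change (ξ q.1 + η q.1 * Real.exp q.2) / (1 + Real.exp q.2) < η q.1
      rw [div_lt_iff₀ (by positivity)]
      nlinarith⟩
  left_inv := by
    rintro ⟨⟨y, t⟩, hy, ht, ht'⟩
    ext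
    · rfl
    · change ξ y < t at ht
      change t < η y at ht'
      change (ξ y + η y * Real.exp (Real.log ((t - ξ y) / (η y - t)))) /
        (1 + Real.exp (Real.log ((t - ξ y) / (η y - t)))) = t
      rw [Real.exp_log (div_pos (sub_pos.2 ht) (sub_pos.2 ht'))]
      have h1 : η y - t ≠ 0 := (sub_pos.2 ht').ne'
      have h2 : η y - ξ y ≠ 0 := (sub_pos.2 (ht.trans ht')).ne'
      have h3 : 1 + (t - ξ y) / (η y - t) = (η y - ξ y) / (η y - t) := by
        field_simp
        ring
      rw [h3]
      field_simp
      ring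
  right_inv := by
    rintro ⟨y, t⟩
    refine Prod.ext rfl ?_
    change Real.log (((ξ y + η y * Real.exp t) / (1 + Real.exp t) - ξ y) /
      (η y - (ξ y + η y * Real.exp t) / (1 + Real.exp t))) = t
    have h1 := Real.exp_pos t
    have h2 : η y - ξ y ≠ 0 := (sub_pos.2 (h y y.2)).ne'
    have h3 : 1 + Real.exp t ≠ 0 := by positivity
    have e1 : (ξ y + η y * Real.exp t) / (1 + Real.exp t) - ξ y =
      (η y - ξ y) * Real.exp t / (1 + Real.exp t) := by
      field_simp
      ring
    have e2 : η y - (ξ y + η y * Real.exp t) / (1 + Real.exp t) =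
      (η y - ξ y) / (1 + Real.exp t) := by
      field_simp
      ring
    rw [e1, e2, div_div_div_cancel_right₀ h3, mul_div_cancel_left₀ _ h2, Real.log_exp]
  continuous_toFun := by
    refine Continuous.prodMk (by fun_prop) (Continuous.log (Continuous.div (by fun_prop)
      (by fun_prop) ?_) ?_)
    · rintro ⟨⟨y, t⟩, hy, ht, ht'⟩
      exact (sub_pos.2 ht').ne'
    · rintro ⟨⟨y, t⟩, hy, ht, ht'⟩
      exact (div_pos (sub_pos.2 ht) (sub_pos.2 ht')).ne'
  continuous_invFun := by
    refine Continuous.subtype_mk (Continuous.prodMk (by fun_prop) (Continuous.div (by fun_prop)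
      (by fun_prop) ?_)) _
    intro q
    have := Real.exp_pos q.2
    positivity

end Bands

/-- A closed subset of `D × ℝ` that is, over `D`, locally a finite union of disjoint graphs. -/
structure IsMultigraph {D : Type*} [TopologicalSpace D] (W : Set (D × ℝ)) : Prop where
  isClosed : IsClosed W
  bounded : ∀ y, ∃ M, ∀ᶠ z in 𝓝 y, ∀ t, (z, t) ∈ W → |t| ≤ M
  lift : ∀ p ∈ W, ∀ ε > 0, ∀ᶠ y in 𝓝 p.1, ∃ t, |t - p.2| < ε ∧ (y, t) ∈ W
  separated : ∀ p ∈ W, ∃ ε > 0, ∀ᶠ y in 𝓝 p.1, ∀ t t', |t - p.2| < ε → |t' - p.2| < ε →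
    (y, t) ∈ W → (y, t') ∈ W → t = t'

namespace IsMultigraph

variable {D : Type*} [TopologicalSpace D] {W : Set (D × ℝ)} (hW : IsMultigraph W)

include hW

/-- The tube lemma, which applies although the fibre `ℝ` is not compact because the fibres of `W`
are locally uniformly bounded. -/
theorem eventually_notMem {K : Set (D × ℝ)} (hK : IsClosed K) (hKW : K ⊆ W) {y : D}
    (hy : ∀ t, (y, t) ∉ K) : ∀ᶠ z in 𝓝 y, ∀ t, (z, t) ∉ K := by
  obtain ⟨M, hM⟩ := hW.bounded y
  obtain ⟨U, V, hU, -, hyU, hV, hUV⟩ := generalized_tube_lemma (isCompact_singleton (x := y))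
    (isCompact_Icc (a := -M) (b := M)) hK.isOpen_compl (by
      rintro ⟨z, t⟩ ⟨rfl, -⟩
      exact hy t)
  filter_upwards [hM, hU.mem_nhds (hyU rfl)] with z hz hzU t ht
  exact hUV ⟨hzU, hV (abs_le.1 (hz t (hKW ht)))⟩ ht

/-- Empty fibres persist nearby by `eventually_notMem`, nonempty ones by the lifting property. -/
theorem isClopen_image : IsClopen (Prod.fst '' W) := by
  constructor
  · rw [← isOpen_compl_iff, isOpen_iff_mem_nhds]
    intro y hy
    filter_upwards [hW.eventually_notMem hW.isClosed le_rfl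
      (fun t ht => hy ⟨(y, t), ht, rfl⟩)] with z hz
    rintro ⟨⟨z, t⟩, h, rfl⟩
    exact hz t h
  · rw [isOpen_iff_mem_nhds]
    rintro _ ⟨p, hp, rfl⟩
    filter_upwards [hW.lift p hp 1 one_pos] with z ⟨t, _, ht⟩
    exact ⟨_, ht, rfl⟩

omit hW

open Classical in
/-- The lowest point of each fibre. -/
def _root_.lowestPoint {D : Type*} (W : Set (D × ℝ)) (y : D) : ℝ :=
  if y ∈ Prod.fst '' W then sInf {t | (y, t) ∈ W} else 0

theorem _root_.lowestPoint_mem {D : Type*} {W : Set (D × ℝ)} {y : D}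
    (hf : {t | (y, t) ∈ W}.Finite) (hy : y ∈ Prod.fst '' W) : (y, lowestPoint W y) ∈ W := by
  rw [lowestPoint, if_pos hy]
  obtain ⟨⟨y, t⟩, ht, rfl⟩ := hy
  exact Set.Nonempty.csInf_mem (s := {t | (y, t) ∈ W}) ⟨t, ht⟩ hf

theorem _root_.lowestPoint_le {D : Type*} {W : Set (D × ℝ)} {y : D} {t : ℝ}
    (hf : {t | (y, t) ∈ W}.Finite) (ht : (y, t) ∈ W) : lowestPoint W y ≤ t := by
  rw [lowestPoint, if_pos ⟨_, ht, rfl⟩]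
  exact csInf_le hf.bddBelow ht

include hW

variable (hf : ∀ y, {t | (y, t) ∈ W}.Finite)

include hf

/-- Lifting the lowest point to nearby fibres bounds the function from above; `eventually_notMem`,
for the part of `W` at least `ε` below, bounds it from below. The value 0 over empty fibres is
harmless since the image of `W` is clopen. -/
theorem continuous_lowestPoint : Continuous (lowestPoint W) := by
  rw [continuous_iff_continuousAt]
  intro y
  by_cases hy : y ∈ Prod.fst '' W
  · rw [Metric.continuousAt_iff']
    intro ε hε
    have hm := lowestPoint_mem (hf y) hy
    have h1 := hW.lift _ hm ε hε
    have h2 := hW.eventually_notMem (K := W ∩ {p | p.2 ≤ lowestPoint W y - ε})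
      (hW.isClosed.inter (isClosed_le continuous_snd continuous_const)) Set.inter_subset_left
      (y := y) (fun t ht => by
        have h1 := lowestPoint_le (hf y) ht.1
        have h2 : t ≤ lowestPoint W y - ε := ht.2
        linarith)
    filter_upwards [h1, h2, hW.isClopen_image.2.mem_nhds hy] with z ⟨t, ht, htW⟩ h2 hz
    have h3 := lowestPoint_le (hf z) htW
    have h4 : ¬ lowestPoint W z ≤ lowestPoint W y - ε :=
      fun h => h2 _ ⟨lowestPoint_mem (hf z) hz, h⟩
    rw [Real.dist_eq, abs_lt]
    have := (abs_lt.1 ht).2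
    push Not at h4
    constructor <;> linarith
  · refine ContinuousAt.congr (f := fun _ => (0 : ℝ)) continuousAt_const ?_
    filter_upwards [hW.isClopen_image.1.isOpen_compl.mem_nhds hy] with z hz
    rw [lowestPoint, if_neg hz]

/-- Closedness is the main point: were a lowest point a limit of points that are not lowest, nearby
fibres would contain two distinct points close to it, against `separated`. -/
theorem removeLowest : IsMultigraph (W ∩ {p | lowestPoint W p.1 < p.2}) where
  isClosed := by
    have hc := hW.continuous_lowestPoint hf
    refine isClosed_of_closure_subset fun p hp => ?_
    have hpW : p ∈ W := hW.isClosed.closure_subset_iff.2 Set.inter_subset_left hp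
    refine ⟨hpW, lt_of_le_of_ne (lowestPoint_le (hf _) hpW) fun heq => ?_⟩
    obtain ⟨ε, hε, hs⟩ := hW.separated p hpW
    rw [mem_closure_iff_frequently] at hp
    have h1 : ∀ᶠ q in 𝓝 p, |q.2 - p.2| < ε := by
      have : ContinuousAt (fun q : D × ℝ => |q.2 - p.2|) p := by fun_prop
      exact this.eventually_lt continuousAt_const (by simpa using hε)
    have h2 : ∀ᶠ q in 𝓝 p, |lowestPoint W q.1 - p.2| < ε := by
      have : ContinuousAt (fun q : D × ℝ => |lowestPoint W q.1 - p.2|) p := by fun_prop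
      exact this.eventually_lt continuousAt_const (by simpa [heq] using hε)
    obtain ⟨q, hq, h1, h2, h3⟩ := (hp.and_eventually (h1.and (h2.and
      (continuous_fst.continuousAt.eventually hs)))).exists
    exact hq.2.ne' (h3 _ _ h1 h2 hq.1 (lowestPoint_mem (hf _) ⟨q, hq.1, rfl⟩))
  bounded y := by
    obtain ⟨M, hM⟩ := hW.bounded y
    exact ⟨M, hM.mono fun z hz t ht => hz t ht.1⟩
  lift p hp ε hε := by
    have hc := hW.continuous_lowestPoint hf
    have hp2 : lowestPoint W p.1 < p.2 := hp.2
    set δ := (p.2 - lowestPoint W p.1) / 2 with hδ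
    have hδ0 : 0 < δ := by rw [hδ]; linarith
    have h1 : ∀ᶠ y in 𝓝 p.1, lowestPoint W y < p.2 - δ :=
      hc.continuousAt.eventually_lt continuousAt_const (by rw [hδ]; linarith)
    filter_upwards [hW.lift p hp.1 (min ε δ) (lt_min hε hδ0), h1] with y ⟨t, ht, htW⟩ h1
    refine ⟨t, ht.trans_le (min_le_left _ _), htW, ?_⟩
    have := (abs_lt.1 (ht.trans_le (min_le_right _ _))).1
    change lowestPoint W y < t
    linarith
  separated p hp := by
    obtain ⟨ε, hε, h⟩ := hW.separated p hp.1
    exact ⟨ε, hε, h.mono fun y hy t t' h1 h2 h3 h4 => hy t t' h1 h2 h3.1 h4.1⟩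

omit hW [TopologicalSpace D] in
theorem ncard_removeLowest {m : ℕ} (hm : ∀ y, {t | (y, t) ∈ W}.ncard ≤ m + 1) (y : D) :
    {t | (y, t) ∈ W ∩ {p | lowestPoint W p.1 < p.2}}.ncard ≤ m := by
  by_cases hy : y ∈ Prod.fst '' W
  · have hss : {t | (y, t) ∈ W ∩ {p | lowestPoint W p.1 < p.2}} ⊂ {t | (y, t) ∈ W} := by
      refine ⟨fun t ht => ht.1, fun h => ?_⟩
      exact lt_irrefl (lowestPoint W y) (h (lowestPoint_mem (hf y) hy)).2
    have := Set.ncard_lt_ncard hss (hf y)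
    have := hm y
    omega
  · have : {t | (y, t) ∈ W ∩ {p | lowestPoint W p.1 < p.2}} = ∅ :=
      Set.eq_empty_of_forall_notMem fun t ht => hy ⟨_, ht.1, rfl⟩
    rw [this, Set.ncard_empty]
    exact Nat.zero_le _

end IsMultigraph

section Multigraph

variable {D : Type} [TopologicalSpace D] [MetrizableSpace D] [LocallyCompactSpace D]

/-- The lowest points form a graph over a clopen part of the base; removing it lowers the bound on
the size of the fibres. -/
theorem ClopenMultiplicative.multigraph (hD : ClopenMultiplicative D) (m : ℕ) :
    ∀ W : Set (D × ℝ), IsMultigraph W → (∀ y, {t | (y, t) ∈ W}.Finite) →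
      (∀ y, {t | (y, t) ∈ W}.ncard ≤ m) → ClopenMultiplicative W := by
  induction m with
  | zero =>
    intro W hW hf hm
    have : IsEmpty W := ⟨fun ⟨p, hp⟩ => by
      have := (Set.ncard_eq_zero (hf p.1)).1 (Nat.le_zero.1 (hm p.1))
      exact Set.notMem_empty p.2 (this ▸ hp)⟩
    exact of_isEmpty _
  | succ m ih =>
    intro W hW hf hm
    have hc := hW.continuous_lowestPoint hf
    have := hW.isClosed.locallyCompactSpace
    refine of_inter_of_diff (C := {p | p.2 ≤ lowestPoint W p.1})
      (isClosed_le continuous_snd (hc.comp continuous_fst)) ?_ ?_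
    · refine ((hD.of_isClopen hW.isClopen_image).congr (graphHomeo _ hc).symm).congr
        (Homeomorph.setCongr ?_)
      ext ⟨y, t⟩
      constructor
      · rintro ⟨hy, ht⟩
        obtain rfl : t = lowestPoint W y := ht
        exact ⟨lowestPoint_mem (hf y) hy, le_refl (lowestPoint W y)⟩
      · rintro ⟨h1, h2⟩
        exact ⟨⟨_, h1, rfl⟩, le_antisymm h2 (lowestPoint_le (hf y) h1)⟩
    · refine (ih _ (hW.removeLowest hf) (fun y => (hf y).subset fun t ht => ht.1)
        (IsMultigraph.ncard_removeLowest hf hm)).congr (Homeomorph.setCongr ?_)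
      ext p
      simp

/-- Where the fibre of `W` is empty the region is a half-line bundle. Elsewhere it is a band below
the lowest layer together with the region above that layer, to which the induction applies with the
lowest layer as new lower boundary. -/
theorem ClopenMultiplicative.above_multigraph (hD : ClopenMultiplicative D) (m : ℕ) :
    ∀ (W : Set (D × ℝ)) (E : Set D) (ξ : D → ℝ), IsMultigraph W →
      (∀ y, {t | (y, t) ∈ W}.Finite) → (∀ y, {t | (y, t) ∈ W}.ncard ≤ m) → IsClopen E →
      Continuous ξ → (∀ p ∈ W, p.1 ∈ E ∧ ξ p.1 < p.2) →
      ClopenMultiplicative ({p | p.1 ∈ E ∧ ξ p.1 < p.2} \ W : Set (D × ℝ)) := by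
  induction m with
  | zero =>
    intro W E ξ hW hf hm hE hξ _
    have hW0 : W = ∅ := Set.eq_empty_of_forall_notMem fun p hp => by
      have := (Set.ncard_eq_zero (hf p.1)).1 (Nat.le_zero.1 (hm p.1))
      exact Set.notMem_empty p.2 (this ▸ hp)
    rw [hW0, Set.sdiff_empty]
    have := hE.1.locallyCompactSpace
    exact (hD.of_isClopen hE).prod_real.congr (aboveHomeo E hξ).symm
  | succ m ih =>
    intro W E ξ hW hf hm hE hξ hWE
    have hc := hW.continuous_lowestPoint hf
    have hD' := hW.isClopen_image
    have hEo : IsOpen {p : D × ℝ | p.1 ∈ E ∧ ξ p.1 < p.2} :=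
      (hE.2.preimage continuous_fst).inter (isOpen_lt (hξ.comp continuous_fst) continuous_snd)
    have hlc1 : LocallyCompactSpace ({p | p.1 ∈ E ∧ ξ p.1 < p.2} \ W : Set (D × ℝ)) :=
      (hEo.sdiff hW.isClosed).locallyCompactSpace
    have hlc2 : LocallyCompactSpace
        (({p | p.1 ∈ E ∧ ξ p.1 < p.2} \ W) \ {p | p.1 ∉ Prod.fst '' W} : Set (D × ℝ)) :=
      ((hEo.sdiff hW.isClosed).sdiff
        (hD'.compl.1.preimage continuous_fst)).locallyCompactSpace
    refine of_inter_of_diff (C := {p | p.1 ∉ Prod.fst '' W})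
      (hD'.compl.1.preimage continuous_fst) ?_ ?_
    · have hcl : IsClopen (E \ Prod.fst '' W) := hE.diff hD'
      have := hcl.1.locallyCompactSpace
      refine ((hD.of_isClopen hcl).prod_real.congr (aboveHomeo _ hξ).symm).congr
        (Homeomorph.setCongr ?_)
      ext ⟨y, t⟩
      constructor
      · rintro ⟨⟨h1, h2⟩, h3⟩
        exact ⟨⟨⟨h1, h3⟩, fun h => h2 ⟨_, h, rfl⟩⟩, h2⟩
      · rintro ⟨⟨⟨h1, h3⟩, -⟩, h2⟩
        exact ⟨⟨h1, h2⟩, h3⟩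
    · refine of_inter_of_diff (C := {p | p.2 ≤ lowestPoint W p.1})
        (isClosed_le continuous_snd (hc.comp continuous_fst)) ?_ ?_
      · have := hD'.1.locallyCompactSpace
        have hlt : ∀ y ∈ Prod.fst '' W, ξ y < lowestPoint W y := fun y hy =>
          (hWE _ (lowestPoint_mem (hf y) hy)).2
        refine ((hD.of_isClopen hD').prod_real.congr (bandHomeo _ hξ hc hlt).symm).congr
          (Homeomorph.setCongr ?_)
        ext ⟨y, t⟩
        constructor
        · rintro ⟨h1, h2, h3⟩
          exact ⟨⟨⟨⟨(hWE _ (lowestPoint_mem (hf y) h1)).1, h2⟩,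
            fun h => (lowestPoint_le (hf y) h).not_gt h3⟩, fun h => h h1⟩, h3.le⟩
        · rintro ⟨⟨⟨⟨-, h2⟩, h3⟩, h4⟩, h5⟩
          replace h4 : y ∈ Prod.fst '' W := not_not.1 h4
          refine ⟨h4, h2, lt_of_le_of_ne h5 ?_⟩
          rintro (rfl : t = lowestPoint W y)
          exact h3 (lowestPoint_mem (hf y) h4)
      · refine (ih (W ∩ {p | lowestPoint W p.1 < p.2}) (Prod.fst '' W) (lowestPoint W)
          (hW.removeLowest hf) (fun y => (hf y).subset fun t ht => ht.1)
          (IsMultigraph.ncard_removeLowest hf hm) hD' hc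
          (fun p hp => ⟨⟨p, hp.1, rfl⟩, hp.2⟩)).congr (Homeomorph.setCongr ?_)
        ext ⟨y, t⟩
        constructor
        · rintro ⟨⟨h1, h2⟩, h3⟩
          have h4 := hWE _ (lowestPoint_mem (hf y) h1)
          exact ⟨⟨⟨⟨h4.1, h4.2.trans h2⟩, fun h => h3 ⟨h, h2⟩⟩, fun h => h h1⟩, not_le.2 h2⟩
        · rintro ⟨⟨⟨-, h2⟩, h3⟩, h4⟩
          exact ⟨⟨not_not.1 h3, not_le.1 h4⟩, fun h => h2 h.1⟩

/-- The complement consists of whole lines over empty fibres, the region below the lowest layer, and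
the part above it treated by `above_multigraph`. The bound `m + 1` leaves `m` after one layer is
removed. -/
theorem ClopenMultiplicative.compl_multigraph (hD : ClopenMultiplicative D) {m : ℕ}
    {W : Set (D × ℝ)} (hW : IsMultigraph W) (hf : ∀ y, {t | (y, t) ∈ W}.Finite)
    (hm : ∀ y, {t | (y, t) ∈ W}.ncard ≤ m + 1) : ClopenMultiplicative (Wᶜ : Set (D × ℝ)) := by
  have hc := hW.continuous_lowestPoint hf
  have hD' := hW.isClopen_image
  have hlc1 : LocallyCompactSpace (Wᶜ : Set (D × ℝ)) := hW.isClosed.isOpen_compl.locallyCompactSpace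
  have hlc2 : LocallyCompactSpace (Wᶜ \ {p | p.1 ∉ Prod.fst '' W} : Set (D × ℝ)) :=
    (hW.isClosed.isOpen_compl.sdiff (hD'.compl.1.preimage continuous_fst)).locallyCompactSpace
  refine of_inter_of_diff (C := {p | p.1 ∉ Prod.fst '' W})
    (hD'.compl.1.preimage continuous_fst) ?_ ?_
  · have := hD'.compl.1.locallyCompactSpace
    refine ((hD.of_isClopen hD'.compl).prod_real.congr (preimageFstHomeo _ ℝ).symm).congr
      (Homeomorph.setCongr ?_)
    ext p
    exact ⟨fun h => ⟨fun hp => h ⟨p, hp, rfl⟩, h⟩, fun h => h.2⟩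
  · refine of_inter_of_diff (C := {p | p.2 ≤ lowestPoint W p.1})
      (isClosed_le continuous_snd (hc.comp continuous_fst)) ?_ ?_
    · have := hD'.1.locallyCompactSpace
      refine ((hD.of_isClopen hD').prod_real.congr (belowHomeo _ hc).symm).congr
        (Homeomorph.setCongr ?_)
      ext ⟨y, t⟩
      constructor
      · rintro ⟨h1, h2⟩
        exact ⟨⟨fun h => (lowestPoint_le (hf y) h).not_gt h2, fun h => h h1⟩, h2.le⟩
      · rintro ⟨⟨h3, h4⟩, h5⟩
        replace h4 : y ∈ Prod.fst '' W := not_not.1 h4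
        refine ⟨h4, lt_of_le_of_ne h5 ?_⟩
        rintro (rfl : t = lowestPoint W y)
        exact h3 (lowestPoint_mem (hf y) h4)
    · refine (above_multigraph hD m (W ∩ {p | lowestPoint W p.1 < p.2}) (Prod.fst '' W)
        (lowestPoint W) (hW.removeLowest hf) (fun y => (hf y).subset fun t ht => ht.1)
        (IsMultigraph.ncard_removeLowest hf hm) hD' hc
        (fun p hp => ⟨⟨p, hp.1, rfl⟩, hp.2⟩)).congr (Homeomorph.setCongr ?_)
      ext ⟨y, t⟩
      constructor
      · rintro ⟨⟨h1, h2⟩, h3⟩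
        exact ⟨⟨fun h => h3 ⟨h, h2⟩, fun h => h h1⟩, not_le.2 h2⟩
      · rintro ⟨⟨h2, h3⟩, h4⟩
        exact ⟨⟨not_not.1 h3, not_le.1 h4⟩, fun h => h2 h.1⟩

end Multigraph

end

/-! ### Cylindrical decomposition of real algebraic sets -/

noncomputable section

open TopologicalSpace

/-- A function whose fibrewise zeros are simple and locally bounded has a multigraph as its zero
set. -/
theorem isMultigraph_of_simple_zeros {D : Type*} [TopologicalSpace D] {q q' : D × ℝ → ℝ}
    (hq : Continuous q) (hq' : Continuous q')
    (hd : ∀ y t, HasDerivAt (fun t => q (y, t)) (q' (y, t)) t)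
    (hs : ∀ p, q p = 0 → q' p ≠ 0)
    (hb : ∀ y, ∃ M, ∀ᶠ z in 𝓝 y, ∀ t, q (z, t) = 0 → |t| ≤ M) :
    IsMultigraph {p | q p = 0} := by
  have key : ∀ p, q p = 0 → ∃ ε > 0, (∀ᶠ y in 𝓝 p.1, Set.InjOn (fun t => q (y, t))
      (Set.Icc (p.2 - ε) (p.2 + ε))) ∧
      ∀ δ, 0 < δ → δ ≤ ε → ∀ᶠ y in 𝓝 p.1, ∃ t ∈ Set.Icc (p.2 - δ) (p.2 + δ), q (y, t) = 0 := by
    intro p hp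
    -- The factor `σ` has the sign of `q' p`, so `σ * q` is strictly increasing in `t` near `p`.
    -- Monotonicity yields uniqueness of nearby zeros, and the sign change yields their existence.
    obtain ⟨σ, hσ⟩ : ∃ σ : ℝ, 0 < σ * q' p := ⟨q' p, mul_self_pos.2 (hs p hp)⟩
    have hσ0 : σ ≠ 0 := by rintro rfl; simp at hσ
    have hev : ∀ᶠ r in 𝓝 p.1 ×ˢ 𝓝 p.2, 0 < σ * q' r := by
      rw [← nhds_prod_eq]
      exact (continuous_const.mul hq').continuousAt.eventually (lt_mem_nhds hσ)
    obtain ⟨U, hU, V, hV, hUV⟩ := Filter.eventually_prod_iff.1 hev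
    obtain ⟨ε, hε, hεV⟩ := (Metric.nhds_basis_closedBall.eventually_iff).1 hV
    have hmono : ∀ y, U y → StrictMonoOn (fun t => σ * q (y, t))
        (Set.Icc (p.2 - ε) (p.2 + ε)) := by
      intro y hy
      refine strictMonoOn_of_deriv_pos (convex_Icc _ _) (by fun_prop) fun t ht => ?_
      rw [((hd y t).const_mul σ).deriv]
      refine hUV hy (hεV ?_)
      rw [Real.closedBall_eq_Icc]
      exact interior_subset ht
    refine ⟨ε, hε, ?_, fun δ hδ hδε => ?_⟩
    · filter_upwards [hU] with y hy t ht t' ht' h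
      exact (hmono y hy).injOn ht ht' (by simp only at h ⊢; rw [h])
    · have hm := hmono p.1 hU.self_of_nhds
      have hpm : p.2 ∈ Set.Icc (p.2 - ε) (p.2 + ε) := ⟨by linarith, by linarith⟩
      have h1 : σ * q (p.1, p.2 - δ) < 0 := by
        have := hm ⟨by linarith, by linarith⟩ hpm (show p.2 - δ < p.2 by linarith)
        simpa [hp] using this
      have h2 : 0 < σ * q (p.1, p.2 + δ) := by
        have := hm hpm ⟨by linarith, by linarith⟩ (show p.2 < p.2 + δ by linarith)
        simpa [hp] using this
      have c : ∀ s, Continuous fun y => σ * q (y, s) := fun s => by fun_prop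
      filter_upwards [(c _).continuousAt.eventually (gt_mem_nhds h1),
        (c _).continuousAt.eventually (lt_mem_nhds h2)] with y h1 h2
      obtain ⟨t, ht, h0⟩ := intermediate_value_Icc (f := fun t => σ * q (y, t))
        (show p.2 - δ ≤ p.2 + δ by linarith) (by fun_prop) ⟨h1.le, h2.le⟩
      exact ⟨t, ht, (mul_eq_zero.1 h0).resolve_left hσ0⟩
  refine ⟨isClosed_eq hq continuous_const, hb, fun p hp ε hε => ?_, fun p hp => ?_⟩
  · obtain ⟨ε', hε', -, h⟩ := key p hp
    have hm : 0 < min (ε / 2) ε' := lt_min (half_pos hε) hε'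
    filter_upwards [h _ hm (min_le_right _ _)] with y ⟨t, ht, h0⟩
    refine ⟨t, ?_, h0⟩
    have := min_le_left (ε / 2) ε'
    rw [abs_lt]
    constructor <;> linarith [ht.1, ht.2]
  · obtain ⟨ε, hε, h, -⟩ := key p hp
    refine ⟨ε, hε, h.mono fun y hy t t' h1 h2 h3 h4 => ?_⟩
    have h1 := abs_lt.1 h1
    have h2 := abs_lt.1 h2
    exact hy ⟨by linarith, by linarith⟩ ⟨by linarith, by linarith⟩
      ((show q (y, t) = 0 from h3).trans (show q (y, t') = 0 from h4).symm)

/-- Splitting off the part of the radical of `f` that is prime to `g`. -/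
theorem exists_separable_factor {K : Type*} [Field K] [CharZero K] {f : Polynomial K} (hf : f ≠ 0)
    (g : Polynomial K) : ∃ q, q ≠ 0 ∧ q ∣ f ∧ IsCoprime q g ∧ (∃ k, f ∣ (q * g) ^ k) ∧
      q.Separable := by
  classical
  -- `r` is a squarefree divisor of `f` with the same prime factors. Dividing by `gcd r g` leaves a
  -- factor prime to `g`, because a squarefree product has relatively prime factors.
  obtain ⟨r, k, hr, hrf, hfr⟩ := exists_squarefree_dvd_pow_of_ne_zero hf
  obtain ⟨q, hq⟩ := EuclideanDomain.gcd_dvd_left r g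
  set d := EuclideanDomain.gcd r g
  have hr' : Squarefree (d * q) := hq ▸ hr
  obtain ⟨h1, h2, h3⟩ := squarefree_mul_iff.1 hr'
  refine ⟨q, h3.ne_zero, (Dvd.intro_left d hq.symm).trans hrf, ?_, ⟨k, hfr.trans
    (pow_dvd_pow_of_dvd ?_ k)⟩, PerfectField.separable_iff_squarefree.2 h3⟩
  · refine IsRelPrime.isCoprime fun c hcq hcg => h1 (EuclideanDomain.dvd_gcd ?_ hcg) hcq
    exact hcq.trans (Dvd.intro_left d hq.symm)
  · rw [hq, mul_comm]
    exact mul_dvd_mul_left q (EuclideanDomain.gcd_dvd_right r g)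

namespace FiberwisePolynomial

variable {n : ℕ}

/-- The value of a polynomial in one variable with polynomial coefficients. -/
def value (P : Polynomial (MvPolynomial (Fin n) ℝ)) (p : (Fin n → ℝ) × ℝ) : ℝ :=
  (P.map (MvPolynomial.eval p.1)).eval p.2

theorem value_mul (P Q : Polynomial (MvPolynomial (Fin n) ℝ)) (p : (Fin n → ℝ) × ℝ) :
    value (P * Q) p = value P p * value Q p := by
  simp [value]

theorem value_add (P Q : Polynomial (MvPolynomial (Fin n) ℝ)) (p : (Fin n → ℝ) × ℝ) :
    value (P + Q) p = value P p + value Q p := by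
  simp [value]

theorem value_sub (P Q : Polynomial (MvPolynomial (Fin n) ℝ)) (p : (Fin n → ℝ) × ℝ) :
    value (P - Q) p = value P p - value Q p := by
  simp [value]

theorem value_pow (P : Polynomial (MvPolynomial (Fin n) ℝ)) (k : ℕ) (p : (Fin n → ℝ) × ℝ) :
    value (P ^ k) p = value P p ^ k := by
  simp [value]

theorem value_C (a : MvPolynomial (Fin n) ℝ) (p : (Fin n → ℝ) × ℝ) :
    value (Polynomial.C a) p = MvPolynomial.eval p.1 a := by
  simp [value]

theorem value_one (p : (Fin n → ℝ) × ℝ) : value 1 p = 1 := by simp [value]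

theorem value_eq_sum (P : Polynomial (MvPolynomial (Fin n) ℝ)) (p : (Fin n → ℝ) × ℝ) :
    value P p = ∑ i ∈ Finset.range (P.natDegree + 1),
      MvPolynomial.eval p.1 (P.coeff i) * p.2 ^ i := by
  rw [value, Polynomial.eval_map, Polynomial.eval₂_eq_sum_range]

theorem continuous_value (P : Polynomial (MvPolynomial (Fin n) ℝ)) : Continuous (value P) := by
  have : value P = fun p => ∑ i ∈ Finset.range (P.natDegree + 1),
      MvPolynomial.eval p.1 (P.coeff i) * p.2 ^ i := funext fun p => value_eq_sum P p
  rw [this]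
  exact continuous_finsetSum _ fun i _ =>
    (((MvPolynomial.continuous_eval _).comp continuous_fst).mul (continuous_snd.pow i))

theorem hasDerivAt_value (P : Polynomial (MvPolynomial (Fin n) ℝ)) (x : Fin n → ℝ) (t : ℝ) :
    HasDerivAt (fun t => value P (x, t)) (value P.derivative (x, t)) t := by
  have := (P.map (MvPolynomial.eval x)).hasDerivAt t
  rwa [Polynomial.derivative_map] at this

/-- Cauchy's bound on the roots depends continuously on the point as long as the leading coefficient
does not vanish. -/
theorem eventually_bound {D : Type*} [TopologicalSpace D] {φ : D → Fin n → ℝ} (hφ : Continuous φ)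
    {Q : Polynomial (MvPolynomial (Fin n) ℝ)}
    (hlc : ∀ y, MvPolynomial.eval (φ y) Q.leadingCoeff ≠ 0) (y : D) :
    ∃ M, ∀ᶠ z in 𝓝 y, ∀ t, value Q (φ z, t) = 0 → |t| ≤ M := by
  have hdeg : ∀ z, (Q.map (MvPolynomial.eval (φ z))).natDegree = Q.natDegree := fun z =>
    Polynomial.natDegree_map_of_leadingCoeff_ne_zero _ (hlc z)
  have hlc' : ∀ z, (Q.map (MvPolynomial.eval (φ z))).leadingCoeff =
      MvPolynomial.eval (φ z) Q.leadingCoeff := fun z => by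
    rw [Polynomial.leadingCoeff, hdeg, Polynomial.coeff_map, Polynomial.leadingCoeff]
  have hc : ∀ a : MvPolynomial (Fin n) ℝ, Continuous fun z => MvPolynomial.eval (φ z) a :=
    fun a => (MvPolynomial.continuous_eval a).comp hφ
  have hcont : Continuous fun z => (Q.map (MvPolynomial.eval (φ z))).cauchyBound := by
    simp only [Polynomial.cauchyBound, hdeg, hlc', Polynomial.coeff_map]
    refine Continuous.add (Continuous.div ?_ (hc _).nnnorm fun z => ?_) continuous_const
    · exact Continuous.finset_sup_apply fun i _ => (hc _).nnnorm
    · exact nnnorm_ne_zero_iff.2 (hlc z)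
  refine ⟨(Q.map (MvPolynomial.eval (φ y))).cauchyBound + 1, ?_⟩
  filter_upwards [hcont.continuousAt.eventually (gt_mem_nhds (lt_add_one _))] with z hz t ht
  have h0 : Q.map (MvPolynomial.eval (φ z)) ≠ 0 := by
    intro h
    apply hlc z
    rw [← hlc', h, Polynomial.leadingCoeff_zero]
  have h1 := Polynomial.IsRoot.norm_lt_cauchyBound h0 (show Polynomial.IsRoot _ t from ht)
  have h2 : ‖t‖₊ ≤ (Q.map (MvPolynomial.eval (φ y))).cauchyBound + 1 := (h1.trans hz).le
  exact_mod_cast h2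

theorem finite_zeros {x : Fin n → ℝ} {Q : Polynomial (MvPolynomial (Fin n) ℝ)}
    (hlc : MvPolynomial.eval x Q.leadingCoeff ≠ 0) :
    {t | value Q (x, t) = 0}.Finite ∧ {t | value Q (x, t) = 0}.ncard ≤ Q.natDegree := by
  classical
  set P := Q.map (MvPolynomial.eval x)
  have h0 : P ≠ 0 := by
    intro h
    apply hlc
    rw [Polynomial.leadingCoeff, ← Polynomial.coeff_map]
    change P.coeff _ = 0
    rw [h, Polynomial.coeff_zero]
  have hs : {t | value Q (x, t) = 0} = P.roots.toFinset := by
    ext t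
    simp only [Finset.mem_coe, Multiset.mem_toFinset, Polynomial.mem_roots h0]
    exact Iff.rfl
  rw [hs]
  refine ⟨Finset.finite_toSet _, ?_⟩
  rw [Set.ncard_coe_finset]
  exact (Multiset.toFinset_card_le _).trans ((Polynomial.card_roots' P).trans
    Polynomial.natDegree_map_le)

section Generic

variable (I : Ideal (MvPolynomial (Fin n) ℝ)) [I.IsPrime]

/-- The field of rational functions on the variety of a prime ideal. -/
abbrev FunctionField : Type := FractionRing (MvPolynomial (Fin n) ℝ ⧸ I)

/-- The restriction of polynomials to the generic point. -/
def toField : MvPolynomial (Fin n) ℝ →+* FunctionField I :=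
  (algebraMap (MvPolynomial (Fin n) ℝ ⧸ I) (FunctionField I)).comp (Ideal.Quotient.mk I)

variable {I}

omit [I.IsPrime] in
theorem toField_eq_zero {a : MvPolynomial (Fin n) ℝ} : toField I a = 0 ↔ a ∈ I := by
  rw [toField, RingHom.comp_apply, ← Ideal.Quotient.eq_zero_iff_mem]
  exact map_eq_zero_iff _ (IsFractionRing.injective _ _)

instance : CharZero (FunctionField I) :=
  charZero_of_injective_algebraMap
    (FaithfulSMul.algebraMap_injective ℚ (FunctionField I))

/-- Clearing denominators in the function field and lifting from the coordinate ring to polynomials.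
-/
theorem exists_map_toField (P : Polynomial (FunctionField I)) :
    ∃ s ∉ I, ∃ P' : Polynomial (MvPolynomial (Fin n) ℝ),
      P'.map (toField I) = Polynomial.C (toField I s) * P := by
  obtain ⟨b, hb, h⟩ := IsLocalization.integerNormalization_spec
    (nonZeroDivisors (MvPolynomial (Fin n) ℝ ⧸ I)) P
  obtain ⟨s, rfl⟩ := Ideal.Quotient.mk_surjective b
  obtain ⟨P', hP'⟩ := Polynomial.map_surjective _ (Ideal.Quotient.mk_surjective (I := I))
    (IsLocalization.integerNormalization (nonZeroDivisors (MvPolynomial (Fin n) ℝ ⧸ I)) P)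
  refine ⟨s, fun hs => nonZeroDivisors.ne_zero hb (Ideal.Quotient.eq_zero_iff_mem.2 hs), P', ?_⟩
  rw [toField, ← Polynomial.map_map, hP', h]
  ext i
  rw [Polynomial.coeff_smul, Polynomial.coeff_C_mul, Algebra.smul_def, RingHom.comp_apply]

omit [I.IsPrime] in
theorem value_eq_zero_of_map_eq_zero {P : Polynomial (MvPolynomial (Fin n) ℝ)}
    (hP : P.map (toField I) = 0) {p : (Fin n → ℝ) × ℝ}
    (hp : ∀ a ∈ I, MvPolynomial.eval p.1 a = 0) : value P p = 0 := by
  rw [value_eq_sum]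
  refine Finset.sum_eq_zero fun i _ => ?_
  rw [hp _ (toField_eq_zero.1 ?_), zero_mul]
  rw [← Polynomial.coeff_map, hP, Polynomial.coeff_zero]

/-- Transfers an identity over the function field to points: after clearing denominators it holds
modulo `I`, hence at every point of the zero locus of `I` where the common denominator `s` does not
vanish. -/
theorem exists_value_eq_zero {P Q R : Polynomial (MvPolynomial (Fin n) ℝ)}
    {a b : Polynomial (FunctionField I)}
    (h : R.map (toField I) = a * P.map (toField I) + b * Q.map (toField I)) :
    ∃ s ∉ I, ∀ p : (Fin n → ℝ) × ℝ, (∀ a ∈ I, MvPolynomial.eval p.1 a = 0) →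
      MvPolynomial.eval p.1 s ≠ 0 → value P p = 0 → value Q p = 0 → value R p = 0 := by
  obtain ⟨s, hs, a', ha⟩ := exists_map_toField a
  obtain ⟨t, ht, b', hb⟩ := exists_map_toField b
  refine ⟨s * t, fun h => (‹I.IsPrime›.mem_or_mem h).elim hs ht, fun p hp h0 hP hQ => ?_⟩
  have := value_eq_zero_of_map_eq_zero (I := I) (P := Polynomial.C (s * t) * R -
    (Polynomial.C t * a' * P + Polynomial.C s * b' * Q)) (by
      simp only [Polynomial.map_add, Polynomial.map_sub, Polynomial.map_mul, Polynomial.map_C, ha,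
        hb, h, map_mul]
      ring) hp
  rw [value_sub, value_mul, value_add, value_mul _ P, value_mul _ Q, hP, hQ, value_C, mul_zero,
    mul_zero, add_zero, sub_zero] at this
  exact (mul_eq_zero.1 this).resolve_left h0

/-- Over the function field, `F` has a separable factor prime to `G` whose product with `G` has a
power divisible by `F`. Divisibility, coprimality and separability are all polynomial identities, so
they persist at points outside `h = 0`, where `h` is the product of the leading coefficient of `Q`
and the four denominators. It avoids `I` because `I` is prime. -/
theorem exists_generic_separable {F G : Polynomial (MvPolynomial (Fin n) ℝ)}
    (hF : F.map (toField I) ≠ 0) :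
    ∃ (Q : Polynomial (MvPolynomial (Fin n) ℝ)), ∃ h ∉ I, ∀ p : (Fin n → ℝ) × ℝ,
      (∀ a ∈ I, MvPolynomial.eval p.1 a = 0) → MvPolynomial.eval p.1 h ≠ 0 →
      MvPolynomial.eval p.1 Q.leadingCoeff ≠ 0 ∧
      (value Q p = 0 → value Q.derivative p ≠ 0) ∧
      (value Q p = 0 ↔ value F p = 0 ∧ value G p ≠ 0) := by
  obtain ⟨q, hq0, hqF, ⟨a₁, b₁, h1⟩, ⟨k, hk⟩, hsep⟩ :=
    exists_separable_factor hF (G.map (toField I))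
  obtain ⟨s, hs, Q₀, hQ₀⟩ := exists_map_toField q
  have hs' : toField I s ≠ 0 := fun h => hs (toField_eq_zero.1 h)
  -- discard the top coefficients that vanish on the variety
  obtain ⟨Q, hQ, hlc⟩ : ∃ Q : Polynomial (MvPolynomial (Fin n) ℝ),
      Q.map (toField I) = Polynomial.C (toField I s) * q ∧ Q.leadingCoeff ∉ I := by
    have hr : Q₀.map (toField I) ∈ Polynomial.lifts (toField I) :=
      (Polynomial.mem_lifts _).2 ⟨Q₀, rfl⟩
    obtain ⟨Q, hQ, hdeg⟩ := Polynomial.exists_degree_eq_of_mem_lifts hr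
    refine ⟨Q, hQ.trans hQ₀, fun hmem => ?_⟩
    have hne : Q.map (toField I) ≠ 0 := by
      rw [hQ, hQ₀]
      exact mul_ne_zero (Polynomial.C_ne_zero.2 hs') hq0
    rw [← hQ] at hdeg
    have := Polynomial.natDegree_eq_of_degree_eq hdeg
    apply Polynomial.leadingCoeff_ne_zero.2 hne
    rw [Polynomial.leadingCoeff, ← this, Polynomial.coeff_map]
    exact toField_eq_zero.2 hmem
  have hu : Polynomial.C ((toField I s)⁻¹) * Q.map (toField I) = q := by
    rw [hQ, ← mul_assoc, ← Polynomial.C_mul, inv_mul_cancel₀ hs', Polynomial.C_1, one_mul]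
  -- `Q` divides `F`
  obtain ⟨c, hc⟩ := hqF
  obtain ⟨s₁, hs₁, H₁⟩ := exists_value_eq_zero (I := I) (P := Q) (Q := 0) (R := F)
    (a := c * Polynomial.C ((toField I s)⁻¹)) (b := 0) (by
      rw [zero_mul, add_zero, mul_assoc, hu, hc, mul_comm])
  -- `Q` is prime to `G`
  obtain ⟨s₂, hs₂, H₂⟩ := exists_value_eq_zero (I := I) (P := Q) (Q := G) (R := 1)
    (a := a₁ * Polynomial.C ((toField I s)⁻¹)) (b := b₁) (by
      rw [mul_assoc, hu, h1, Polynomial.map_one])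
  -- `F` divides a power of `Q * G`
  obtain ⟨d, hd⟩ := hk
  obtain ⟨s₃, hs₃, H₃⟩ := exists_value_eq_zero (I := I) (P := F) (Q := 0) (R := (Q * G) ^ k)
    (a := d * Polynomial.C (toField I s) ^ k) (b := 0) (by
      rw [zero_mul, add_zero, Polynomial.map_pow, Polynomial.map_mul, hQ, mul_assoc, mul_pow, hd]
      ring)
  -- `Q` is separable
  obtain ⟨a₂, b₂, h2⟩ := hsep
  obtain ⟨s₄, hs₄, H₄⟩ := exists_value_eq_zero (I := I) (P := Q) (Q := Q.derivative) (R := 1)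
    (a := a₂ * Polynomial.C ((toField I s)⁻¹)) (b := b₂ * Polynomial.C ((toField I s)⁻¹)) (by
      rw [mul_assoc, hu, mul_assoc, ← Polynomial.derivative_map]
      have : Polynomial.C ((toField I s)⁻¹) * (Polynomial.derivative (Q.map (toField I))) =
          Polynomial.derivative q := by
        rw [← hu, Polynomial.derivative_C_mul]
      rw [this, h2, Polynomial.map_one])
  have hI := ‹I.IsPrime›
  refine ⟨Q, Q.leadingCoeff * (s₁ * s₂ * (s₃ * s₄)), fun h => ?_, fun p hp h => ?_⟩
  · rcases hI.mem_or_mem h with h | h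
    · exact hlc h
    · rcases hI.mem_or_mem h with h | h <;> rcases hI.mem_or_mem h with h | h
      exacts [hs₁ h, hs₂ h, hs₃ h, hs₄ h]
  · simp only [map_mul, ne_eq, mul_eq_zero, not_or] at h
    obtain ⟨h0, ⟨e1, e2⟩, e3, e4⟩ := h
    have z0 : value (0 : Polynomial (MvPolynomial (Fin n) ℝ)) p = 0 := by simp [value]
    refine ⟨h0, fun hQ hQ' => ?_, fun hQ => ⟨H₁ p hp e1 hQ z0, fun hG => ?_⟩, fun ⟨hF, hG⟩ => ?_⟩
    · exact one_ne_zero ((value_one p).symm.trans (H₄ p hp e4 hQ hQ'))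
    · exact one_ne_zero ((value_one p).symm.trans (H₂ p hp e2 hQ hG))
    · have := H₃ p hp e3 hF z0
      rw [value_pow, value_mul] at this
      exact (mul_eq_zero.1 (eq_zero_of_pow_eq_zero this)).resolve_right hG

end Generic

/-- The locally closed sets to which the induction applies. -/
def stratum (I : Ideal (MvPolynomial (Fin n) ℝ)) (F G : Polynomial (MvPolynomial (Fin n) ℝ)) :
    Set ((Fin n → ℝ) × ℝ) :=
  {p | (∀ a ∈ I, MvPolynomial.eval p.1 a = 0) ∧ value F p = 0 ∧ value G p ≠ 0}

theorem isClosed_zeroLocus (I : Ideal (MvPolynomial (Fin n) ℝ)) :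
    IsClosed {x : Fin n → ℝ | ∀ a ∈ I, MvPolynomial.eval x a = 0} := by
  simp only [Set.ofPred_forall]
  exact isClosed_iInter fun a => isClosed_iInter fun _ =>
    isClosed_eq (MvPolynomial.continuous_eval a) continuous_const

theorem locallyCompactSpace_stratum (I : Ideal (MvPolynomial (Fin n) ℝ))
    (F G : Polynomial (MvPolynomial (Fin n) ℝ)) : LocallyCompactSpace (stratum I F G) := by
  apply IsLocallyClosed.locallyCompactSpace
  have : stratum I F G = (Prod.fst ⁻¹' {x | ∀ a ∈ I, MvPolynomial.eval x a = 0} ∩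
      {p | value F p = 0}) ∩ {p | value G p ≠ 0} := by
    ext p
    exact and_assoc.symm
  rw [this]
  refine IsLocallyClosed.inter (IsClosed.isLocallyClosed ?_) (IsOpen.isLocallyClosed ?_)
  · exact ((isClosed_zeroLocus I).preimage continuous_fst).inter
      (isClosed_eq (continuous_value F) continuous_const)
  · exact isOpen_ne_fun (continuous_value G) continuous_const

theorem stratum_inter (I : Ideal (MvPolynomial (Fin n) ℝ))
    (F G : Polynomial (MvPolynomial (Fin n) ℝ)) (a : MvPolynomial (Fin n) ℝ) :
    stratum I F G ∩ {p | MvPolynomial.eval p.1 a = 0} = stratum (I ⊔ Ideal.span {a}) F G := by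
  ext p
  constructor
  · rintro ⟨⟨h1, h2⟩, h3⟩
    refine ⟨fun b hb => ?_, h2⟩
    obtain ⟨c, hc, d, hd, rfl⟩ := Submodule.mem_sup.1 hb
    obtain ⟨e, rfl⟩ := Ideal.mem_span_singleton'.1 hd
    rw [map_add, h1 c hc, map_mul, show MvPolynomial.eval p.1 a = 0 from h3, mul_zero, add_zero]
  · rintro ⟨h1, h2⟩
    exact ⟨⟨fun b hb => h1 b (Ideal.mem_sup_left hb), h2⟩,
      h1 a (Ideal.mem_sup_right (Ideal.mem_span_singleton_self a))⟩

theorem stratum_diff (I : Ideal (MvPolynomial (Fin n) ℝ))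
    (F G : Polynomial (MvPolynomial (Fin n) ℝ)) (a : MvPolynomial (Fin n) ℝ) :
    stratum I F G \ {p | MvPolynomial.eval p.1 a = 0} = stratum I F (G * Polynomial.C a) := by
  ext p
  simp only [stratum, Set.mem_sdiff, Set.mem_ofPred_eq, value_mul, value_C, ne_eq, mul_eq_zero,
    not_or]
  tauto

/-- The base over which the family of polynomials behaves uniformly. -/
abbrev genericBase (I : Ideal (MvPolynomial (Fin n) ℝ)) (h : MvPolynomial (Fin n) ℝ) :
    Set (Fin n → ℝ) :=
  {x | (∀ a ∈ I, MvPolynomial.eval x a = 0) ∧ MvPolynomial.eval x h ≠ 0}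

/-- Over `ℝ` finitely many equations are equivalent to one, the vanishing of the sum of squares of
generators. -/
theorem clopenMultiplicative_genericBase
    (H : ∀ F G : MvPolynomial (Fin n) ℝ,
      ClopenMultiplicative {x | MvPolynomial.eval x F = 0 ∧ MvPolynomial.eval x G ≠ 0})
    (I : Ideal (MvPolynomial (Fin n) ℝ)) (h : MvPolynomial (Fin n) ℝ) :
    ClopenMultiplicative (genericBase I h) := by
  obtain ⟨s, hs⟩ := (isNoetherianRing_iff_ideal_fg _).1 inferInstance I
  refine (H (∑ a ∈ s, a ^ 2) h).congr (Homeomorph.setCongr ?_)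
  ext x
  refine and_congr_left fun _ => ?_
  rw [map_sum, Finset.sum_eq_zero_iff_of_nonneg fun a _ => by rw [map_pow]; positivity]
  constructor
  · intro hx a ha
    have : I ≤ RingHom.ker (MvPolynomial.eval x) := by
      rw [← hs, Ideal.span_le]
      intro b hb
      have := hx b hb
      rw [map_pow] at this
      exact eq_zero_of_pow_eq_zero this
    exact this ha
  · intro hx a ha
    rw [map_pow, hx a (hs ▸ Ideal.subset_span ha)]
    exact zero_pow two_ne_zero

theorem locallyCompactSpace_genericBase (I : Ideal (MvPolynomial (Fin n) ℝ))
    (h : MvPolynomial (Fin n) ℝ) : LocallyCompactSpace (genericBase I h) :=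
  IsLocallyClosed.locallyCompactSpace ((isClosed_zeroLocus I).isLocallyClosed.inter
    (isOpen_ne_fun (MvPolynomial.continuous_eval h) continuous_const).isLocallyClosed)

/-- A subset of the product of a subspace with the line, seen in the ambient product. -/
def prodSubtypeHomeo {X : Type*} [TopologicalSpace X] (S : Set X) (T : Set (X × ℝ))
    (hT : ∀ p ∈ T, p.1 ∈ S) : {p : S × ℝ | ((p.1 : X), p.2) ∈ T} ≃ₜ T where
  toFun p := ⟨(p.1.1, p.1.2), p.2⟩
  invFun p := ⟨(⟨p.1.1, hT _ p.2⟩, p.1.2), p.2⟩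
  left_inv _ := rfl
  right_inv _ := rfl
  continuous_toFun := ((continuous_subtype_val.comp (continuous_fst.comp
    continuous_subtype_val)).prodMk (continuous_snd.comp continuous_subtype_val)).subtype_mk _
  continuous_invFun := (((continuous_fst.comp continuous_subtype_val).subtype_mk _).prodMk
    (continuous_snd.comp continuous_subtype_val)).subtype_mk _

theorem isMultigraph_value {I : Ideal (MvPolynomial (Fin n) ℝ)}
    {Q : Polynomial (MvPolynomial (Fin n) ℝ)} {h : MvPolynomial (Fin n) ℝ}
    (hlc : ∀ x ∈ genericBase I h, MvPolynomial.eval x Q.leadingCoeff ≠ 0)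
    (hs : ∀ p : (Fin n → ℝ) × ℝ, p.1 ∈ genericBase I h → value Q p = 0 →
      value Q.derivative p ≠ 0) :
    IsMultigraph {p : genericBase I h × ℝ | value Q (p.1.1, p.2) = 0} := by
  have hc : Continuous fun p : genericBase I h × ℝ => ((p.1.1, p.2) : (Fin n → ℝ) × ℝ) :=
    (continuous_subtype_val.comp continuous_fst).prodMk continuous_snd
  exact isMultigraph_of_simple_zeros (q := fun p : genericBase I h × ℝ => value Q (p.1.1, p.2))
    (q' := fun p : genericBase I h × ℝ => value Q.derivative (p.1.1, p.2))
    ((continuous_value Q).comp hc) ((continuous_value _).comp hc)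
    (fun y t => hasDerivAt_value Q y.1 t) (fun p hp => hs (p.1.1, p.2) p.1.2 hp)
    (eventually_bound continuous_subtype_val fun y => hlc y.1 y.2)

/-- Three generic cases. If `F` and `G` both vanish at the generic point, the stratum is empty. If
only `F` does, it is the complement of the zeros of `G`, which form a multigraph. Otherwise it is
itself the multigraph of the zeros of the separable factor `Q`. -/
theorem clopenMultiplicative_stratum_diff
    (H : ∀ F G : MvPolynomial (Fin n) ℝ,
      ClopenMultiplicative {x | MvPolynomial.eval x F = 0 ∧ MvPolynomial.eval x G ≠ 0})
    (I : Ideal (MvPolynomial (Fin n) ℝ)) [I.IsPrime]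
    (F G : Polynomial (MvPolynomial (Fin n) ℝ)) :
    ∃ h ∉ I, ClopenMultiplicative
      (stratum I F G \ {p | MvPolynomial.eval p.1 h = 0} : Set ((Fin n → ℝ) × ℝ)) := by
  by_cases hF : F.map (toField I) = 0
  · by_cases hG : G.map (toField I) = 0
    · refine ⟨1, (Ideal.ne_top_iff_one I).1 Ideal.IsPrime.ne_top', ?_⟩
      have : IsEmpty (stratum I F G \ {p | MvPolynomial.eval p.1 1 = 0} :
          Set ((Fin n → ℝ) × ℝ)) :=
        ⟨fun p => p.2.1.2.2 (value_eq_zero_of_map_eq_zero hG p.2.1.1)⟩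
      exact ClopenMultiplicative.of_isEmpty _
    · obtain ⟨Q, h, hI, hQ⟩ := exists_generic_separable (G := 1) hG
      refine ⟨h, hI, ?_⟩
      have hlc := locallyCompactSpace_genericBase I h
      refine ((clopenMultiplicative_genericBase H I h).compl_multigraph (m := Q.natDegree)
        (isMultigraph_value (fun x hx => (hQ (x, 0) hx.1 hx.2).1)
          fun p hp => (hQ p hp.1 hp.2).2.1)
        (fun y => (finite_zeros (hQ (y.1, 0) y.2.1 y.2.2).1).1)
        (fun y => (finite_zeros (hQ (y.1, 0) y.2.1 y.2.2).1).2.trans (Nat.le_succ _))).congr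
        ((Homeomorph.setCongr ?_).trans (prodSubtypeHomeo (genericBase I h) _
          fun p hp => ⟨hp.1.1, hp.2⟩))
      ext p
      have := (hQ (p.1.1, p.2) p.1.2.1 p.1.2.2).2.2
      simp only [value_one, ne_eq, one_ne_zero, not_false_eq_true, and_true] at this
      simp only [Set.mem_compl_iff, Set.mem_ofPred_eq, this]
      exact ⟨fun h => ⟨⟨p.1.2.1, value_eq_zero_of_map_eq_zero hF p.1.2.1, h⟩, p.1.2.2⟩,
        fun h => h.1.2.2⟩
  · obtain ⟨Q, h, hI, hQ⟩ := exists_generic_separable (G := G) hF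
    refine ⟨h, hI, ?_⟩
    have hlc := locallyCompactSpace_genericBase I h
    refine ((clopenMultiplicative_genericBase H I h).multigraph Q.natDegree _
      (isMultigraph_value (fun x hx => (hQ (x, 0) hx.1 hx.2).1)
          fun p hp => (hQ p hp.1 hp.2).2.1)
      (fun y => (finite_zeros (hQ (y.1, 0) y.2.1 y.2.2).1).1)
      (fun y => (finite_zeros (hQ (y.1, 0) y.2.1 y.2.2).1).2)).congr
      ((Homeomorph.setCongr ?_).trans (prodSubtypeHomeo (genericBase I h) _
        fun p hp => ⟨hp.1.1, hp.2⟩))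
    ext p
    have := (hQ (p.1.1, p.2) p.1.2.1 p.1.2.2).2.2
    simp only [Set.mem_ofPred_eq, this]
    exact ⟨fun h => ⟨⟨p.1.2.1, h⟩, p.1.2.2⟩, fun h => h.1.2⟩

/-- Noetherian induction: the statement is assumed for all larger ideals. For prime `I` the locus `h
= 0` belongs to a larger ideal and its complement is the generic case. If `a * b ∈ I` with neither
factor in `I`, the stratum is split along `a = 0`; where `a ≠ 0`, necessarily `b = 0`, so both parts
belong to larger ideals. -/
theorem clopenMultiplicative_stratum
    (H : ∀ F G : MvPolynomial (Fin n) ℝ,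
      ClopenMultiplicative {x | MvPolynomial.eval x F = 0 ∧ MvPolynomial.eval x G ≠ 0})
    (I : Ideal (MvPolynomial (Fin n) ℝ)) :
    ∀ F G : Polynomial (MvPolynomial (Fin n) ℝ), ClopenMultiplicative (stratum I F G) := by
  induction I using IsNoetherian.induction with
  | hgt I ih =>
    have hlt : ∀ a ∉ I, I < I ⊔ Ideal.span {a} := fun a ha =>
      lt_of_le_of_ne le_sup_left fun h => ha (h ▸
        Ideal.mem_sup_right (Ideal.mem_span_singleton_self a))
    have hcl : ∀ a : MvPolynomial (Fin n) ℝ,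
        IsClosed {p : (Fin n → ℝ) × ℝ | MvPolynomial.eval p.1 a = 0} := fun a =>
      isClosed_eq ((MvPolynomial.continuous_eval a).comp continuous_fst) continuous_const
    intro F G
    have hlc := locallyCompactSpace_stratum I F G
    by_cases hI : Ideal.IsPrime I
    · obtain ⟨h, hI, hd⟩ := clopenMultiplicative_stratum_diff H I F G
      refine ClopenMultiplicative.of_inter_of_diff (hcl h) ?_ hd
      rw [stratum_inter]
      exact ih _ (hlt h hI) F G
    · rcases (Ideal.not_isPrime_iff (I := I)).1 hI with rfl | ⟨a, ha, b, hb, hab⟩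
      · have : IsEmpty (stratum (⊤ : Ideal _) F G) := ⟨fun p => by
          have := p.2.1 1 Submodule.mem_top
          simp at this⟩
        exact ClopenMultiplicative.of_isEmpty _
      · refine ClopenMultiplicative.of_inter_of_diff (hcl a) ?_ ?_
        · rw [stratum_inter]
          exact ih _ (hlt a ha) F G
        · rw [stratum_diff]
          have : stratum I F (G * Polynomial.C a) =
              stratum (I ⊔ Ideal.span {b}) F (G * Polynomial.C a) := by
            rw [← stratum_inter]
            refine (Set.inter_eq_left.2 fun p hp => ?_).symm
            have h1 := hp.1 _ hab
            have h2 := hp.2.2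
            rw [value_mul, value_C] at h2
            rw [map_mul] at h1
            exact (mul_eq_zero.1 h1).resolve_left (right_ne_zero_of_mul h2)
          rw [this]
          exact ih _ (hlt b hb) _ _

end FiberwisePolynomial

/-- Splitting off the first coordinate. -/
def consHomeo (n : ℕ) : (Fin n → ℝ) × ℝ ≃ₜ (Fin (n + 1) → ℝ) where
  toFun p := Fin.cons p.2 p.1
  invFun x := (Fin.tail x, x 0)
  left_inv _ := by simp
  right_inv _ := by simp
  continuous_toFun := by
    refine continuous_pi fun i => ?_
    refine Fin.cases ?_ (fun i => ?_) i
    · exact continuous_snd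
    · exact (continuous_apply i).comp continuous_fst
  continuous_invFun := by
    refine Continuous.prodMk ?_ (continuous_apply 0)
    exact continuous_pi fun i => continuous_apply i.succ

open FiberwisePolynomial in
/-- Every open and closed part of a difference of two real algebraic sets has a defined Euler
characteristic with compact supports, which is multiplicative in products. -/
theorem clopenMultiplicative_algebraic (n : ℕ) : ∀ F G : MvPolynomial (Fin n) ℝ,
    ClopenMultiplicative {x | MvPolynomial.eval x F = 0 ∧ MvPolynomial.eval x G ≠ 0} := by
  induction n with
  | zero =>
    intro F G
    rcases Set.eq_empty_or_nonempty
      {x : Fin 0 → ℝ | MvPolynomial.eval x F = 0 ∧ MvPolynomial.eval x G ≠ 0} with h | ⟨x, hx⟩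
    · rw [h]
      exact ClopenMultiplicative.of_isEmpty _
    · let := Unique.mk'
        {x : Fin 0 → ℝ | MvPolynomial.eval x F = 0 ∧ MvPolynomial.eval x G ≠ 0}
        (h₁ := ⟨⟨x, hx⟩⟩)
      exact ClopenMultiplicative.of_unique _
  | succ n ih =>
    intro F G
    -- The zero ideal puts no condition on the base; the first coordinate serves as the fibre
    -- variable.
    refine (clopenMultiplicative_stratum ih ⊥ (MvPolynomial.finSuccEquiv ℝ n F)
      (MvPolynomial.finSuccEquiv ℝ n G)).congr ((consHomeo n).sets ?_)
    ext p
    simp only [stratum, Set.mem_preimage, Set.mem_ofPred_eq, value]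
    change _ ↔ MvPolynomial.eval (Fin.cons p.2 p.1) F = 0 ∧
      MvPolynomial.eval (Fin.cons p.2 p.1) G ≠ 0
    rw [MvPolynomial.eval_eq_eval_mv_eval', MvPolynomial.eval_eq_eval_mv_eval']
    simp

end

/-! ### Analytic germs and their Taylor polynomials along arcs -/

noncomputable section

open Filter Asymptotics

/-! ### Order of vanishing along a polynomial or analytic function of one variable -/

/-- Dividing by `t ^ k` away from 0 would give `g = O(t ^ (m - k))`, so `g` would tend to 0. -/
theorem not_isBigO_pow_of_ne_zero {u g : ℝ → ℝ} {k m : ℕ} (hg : ContinuousAt g 0) (h0 : g 0 ≠ 0)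
    (hu : ∀ᶠ t in 𝓝 (0 : ℝ), u t = t ^ k * g t) (hkm : k < m) :
    ¬ u =O[𝓝 0] fun t => t ^ m := by
  intro h
  have h1 : g =O[𝓝[≠] 0] fun t : ℝ => t ^ (m - k) := by
    obtain ⟨c, hc⟩ := h.bound
    refine IsBigO.of_bound c ?_
    filter_upwards [hc.filter_mono nhdsWithin_le_nhds, hu.filter_mono nhdsWithin_le_nhds,
      self_mem_nhdsWithin] with t h1 h2 (h3 : t ≠ 0)
    rw [h2, ← Nat.add_sub_cancel' hkm.le, pow_add, norm_mul, norm_mul, mul_left_comm] at h1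
    exact le_of_mul_le_mul_left h1 (norm_pos_iff.2 (pow_ne_zero _ h3))
  have h2 : Tendsto (fun t : ℝ => t ^ (m - k)) (𝓝[≠] 0) (𝓝 0) := by
    have : ContinuousAt (fun t : ℝ => t ^ (m - k)) 0 := by fun_prop
    have h3 := this.tendsto
    rw [zero_pow (Nat.sub_ne_zero_of_lt hkm)] at h3
    exact h3.mono_left nhdsWithin_le_nhds
  exact h0 (tendsto_nhds_unique (hg.tendsto.mono_left nhdsWithin_le_nhds) (h1.trans_tendsto h2))

theorem Polynomial.X_pow_dvd_of_isBigO {q : Polynomial ℝ} {m : ℕ}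
    (h : (fun t => q.eval t) =O[𝓝 0] fun t : ℝ => t ^ m) : Polynomial.X ^ m ∣ q := by
  by_cases hq : q = 0
  · simp [hq]
  obtain ⟨r, hr, hd⟩ := Polynomial.exists_eq_pow_rootMultiplicity_mul_and_not_dvd q hq 0
  rw [map_zero, sub_zero] at hr hd
  by_contra hm
  refine not_isBigO_pow_of_ne_zero (k := q.rootMultiplicity 0) (g := fun t => r.eval t)
    r.continuous.continuousAt ?_ (Eventually.of_forall fun t => ?_) ?_ h
  · rwa [Ne, ← Polynomial.coeff_zero_eq_eval_zero, ← Polynomial.X_dvd_iff]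
  · conv_lhs => rw [hr]
    simp
  · by_contra hk
    exact hm ((pow_dvd_pow _ (not_lt.1 hk)).trans ⟨r, hr⟩)

theorem AnalyticAt.exists_eq_pow_mul_of_isBigO {u : ℝ → ℝ} (hu : AnalyticAt ℝ u 0) {m : ℕ}
    (h : u =O[𝓝 0] fun t : ℝ => t ^ m) :
    ∃ g, AnalyticAt ℝ g 0 ∧ ∀ᶠ t in 𝓝 (0 : ℝ), u t = t ^ m * g t := by
  have key : (m : ℕ∞) ≤ analyticOrderAt u 0 := by
    by_contra hlt
    rw [not_le] at hlt
    obtain ⟨k, hk⟩ := ENat.ne_top_iff_exists.1 (ne_top_of_lt hlt)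
    obtain ⟨g, hg, h0, he⟩ := hu.analyticOrderAt_eq_natCast.1 hk.symm
    rw [← hk] at hlt
    exact not_isBigO_pow_of_ne_zero hg.continuousAt h0 (by simpa using he)
      (by exact_mod_cast hlt) h
  obtain ⟨g, hg, he⟩ := (natCast_le_analyticOrderAt hu).1 key
  exact ⟨g, hg, by simpa using he⟩

/-! ### Polynomial approximation of analytic germs -/

/-- The germ of `f` at `0` agrees with the polynomial `F` up to order `n`. -/
def ApproximatedBy {d : ℕ} (f : (Fin d → ℝ) → ℝ) (F : MvPolynomial (Fin d) ℝ) (n : ℕ) : Prop :=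
  (fun x => f x - MvPolynomial.eval x F) =O[𝓝 0] fun x => ‖x‖ ^ (n + 1)

theorem AnalyticAt.exists_approximatedBy {d : ℕ} {f : (Fin d → ℝ) → ℝ} (hf : AnalyticAt ℝ f 0)
    (n : ℕ) : ∃ F, ApproximatedBy f F n := by
  obtain ⟨p, hp⟩ := hf
  have h1 : ∀ k, ∃ F : MvPolynomial (Fin d) ℝ, ∀ x : Fin d → ℝ,
      p k (fun _ => x) = MvPolynomial.eval x F := by
    intro k
    -- The multilinear form on the diagonal, expanded in the standard basis: one monomial for each
    -- choice `r` of basis vectors.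
    refine ⟨∑ r : Fin k → Fin d, (∏ j, MvPolynomial.X (r j)) *
      MvPolynomial.C (p k fun j => Pi.single (r j) 1), fun x => ?_⟩
    have hx : x = ∑ i, x i • (Pi.single i (1 : ℝ) : Fin d → ℝ) := by
      conv_lhs => rw [← Finset.univ_sum_single x]
      exact Finset.sum_congr rfl fun i _ => by rw [← Pi.single_smul, smul_eq_mul, mul_one]
    have h2 := (p k).toMultilinearMap.map_sum
      (fun (_ : Fin k) i => x i • (Pi.single i (1 : ℝ) : Fin d → ℝ))
    rw [← hx] at h2
    rw [map_sum]
    refine h2.trans (Finset.sum_congr rfl fun r _ => ?_)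
    rw [MultilinearMap.map_smul_univ]
    simp
  choose F hF using h1
  refine ⟨∑ k ∈ Finset.range (n + 1), F k, ?_⟩
  refine (hp.isBigO_sub_partialSum_pow (n + 1)).congr_left fun x => ?_
  rw [zero_add, map_sum, FormalMultilinearSeries.partialSum]
  simp only [hF]

namespace ApproximatedBy

variable {d d₁ d₂ n : ℕ} {f : (Fin d → ℝ) → ℝ} {F : MvPolynomial (Fin d) ℝ}

/-- At `x = 0` the error bound is 0, so `F` and `f` have the same value there. -/
theorem constantCoeff (h : ApproximatedBy f F n) (h0 : f 0 = 0) :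
    MvPolynomial.constantCoeff F = 0 := by
  have := h.eq_zero_imp.self_of_nhds (by simp)
  rw [h0, zero_sub, neg_eq_zero] at this
  rw [← MvPolynomial.eval_zero]
  exact this

theorem mono (h : ApproximatedBy f F n) {i : ℕ} (hi : i ≤ n) : ApproximatedBy f F i := by
  refine IsBigO.trans h (IsBigO.of_bound 1 ?_)
  filter_upwards [Metric.ball_mem_nhds (0 : Fin d → ℝ) one_pos] with x hx
  rw [mem_ball_zero_iff] at hx
  rw [one_mul, norm_pow, norm_pow, norm_norm]
  exact pow_le_pow_of_le_one (norm_nonneg x) hx.le (by omega)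

/-- The polynomial `F(x) + G(y)`. -/
def _root_.MvPolynomial.joinSum (F : MvPolynomial (Fin d₁) ℝ) (G : MvPolynomial (Fin d₂) ℝ) :
    MvPolynomial (Fin (d₁ + d₂)) ℝ :=
  MvPolynomial.rename (Fin.castAdd d₂) F + MvPolynomial.rename (Fin.natAdd d₁) G

theorem thomSebastianiSum {f : (Fin d₁ → ℝ) → ℝ} {g : (Fin d₂ → ℝ) → ℝ}
    {F : MvPolynomial (Fin d₁) ℝ} {G : MvPolynomial (Fin d₂) ℝ} (hf : ApproximatedBy f F n)
    (hg : ApproximatedBy g G n) :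
    ApproximatedBy (thomSebastianiSum f g) (F.joinSum G) n := by
  have aux : ∀ {e : ℕ} {φ : (Fin e → ℝ) → ℝ} (ι : Fin e → Fin (d₁ + d₂)),
      (φ =O[𝓝 0] fun x => ‖x‖ ^ (n + 1)) →
      (fun z : Fin (d₁ + d₂) → ℝ => φ (fun i => z (ι i))) =O[𝓝 0] fun z => ‖z‖ ^ (n + 1) := by
    intro e φ ι h
    have hc : Tendsto (fun z : Fin (d₁ + d₂) → ℝ => fun i => z (ι i)) (𝓝 0) (𝓝 0) := by
      have : Continuous (fun z : Fin (d₁ + d₂) → ℝ => fun i => z (ι i)) := by fun_prop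
      exact this.tendsto 0
    refine (h.comp_tendsto hc).trans (IsBigO.of_bound 1 (Eventually.of_forall fun z => ?_))
    rw [one_mul, Function.comp, norm_pow, norm_pow, norm_norm, norm_norm]
    exact pow_le_pow_left₀ (norm_nonneg _)
      ((pi_norm_le_iff_of_nonneg (norm_nonneg z)).2 fun i => norm_le_pi_norm z _) _
  refine ((aux (Fin.castAdd d₂) hf).add (aux (Fin.natAdd d₁) hg)).congr_left fun z => ?_
  simp only [_root_.thomSebastianiSum, MvPolynomial.joinSum, map_add, MvPolynomial.eval_rename]
  simp only [Function.comp_def]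
  ring

end ApproximatedBy

theorem AnalyticAt.thomSebastianiSum {d₁ d₂ : ℕ} {f : (Fin d₁ → ℝ) → ℝ} {g : (Fin d₂ → ℝ) → ℝ}
    (hf : AnalyticAt ℝ f 0) (hg : AnalyticAt ℝ g 0) :
    AnalyticAt ℝ (thomSebastianiSum f g) 0 := by
  have aux : ∀ {e : ℕ} {φ : (Fin e → ℝ) → ℝ} (ι : Fin e → Fin (d₁ + d₂)), AnalyticAt ℝ φ 0 →
      AnalyticAt ℝ (fun z : Fin (d₁ + d₂) → ℝ => φ (fun i => z (ι i))) 0 := by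
    intro e φ ι h
    have h1 := (ContinuousLinearMap.pi (R := ℝ) (φ := fun _ : Fin e => ℝ) fun i =>
      ContinuousLinearMap.proj (R := ℝ) (φ := fun _ : Fin (d₁ + d₂) => ℝ) (ι i)).analyticAt 0
    exact AnalyticAt.fun_comp (g := φ) (by exact h) h1
  exact (aux (Fin.castAdd d₂) hf).add (aux (Fin.natAdd d₁) hg)

/-! ### Coefficients of a polynomial along an arc -/

open Polynomial in
/-- The components of the arc with coefficients `a`, as polynomials in the parameter. -/
def arcPolynomial {R : Type*} [CommSemiring R] {n d : ℕ} (a : Fin n → Fin d → R) (i : Fin d) : R[X] :=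
  ∑ k : Fin n, C (a k i) * X ^ ((k : ℕ) + 1)

/-- The coefficient at `t^k` of `F` along the arc with coefficients `a`. -/
def arcCoeff {R : Type*} [CommRing R] [Algebra ℝ R] {n d : ℕ} (F : MvPolynomial (Fin d) ℝ) (k : ℕ)
    (a : Fin n → Fin d → R) : R :=
  (MvPolynomial.aeval (arcPolynomial a) F).coeff k

section ArcPolynomial

open Polynomial

variable {R S : Type*} [CommRing R] [CommRing S] [Algebra ℝ R] [Algebra ℝ S] {n d : ℕ}

omit [Algebra ℝ R] in
theorem coeff_arcPolynomial_zero (a : Fin n → Fin d → R) (i : Fin d) :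
    (arcPolynomial a i).coeff 0 = 0 := by
  simp [arcPolynomial]

omit [Algebra ℝ R] in
theorem coeff_arcPolynomial_succ (a : Fin n → Fin d → R) (i : Fin d) (k : ℕ) :
    (arcPolynomial a i).coeff (k + 1) = if h : k < n then a ⟨k, h⟩ i else 0 := by
  simp only [arcPolynomial, finsetSum_coeff, coeff_C_mul_X_pow, add_left_inj]
  split_ifs with h
  · rw [Finset.sum_eq_single ⟨k, h⟩]
    · simp
    · intro b _ hb
      exact if_neg fun hk => hb (Fin.ext hk.symm)
    · simp
  · exact Finset.sum_eq_zero fun b _ => if_neg fun (hk : k = b) => h (by omega)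

theorem arcCoeff_map (φ : R →ₐ[ℝ] S) (F : MvPolynomial (Fin d) ℝ) (k : ℕ)
    (a : Fin n → Fin d → R) : arcCoeff F k (fun j i => φ (a j i)) = φ (arcCoeff F k a) := by
  have : arcPolynomial (fun j i => φ (a j i)) = fun i => mapAlgHom φ (arcPolynomial a i) := by
    funext i
    simp [arcPolynomial]
  have h := MvPolynomial.comp_aeval_apply (arcPolynomial a) (mapAlgHom φ) F
  rw [arcCoeff, this, ← h, coe_mapAlgHom, coeff_map]
  rfl

theorem aeval_congr_of_dvd {γ δ : Fin d → R[X]} {m : R[X]} (h : ∀ i, m ∣ γ i - δ i)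
    (F : MvPolynomial (Fin d) ℝ) :
    m ∣ MvPolynomial.aeval γ F - MvPolynomial.aeval δ F := by
  rw [← Ideal.mem_span_singleton, ← Ideal.Quotient.mk_eq_mk_iff_sub_mem]
  have e : ∀ γ : Fin d → R[X], Ideal.Quotient.mk (Ideal.span {m}) (MvPolynomial.aeval γ F) =
      MvPolynomial.aeval (fun i => Ideal.Quotient.mkₐ ℝ (Ideal.span {m}) (γ i)) F := by
    intro γ
    exact MvPolynomial.comp_aeval_apply γ (Ideal.Quotient.mkₐ ℝ (Ideal.span {m})) F
  rw [e, e]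
  congr 2
  funext i
  exact (Ideal.Quotient.mk_eq_mk_iff_sub_mem _ _).2 (Ideal.mem_span_singleton.2 (h i))

omit [Algebra ℝ R] in
theorem X_pow_dvd_sub_iff {p q : R[X]} {m : ℕ} :
    X ^ m ∣ p - q ↔ ∀ k < m, p.coeff k = q.coeff k := by
  simp [X_pow_dvd_iff, sub_eq_zero]

theorem coeff_aeval_congr {γ δ : Fin d → R[X]} {m : ℕ}
    (h : ∀ i, ∀ k ≤ m, (γ i).coeff k = (δ i).coeff k) (F : MvPolynomial (Fin d) ℝ) {k : ℕ}
    (hk : k ≤ m) : (MvPolynomial.aeval γ F).coeff k = (MvPolynomial.aeval δ F).coeff k :=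
  X_pow_dvd_sub_iff.1 (aeval_congr_of_dvd (m := X ^ (m + 1))
    (fun i => X_pow_dvd_sub_iff.2 fun k hk => h i k (by omega)) F) k (by omega)

/-- Coefficients of low order depend only on the beginning of the arc. -/
theorem arcCoeff_append (F : MvPolynomial (Fin d) ℝ) {i m k : ℕ} (hk : k ≤ i)
    (a : Fin i → Fin d → R) (b : Fin m → Fin d → R) :
    arcCoeff F k (Fin.append a b) = arcCoeff F k a := by
  refine coeff_aeval_congr (fun j l hl => ?_) F hk
  cases l with
  | zero => rw [coeff_arcPolynomial_zero, coeff_arcPolynomial_zero]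
  | succ l =>
    rw [coeff_arcPolynomial_succ, coeff_arcPolynomial_succ, dif_pos (by omega), dif_pos (by omega)]
    exact congrFun (Fin.append_left a b ⟨l, by omega⟩) j

theorem arcCoeff_zero {F : MvPolynomial (Fin d) ℝ} (hF : MvPolynomial.constantCoeff F = 0)
    (a : Fin n → Fin d → R) : arcCoeff F 0 a = 0 := by
  rw [arcCoeff, coeff_aeval_congr (m := 0) (δ := fun _ => 0) _ F le_rfl]
  · simp [MvPolynomial.aeval_zero', hF]
  · intro i k hk
    obtain rfl : k = 0 := by omega
    rw [coeff_arcPolynomial_zero, coeff_zero]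

theorem arcCoeff_joinSum {d₁ d₂ : ℕ} (F : MvPolynomial (Fin d₁) ℝ) (G : MvPolynomial (Fin d₂) ℝ)
    (k : ℕ) (c : Fin n → Fin (d₁ + d₂) → R) :
    arcCoeff (F.joinSum G) k c = arcCoeff F k (fun j i => c j (Fin.castAdd d₂ i)) +
      arcCoeff G k (fun j i => c j (Fin.natAdd d₁ i)) := by
  rw [arcCoeff, MvPolynomial.joinSum, map_add, MvPolynomial.aeval_rename,
    MvPolynomial.aeval_rename, coeff_add]
  rfl

/-- Weighted homogeneity of the coefficients along an arc. -/
theorem arcCoeff_smul (F : MvPolynomial (Fin d) ℝ) (k : ℕ) (c : R) (a : Fin n → Fin d → R) :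
    arcCoeff F k (fun j i => c ^ ((j : ℕ) + 1) * a j i) = c ^ k * arcCoeff F k a := by
  -- The substitution `t ↦ c t`, which multiplies the coefficient at `t ^ l` by `c ^ l`.
  let φ : R[X] →ₐ[ℝ] R[X] := (aeval (C c * X : R[X])).restrictScalars ℝ
  have hφ : ∀ p : R[X], ∀ l, (φ p).coeff l = p.coeff l * c ^ l := fun p l =>
    comp_C_mul_X_coeff
  have e : arcPolynomial (fun j i => c ^ ((j : ℕ) + 1) * a j i) =
      fun i => φ (arcPolynomial a i) := by
    funext i
    ext k
    rw [hφ]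
    cases k with
    | zero => rw [coeff_arcPolynomial_zero, coeff_arcPolynomial_zero, zero_mul]
    | succ k =>
      rw [coeff_arcPolynomial_succ, coeff_arcPolynomial_succ]
      split_ifs
      · exact mul_comm _ _
      · exact (zero_mul _).symm
  have h := MvPolynomial.comp_aeval_apply (arcPolynomial a) φ F
  rw [arcCoeff, e, ← h, hφ, mul_comm]
  rfl

/-- Evaluate `F` along the universal arc, whose coefficients are variables, and specialize. This is
the reason for allowing arcs over an arbitrary algebra. -/
theorem exists_arcCoeff_eq_eval (F : MvPolynomial (Fin d) ℝ) (n k : ℕ) :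
    ∃ p : MvPolynomial (Fin n × Fin d) ℝ, ∀ a : Fin n → Fin d → ℝ,
      arcCoeff F k a = MvPolynomial.eval (fun x => a x.1 x.2) p := by
  refine ⟨arcCoeff F k fun j i => MvPolynomial.X (j, i), fun a => ?_⟩
  have := arcCoeff_map (MvPolynomial.aeval fun x : Fin n × Fin d => a x.1 x.2) F k
    fun j i => MvPolynomial.X (j, i)
  simp only [MvPolynomial.aeval_X] at this
  rw [this]
  rfl

@[fun_prop]
theorem continuous_arcCoeff (F : MvPolynomial (Fin d) ℝ) (k : ℕ) :
    Continuous fun a : Fin n → Fin d → ℝ => arcCoeff F k a := by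
  obtain ⟨p, hp⟩ := exists_arcCoeff_eq_eval F n k
  simp only [hp]
  exact (MvPolynomial.continuous_eval p).comp (by fun_prop)

theorem truncatedArc_eq (a : Fin n → Fin d → ℝ) (t : ℝ) :
    truncatedArc a t = fun i => (arcPolynomial a i).eval t := by
  funext i
  simp [truncatedArc, arcPolynomial, eval_finsetSum, mul_comm (a _ _)]

theorem eval_truncatedArc (F : MvPolynomial (Fin d) ℝ) (a : Fin n → Fin d → ℝ) (t : ℝ) :
    MvPolynomial.eval (truncatedArc a t) F = (MvPolynomial.aeval (arcPolynomial a) F).eval t := by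
  rw [truncatedArc_eq]
  have := MvPolynomial.comp_aeval_apply (arcPolynomial a) (aeval (R := ℝ) t) F
  rw [← coe_aeval_eq_eval, this]
  rfl

end ArcPolynomial

theorem analyticAt_truncatedArc {n d : ℕ} (a : Fin n → Fin d → ℝ) :
    AnalyticAt ℝ (truncatedArc a) 0 := by
  unfold truncatedArc
  fun_prop

theorem truncatedArc_isBigO {n d : ℕ} (a : Fin n → Fin d → ℝ) :
    truncatedArc a =O[𝓝 0] fun t => t := by
  have h0 : truncatedArc a 0 = 0 := by simp [truncatedArc]
  simpa [h0] using (analyticAt_truncatedArc a).differentiableAt.isBigO_sub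

/-- The sets of arcs occurring in the zeta functions are semialgebraic. -/
theorem ApproximatedBy.arcsWithCoeff_eq {d i n : ℕ} {f : (Fin d → ℝ) → ℝ}
    {F : MvPolynomial (Fin d) ℝ} (hF : ApproximatedBy f F n) (hf : AnalyticAt ℝ f 0) (hi : i ≤ n)
    (S : Set ℝ) : arcsWithCoeff f i S = {a | (∀ k < i, arcCoeff F k a = 0) ∧ arcCoeff F i a ∈ S} := by
  ext a
  have h0 : truncatedArc a 0 = 0 := by simp [truncatedArc]
  have hfa : AnalyticAt ℝ (fun t => f (truncatedArc a t)) 0 :=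
    AnalyticAt.fun_comp (g := f) (by rwa [h0]) (analyticAt_truncatedArc a)
  have hO := truncatedArc_isBigO a
  have hlim : Tendsto (truncatedArc a) (𝓝 0) (𝓝 0) := by
    have := (analyticAt_truncatedArc a).continuousAt.tendsto
    rwa [h0] at this
  -- The germs differ by `O(‖x‖ ^ (i + 1))`, and the arc is `O(t)`.
  have h1 : (fun t => f (truncatedArc a t) - (MvPolynomial.aeval (arcPolynomial a) F).eval t)
      =O[𝓝 0] fun t : ℝ => t ^ (i + 1) := by
    refine (((hF.mono hi).comp_tendsto hlim).congr_left fun t => ?_).trans (hO.norm_left.pow (i + 1))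
    simp only [Function.comp, eval_truncatedArc]
  -- Conditions on the coefficients become a condition up to `O(t ^ (i + 1))`, which cannot tell `f`
  -- from `F`.
  have hpoly : ∀ c : ℝ, ((∀ k < i, arcCoeff F k a = 0) ∧ arcCoeff F i a = c) ↔
      (fun t => (MvPolynomial.aeval (arcPolynomial a) F).eval t - c * t ^ i)
        =O[𝓝 0] fun t : ℝ => t ^ (i + 1) := by
    intro c
    have e : ∀ t, (MvPolynomial.aeval (arcPolynomial a) F - Polynomial.C c * Polynomial.X ^ i).eval t
        = (MvPolynomial.aeval (arcPolynomial a) F).eval t - c * t ^ i := fun t => by simp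
    simp only [← e]
    have e2 : ((∀ k < i, arcCoeff F k a = 0) ∧ arcCoeff F i a = c) ↔ Polynomial.X ^ (i + 1) ∣
        (MvPolynomial.aeval (arcPolynomial a) F - Polynomial.C c * Polynomial.X ^ i) := by
      rw [X_pow_dvd_sub_iff]
      simp only [Polynomial.coeff_C_mul_X_pow, Order.lt_add_one_iff]
      constructor
      · rintro ⟨h1, h2⟩ k hk
        split_ifs with h
        · rw [h]; exact h2
        · exact h1 k (by omega)
      · intro h
        refine ⟨fun k hk => (h k hk.le).trans (if_neg hk.ne), (h i le_rfl).trans (if_pos rfl)⟩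
    rw [e2]
    refine ⟨?_, Polynomial.X_pow_dvd_of_isBigO⟩
    rintro ⟨q, hq⟩
    rw [hq]
    simp only [Polynomial.eval_mul, Polynomial.eval_pow, Polynomial.eval_X]
    have : (fun t => q.eval t) =O[𝓝 (0 : ℝ)] fun _ => (1 : ℝ) :=
      q.continuous.continuousAt.isBigO_one ℝ
    simpa using (isBigO_refl (fun t : ℝ => t ^ (i + 1)) (𝓝 0)).mul this
  constructor
  · rintro ⟨c, hc, h, hh, he⟩
    obtain ⟨h2, h3⟩ := (hpoly c).2 (by
      have h2 : (fun t => t ^ (i + 1) * h t) =O[𝓝 0] fun t : ℝ => t ^ (i + 1) := by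
        simpa using (isBigO_refl (fun t : ℝ => t ^ (i + 1)) (𝓝 0)).mul
          (hh.continuousAt.isBigO_one ℝ)
      refine (h2.sub h1).congr' ?_ EventuallyEq.rfl
      filter_upwards [he] with t ht
      rw [ht]
      ring)
    exact ⟨h2, h3 ▸ hc⟩
  · rintro ⟨h2, h3⟩
    refine ⟨_, h3, ?_⟩
    have h4 := (hpoly _).1 ⟨h2, rfl⟩
    have h5 : AnalyticAt ℝ (fun t => f (truncatedArc a t) - arcCoeff F i a * t ^ i) 0 :=
      hfa.sub (by fun_prop)
    -- An analytic function that is `O(t ^ (i + 1))` is analytically divisible by `t ^ (i + 1)`;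
    -- this supplies the required higher-order terms.
    obtain ⟨g, hg, he⟩ := h5.exists_eq_pow_mul_of_isBigO
      ((h1.add h4).congr_left fun t => by ring)
    refine ⟨g, hg, ?_⟩
    filter_upwards [he] with t ht
    linarith

end

/-! ### Euler characteristics of sets of arcs and the modified zeta coefficients -/

noncomputable section

open TopologicalSpace

/-- The coefficients of a truncated arc as a single vector. -/
def arcSpaceHomeo (n d : ℕ) : (Fin n → Fin d → ℝ) ≃ₜ (Fin (n * d) → ℝ) :=
  Homeomorph.piCurry.symm.trans (Homeomorph.piCongrLeft (Y := fun _ => ℝ) finProdFinEquiv)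

theorem arcSpaceHomeo_apply {n d : ℕ} (a : Fin n → Fin d → ℝ) (x : Fin n × Fin d) :
    arcSpaceHomeo n d a (finProdFinEquiv x) = a x.1 x.2 :=
  Equiv.piCongrLeft_apply_apply (P := fun _ => ℝ) finProdFinEquiv _ x

section Line

variable {X : Type} [TopologicalSpace X] [MetrizableSpace X] [LocallyCompactSpace X]

theorem eulerCharC_prod_pi (hX : HasEulerCharC X) (m : ℕ) :
    HasEulerCharC (X × (Fin m → ℝ)) ∧
      eulerCharC (X × (Fin m → ℝ)) = (-1) ^ m * eulerCharC X := by
  induction m with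
  | zero =>
    let e := Homeomorph.prodUnique X (Fin 0 → ℝ)
    refine ⟨hX.congr e.symm, ?_⟩
    rw [eulerCharC_congr e, pow_zero, one_mul]
  | succ m ih =>
    let e : (X × (Fin m → ℝ)) × ℝ ≃ₜ X × (Fin (m + 1) → ℝ) :=
      (Homeomorph.prodAssoc _ _ _).trans ((Homeomorph.refl X).prodCongr (consHomeo m))
    refine ⟨ih.1.prod_real.congr e, ?_⟩
    rw [← eulerCharC_congr e, eulerCharC_prod_real ih.1, ih.2]
    ring

theorem eulerCharC_prod_arcSpace (hX : HasEulerCharC X) (n d : ℕ) :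
    HasEulerCharC (X × (Fin n → Fin d → ℝ)) ∧
      eulerCharC (X × (Fin n → Fin d → ℝ)) = (-1) ^ (n * d) * eulerCharC X := by
  let e := (Homeomorph.refl X).prodCongr (arcSpaceHomeo n d)
  obtain ⟨h1, h2⟩ := eulerCharC_prod_pi hX (n * d)
  exact ⟨h1.congr e.symm, by rw [eulerCharC_congr e, h2]⟩

end Line

theorem eulerCharC_arcSpace (n d : ℕ) : HasEulerCharC (Fin n → Fin d → ℝ) ∧
    eulerCharC (Fin n → Fin d → ℝ) = (-1) ^ (n * d) := by
  let e := Homeomorph.punitProd (Fin n → Fin d → ℝ)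
  obtain ⟨h1, h2⟩ := eulerCharC_prod_arcSpace (hasEulerCharC_of_unique PUnit) n d
  exact ⟨h1.congr e, by rw [← eulerCharC_congr e, h2, eulerCharC_of_unique, mul_one]⟩

section Arcs

variable {d n : ℕ} (F : MvPolynomial (Fin d) ℝ)

/-- The truncated arcs along which the coefficients of `F` of order less than `m` vanish. -/
def arcsVanishing (F : MvPolynomial (Fin d) ℝ) (n m : ℕ) : Set (Fin n → Fin d → ℝ) :=
  {a | ∀ k < m, arcCoeff F k a = 0}

theorem isClosed_arcsVanishing (n m : ℕ) : IsClosed (arcsVanishing F n m) := by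
  simp only [arcsVanishing, Set.ofPred_forall]
  exact isClosed_iInter fun k => isClosed_iInter fun _ =>
    isClosed_eq (continuous_arcCoeff F k) continuous_const

theorem arcsVanishing_succ (n m : ℕ) :
    arcsVanishing F n (m + 1) = arcsVanishing F n m ∩ {a | arcCoeff F m a = 0} := by
  ext a
  exact Nat.forall_lt_succ_right

theorem clopenMultiplicative_arcs (m : ℕ) (q : MvPolynomial (Fin n × Fin d) ℝ) :
    ClopenMultiplicative (arcsVanishing F n m ∩
      {a | MvPolynomial.eval (fun x => a x.1 x.2) q ≠ 0} : Set (Fin n → Fin d → ℝ)) := by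
  choose p hp using exists_arcCoeff_eq_eval F n
  refine (clopenMultiplicative_algebraic (n * d)
    (∑ k ∈ Finset.range m, MvPolynomial.rename finProdFinEquiv (p k) ^ 2)
    (MvPolynomial.rename finProdFinEquiv q)).congr
      ((arcSpaceHomeo n d).sets (Set.ext fun a => ?_)).symm
  have e : arcSpaceHomeo n d a ∘ finProdFinEquiv = fun x => a x.1 x.2 :=
    funext (arcSpaceHomeo_apply a)
  simp only [Set.mem_inter_iff, arcsVanishing, Set.mem_ofPred_eq, Set.mem_preimage, map_sum,
    map_pow, MvPolynomial.eval_rename, e, ← hp]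
  rw [Finset.sum_eq_zero_iff_of_nonneg fun k _ => sq_nonneg _]
  simp

theorem eulerMultiplicative_arcsVanishing (m : ℕ) :
    EulerMultiplicative (arcsVanishing F n m) := by
  have := (clopenMultiplicative_arcs (n := n) F m 1).eulerMultiplicative
  refine this.congr (Homeomorph.setCongr ?_)
  simp

theorem clopenMultiplicative_arcs_ne (m k : ℕ) :
    ClopenMultiplicative (arcsVanishing F n m ∩ {a | arcCoeff F k a ≠ 0} : Set _) := by
  obtain ⟨q, hq⟩ := exists_arcCoeff_eq_eval F n k
  have e : {a : Fin n → Fin d → ℝ | arcCoeff F k a ≠ 0} =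
      {a | MvPolynomial.eval (fun x => a x.1 x.2) q ≠ 0} := by
    simp only [hq]
  rw [e]
  exact clopenMultiplicative_arcs F m q

/-- Positivity is a clopen condition on the locus where the coefficient is nonzero; here the control
of clopen pieces of algebraic sets is used. -/
theorem eulerMultiplicative_arcs_pos (m k : ℕ) :
    EulerMultiplicative (arcsVanishing F n m ∩ {a | 0 < arcCoeff F k a} : Set _) := by
  have hc : Continuous fun a : (arcsVanishing F n m ∩ {a | arcCoeff F k a ≠ 0} : Set _) =>
    arcCoeff F k a.1 := (continuous_arcCoeff F k).comp continuous_subtype_val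
  have h : IsClopen {a : (arcsVanishing F n m ∩ {a | arcCoeff F k a ≠ 0} : Set _) |
      0 < arcCoeff F k a.1} := by
    refine ⟨?_, isOpen_lt continuous_const hc⟩
    convert isClosed_le continuous_const hc using 1
    ext a
    exact ⟨fun h => le_of_lt (b := arcCoeff F k a.1) h,
      fun h => lt_of_le_of_ne (b := arcCoeff F k a.1) h a.2.2.symm⟩
  refine ((clopenMultiplicative_arcs_ne F m k).of_isClopen h).eulerMultiplicative.congr
    ((preimageValHomeo _ {a | 0 < arcCoeff F k a}).trans (Homeomorph.setCongr ?_))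
  ext a
  simp only [Set.mem_inter_iff, Set.mem_ofPred_eq]
  exact ⟨fun h => ⟨h.1.1, h.2⟩, fun h => ⟨⟨h.1, h.2.ne'⟩, h.2⟩⟩

/-- The truncated arcs along which the coefficients of `F` of order less than `n` vanish and the
one of order `n` is non-negative. -/
def arcsNonneg (F : MvPolynomial (Fin d) ℝ) (n : ℕ) : Set (Fin n → Fin d → ℝ) :=
  arcsVanishing F n n ∩ {a | 0 ≤ arcCoeff F n a}

theorem isClosed_arcsNonneg (n : ℕ) : IsClosed (arcsNonneg F n) :=
  (isClosed_arcsVanishing F n n).inter (isClosed_le continuous_const (continuous_arcCoeff F n))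

theorem isClosed_arcCoeff_eq_zero (n k : ℕ) :
    IsClosed {a : Fin n → Fin d → ℝ | arcCoeff F k a = 0} :=
  isClosed_eq (continuous_arcCoeff F k) continuous_const

theorem arcsNonneg_inter (n : ℕ) :
    arcsNonneg F n ∩ {a | arcCoeff F n a = 0} = arcsVanishing F n (n + 1) := by
  rw [arcsVanishing_succ]
  ext a
  simp only [arcsNonneg, Set.mem_inter_iff, Set.mem_ofPred_eq]
  exact ⟨fun h => ⟨h.1.1, h.2⟩, fun h => ⟨⟨h.1, h.2.ge⟩, h.2⟩⟩

theorem arcsNonneg_diff (n : ℕ) :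
    arcsNonneg F n \ {a | arcCoeff F n a = 0} =
      arcsVanishing F n n ∩ {a | 0 < arcCoeff F n a} := by
  ext a
  simp only [arcsNonneg, Set.mem_sdiff, Set.mem_inter_iff, Set.mem_ofPred_eq]
  exact ⟨fun h => ⟨h.1.1, lt_of_le_of_ne h.1.2 (Ne.symm h.2)⟩, fun h => ⟨⟨h.1, h.2.le⟩, h.2.ne'⟩⟩

theorem eulerMultiplicative_arcsNonneg (n : ℕ) : EulerMultiplicative (arcsNonneg F n) := by
  have := (isClosed_arcsNonneg F n).locallyCompactSpace
  refine EulerMultiplicative.of_inter_of_diff (isClosed_arcCoeff_eq_zero F n n) ?_ ?_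
  · rw [arcsNonneg_inter]
    exact eulerMultiplicative_arcsVanishing F (n + 1)
  · rw [arcsNonneg_diff]
    exact eulerMultiplicative_arcs_pos F n n

theorem eulerCharC_arcsNonneg (n : ℕ) :
    eulerCharC (arcsNonneg F n) = eulerCharC (arcsVanishing F n (n + 1)) +
      eulerCharC (arcsVanishing F n n ∩ {a | 0 < arcCoeff F n a} : Set _) := by
  have := (isClosed_arcsNonneg F n).locallyCompactSpace
  have h1 := arcsNonneg_inter F n
  have h2 := arcsNonneg_diff F n
  rw [eulerCharC_eq_inter_add_diff (isClosed_arcCoeff_eq_zero F n n), h1, h2]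
  · rw [h1]
    exact (eulerMultiplicative_arcsVanishing F (n + 1)).hasEulerCharC
  · rw [h2]
    exact (eulerMultiplicative_arcs_pos F n n).hasEulerCharC

/-- The arcs along which `F` has order exactly `i`. -/
def arcsOfOrder (F : MvPolynomial (Fin d) ℝ) (n i : ℕ) : Set (Fin n → Fin d → ℝ) :=
  arcsVanishing F n i ∩ {a | arcCoeff F i a ≠ 0}

theorem locallyCompactSpace_arcsOfOrder (n i : ℕ) : LocallyCompactSpace (arcsOfOrder F n i) :=
  IsLocallyClosed.locallyCompactSpace ((isClosed_arcsVanishing F n i).isLocallyClosed.inter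
    (isOpen_ne_fun (continuous_arcCoeff F i) continuous_const).isLocallyClosed)

theorem hasEulerCharC_arcsOfOrder (n i : ℕ) : HasEulerCharC (arcsOfOrder F n i) :=
  (clopenMultiplicative_arcs_ne F i i).eulerMultiplicative.hasEulerCharC

/-- Having order `i` depends only on the first `i` coefficient vectors. The other `m` are free and
contribute a factor `ℝ^(m d)`. -/
theorem eulerCharC_arcsOfOrder_add (i m : ℕ) :
    eulerCharC (arcsOfOrder F (i + m) i) = (-1) ^ (m * d) * eulerCharC (arcsOfOrder F i i) := by
  have := locallyCompactSpace_arcsOfOrder F i i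
  let e : arcsOfOrder F i i × (Fin m → Fin d → ℝ) ≃ₜ arcsOfOrder F (i + m) i :=
    (preimageFstHomeo (arcsOfOrder F i i) (Fin m → Fin d → ℝ)).symm.trans
      ((Fin.appendHomeomorph (X := Fin d → ℝ) i m).sets (by
        ext p
        change p.1 ∈ arcsOfOrder F i i ↔ Fin.append p.1 p.2 ∈ arcsOfOrder F (i + m) i
        simp only [arcsOfOrder, arcsVanishing, Set.mem_inter_iff, Set.mem_ofPred_eq]
        rw [arcCoeff_append F le_rfl]
        refine and_congr_left' (forall₂_congr fun k hk => ?_)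
        rw [arcCoeff_append F hk.le]))
  rw [← eulerCharC_congr e, (eulerCharC_prod_arcSpace (hasEulerCharC_arcsOfOrder F i i) m d).2]

/-- The orders 1, …, m are removed one at a time; order 0 does not occur as `F` has no constant
term. The sign from the `n - i` free vectors is `(-1)^((n-i)d) = (-1)^(nd) * (-1)^(id)`, which
matches the normalization in the zeta function. -/
theorem eulerCharC_arcsVanishing (h0 : MvPolynomial.constantCoeff F = 0) (n m : ℕ) (hm : m ≤ n) :
    eulerCharC (arcsVanishing F n (m + 1)) = (-1) ^ (n * d) *
      (1 - ∑ i ∈ Finset.Icc 1 m, (-1) ^ (i * d) * eulerCharC (arcsOfOrder F i i)) := by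
  induction m with
  | zero =>
    have : arcsVanishing F n (0 + 1) = Set.univ := by
      ext a
      simp [arcsVanishing, arcCoeff_zero h0]
    rw [this, eulerCharC_congr (Homeomorph.Set.univ _), (eulerCharC_arcSpace n d).2]
    simp
  | succ m ih =>
    have := (isClosed_arcsVanishing F n (m + 1)).locallyCompactSpace
    have h1 := eulerCharC_eq_inter_add_diff (S := arcsVanishing F n (m + 1))
      (isClosed_arcCoeff_eq_zero F n (m + 1)) (by
        rw [← arcsVanishing_succ]
        exact (eulerMultiplicative_arcsVanishing F _).hasEulerCharC)
      (hasEulerCharC_arcsOfOrder F n (m + 1))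
    rw [← arcsVanishing_succ, ih (by omega)] at h1
    obtain ⟨l, rfl⟩ := Nat.exists_eq_add_of_le hm
    have h2 : eulerCharC (arcsVanishing F (m + 1 + l) (m + 1) \ {a | arcCoeff F (m + 1) a = 0} :
        Set _) = (-1) ^ (l * d) * eulerCharC (arcsOfOrder F (m + 1) (m + 1)) :=
      eulerCharC_arcsOfOrder_add F (m + 1) l
    rw [h2] at h1
    have h3 : ((-1 : ℤ) ^ ((m + 1 + l) * d)) * (-1) ^ ((m + 1) * d) = (-1) ^ (l * d) := by
      rw [add_mul, pow_add, mul_right_comm, ← mul_pow]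
      simp
    rw [← h3] at h1
    rw [Finset.sum_Icc_succ_top (by omega)]
    linarith

end Arcs

section Zeta

variable {d n : ℕ} {f : (Fin d → ℝ) → ℝ} {F : MvPolynomial (Fin d) ℝ}

namespace ApproximatedBy

theorem arcsPos_eq (hF : ApproximatedBy f F n) (hf : AnalyticAt ℝ f 0) :
    arcsPos f n = arcsVanishing F n n ∩ {a | 0 < arcCoeff F n a} :=
  hF.arcsWithCoeff_eq hf le_rfl _

theorem arcsNonzero_eq (hF : ApproximatedBy f F n) (hf : AnalyticAt ℝ f 0) {i : ℕ} (hi : i ≤ n) :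
    arcsNonzero f i = arcsOfOrder F i i :=
  hF.arcsWithCoeff_eq hf hi _

/-- The coefficient of the modified positive zeta function as an Euler characteristic. -/
theorem coeff_modifiedZetaPos (hF : ApproximatedBy f F n) (hf : AnalyticAt ℝ f 0) (h0 : f 0 = 0)
    (hn : 1 ≤ n) : PowerSeries.coeff n (modifiedZetaPos f) =
      (-1) ^ (n * d) * eulerCharC (arcsNonneg F n) := by
  have hn' : n ≠ 0 := by omega
  -- Arcs of order above `n` account for `A_n`, those with positive coefficient at `n` for `a_n^+`.
  rw [modifiedZetaPos, PowerSeries.coeff_mk, if_neg hn', zetaPos, PowerSeries.coeff_mk, if_neg hn',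
    hF.arcsPos_eq hf, eulerCharC_arcsNonneg, mul_add,
    eulerCharC_arcsVanishing F (hF.constantCoeff h0) n n le_rfl, ← mul_assoc, ← mul_pow]
  simp only [mul_neg, mul_one, neg_neg, one_pow, one_mul, zetaPartial, zetaTotal,
    PowerSeries.coeff_mk]
  congr 2
  refine Finset.sum_congr rfl fun i hi => ?_
  rw [Finset.mem_Icc] at hi
  rw [if_neg (by omega), hF.arcsNonzero_eq hf hi.2]

end ApproximatedBy

theorem neg_mem_arcsWithCoeff {f : (Fin d → ℝ) → ℝ} (S : Set ℝ) :
    arcsWithCoeff (-f) n S = arcsWithCoeff f n {c | -c ∈ S} := by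
  have key : ∀ (f : (Fin d → ℝ) → ℝ) (S T : Set ℝ), (∀ c ∈ S, -c ∈ T) →
      arcsWithCoeff f n S ⊆ arcsWithCoeff (-f) n T := by
    rintro f S T hST a ⟨c, hc, h, hh, he⟩
    refine ⟨-c, hST c hc, -h, hh.neg, ?_⟩
    filter_upwards [he] with t ht
    simp only [Pi.neg_apply, ht]
    ring
  refine Set.Subset.antisymm ?_ (key f _ S fun c hc => hc)
  have := key (-f) S {c | -c ∈ S} fun c hc => by simpa using hc
  rwa [neg_neg] at this

theorem arcsNeg_eq (f : (Fin d → ℝ) → ℝ) (n : ℕ) : arcsNeg f n = arcsPos (-f) n := by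
  rw [arcsPos, neg_mem_arcsWithCoeff]
  simp [arcsNeg]

theorem arcsNonzero_neg (f : (Fin d → ℝ) → ℝ) (n : ℕ) : arcsNonzero (-f) n = arcsNonzero f n := by
  rw [arcsNonzero, neg_mem_arcsWithCoeff]
  simp [arcsNonzero]

/-- Changing the sign of `f` exchanges positive and negative arcs and keeps the nonzero ones. -/
theorem modifiedZetaNeg_eq (f : (Fin d → ℝ) → ℝ) : modifiedZetaNeg f = modifiedZetaPos (-f) := by
  have h1 : ∀ n, eulerCharC (arcsNeg f n) = eulerCharC (arcsPos (-f) n) := fun n => by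
    rw [arcsNeg_eq]
  have h2 : ∀ n, eulerCharC (arcsNonzero f n) = eulerCharC (arcsNonzero (-f) n) := fun n => by
    rw [arcsNonzero_neg]
  simp only [modifiedZetaNeg, modifiedZetaPos, zetaPartial, zetaTotal, zetaPos, zetaNeg, h1, h2]

theorem AnalyticAt.zetaDefined (hf : AnalyticAt ℝ f 0) : ZetaDefined f := by
  have pos : ∀ {f : (Fin d → ℝ) → ℝ} (_ : AnalyticAt ℝ f 0) n, HasEulerCharC (arcsPos f n) := by
    intro f hf n
    obtain ⟨F, hF⟩ := hf.exists_approximatedBy n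
    rw [hF.arcsPos_eq hf]
    exact (eulerMultiplicative_arcs_pos F n n).hasEulerCharC
  intro n _
  refine ⟨pos hf n, ?_, ?_⟩
  · rw [arcsNeg_eq]
    exact pos hf.neg n
  · obtain ⟨F, hF⟩ := hf.exists_approximatedBy n
    rw [hF.arcsNonzero_eq hf le_rfl]
    exact hasEulerCharC_arcsOfOrder F n n

end Zeta

end

/-! ### Strata swept out by half-lines -/

noncomputable section

open TopologicalSpace Polynomial

/-- A space swept out by half-lines has vanishing Euler characteristic with compact supports. -/
theorem eulerCharC_eq_zero_of_halfLines {E : Type} [TopologicalSpace E] [MetrizableSpace E]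
    {S S₀ : Set E} [LocallyCompactSpace S₀] {r : E → ℝ} {φ : E × ℝ → E} {ψ : E → E}
    (hr : ContinuousOn r S) (hφ : ContinuousOn φ (S₀ ×ˢ Set.univ)) (hψ : ContinuousOn ψ S)
    (hr0 : ∀ x ∈ S, 0 ≤ r x) (hψS : ∀ x ∈ S, ψ x ∈ S₀) (hφψ : ∀ x ∈ S, φ (ψ x, r x) = x)
    (hφS : ∀ y ∈ S₀, ∀ s, 0 ≤ s → φ (y, s) ∈ S ∧ r (φ (y, s)) = s ∧ ψ (φ (y, s)) = y) :
    HasEulerCharC S ∧ eulerCharC S = 0 := by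
  let e : S₀ × NNReal ≃ₜ S :=
    { toFun := fun p => ⟨φ (p.1, p.2), (hφS _ p.1.2 _ p.2.2).1⟩
      invFun := fun x => (⟨ψ x, hψS _ x.2⟩, ⟨r x, hr0 _ x.2⟩)
      left_inv := fun p => Prod.ext (Subtype.ext (hφS _ p.1.2 _ p.2.2).2.2)
        (Subtype.ext (hφS _ p.1.2 _ p.2.2).2.1)
      right_inv := fun x => Subtype.ext (hφψ _ x.2)
      continuous_toFun := by
        refine Continuous.subtype_mk ?_ _
        exact hφ.comp_continuous (f := fun p : S₀ × NNReal => ((p.1 : E), (p.2 : ℝ)))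
          (by fun_prop) fun p => ⟨p.1.2, trivial⟩
      continuous_invFun := by
        refine Continuous.prodMk (Continuous.subtype_mk ?_ _) (Continuous.subtype_mk ?_ _)
        · exact hψ.comp_continuous continuous_subtype_val fun x => x.2
        · exact hr.comp_continuous continuous_subtype_val fun x => x.2 }
  exact ⟨(hasEulerCharC_halfLine S₀).congr e, by rw [← eulerCharC_congr e, eulerCharC_halfLine]⟩

/-! ### Reparametrization of arcs -/

/-- For `p = c t^i + …`, the factor `(t + s t^(e+1))^i = t^i (1 + s i t^e + …)` produces the first
change, `s i c` at `t^(i+e)`; the change in the cofactor only enters one order later. -/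
theorem X_pow_dvd_comp_sub {i e : ℕ} (he : 1 ≤ e) (s : ℝ) {p : ℝ[X]} (hp : X ^ i ∣ p) :
    X ^ (i + e + 1) ∣ p.comp (X + C s * X ^ (e + 1)) - (p + C (s * i * p.coeff i) * X ^ (i + e)) := by
  obtain ⟨q, rfl⟩ := hp
  obtain ⟨v, hv⟩ : X ^ (e + 1) ∣ q.comp (X + C s * X ^ (e + 1)) - q := by
    have h := sub_dvd_eval_sub (X + C s * X ^ (e + 1)) X (q.map C)
    rw [eval_map, eval_map, ← comp, ← comp, comp_X, add_sub_cancel_left] at h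
    exact (Dvd.intro_left _ rfl).trans h
  obtain ⟨w, hw⟩ : X ∣ q - C (q.coeff 0) := X_dvd_iff.2 (by simp)
  obtain ⟨k, hk⟩ := powAddExpansion (1 : ℝ[X]) (C s * X ^ e) i
  have h1 : (X + C s * X ^ (e + 1)) ^ i = X ^ i * (1 + C s * X ^ e) ^ i := by
    rw [← mul_pow]
    ring
  have h2 : (X ^ i * q).coeff i = q.coeff 0 := by simp [coeff_X_pow_mul']
  obtain ⟨l, rfl⟩ := Nat.exists_eq_add_of_le he
  rw [h2, mul_comp, X_pow_comp, h1, hk, sub_eq_iff_eq_add.1 hv]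
  simp only [map_mul, map_natCast, one_pow, mul_one]
  rw [sub_eq_iff_eq_add] at hw
  -- The quotient collects the change `v` of the cofactor, its non-constant part `w`, and the
  -- quadratic remainder `k` of the binomial expansion.
  refine ⟨v * (1 + (i : ℝ[X]) * (C s * X ^ (1 + l)) + k * (C s * X ^ (1 + l)) ^ 2) + (i : ℝ[X]) * C s * w +
    k * C s ^ 2 * X ^ l * q, ?_⟩
  have h3 : (i : ℝ[X]) * C s * X ^ (1 + l) * q =
    (i : ℝ[X]) * C s * X ^ (1 + l) * (X * w + C (q.coeff 0)) := by rw [← hw]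
  linear_combination X ^ i * h3

/-- The matrix of the reparametrization `t ↦ t + s t^{e+1}` on truncated arcs. -/
def reparamMatrix (n e : ℕ) (s : ℝ) : Matrix (Fin n) (Fin n) ℝ :=
  Matrix.of fun k j => ((X + C s * X ^ (e + 1) : ℝ[X]) ^ ((j : ℕ) + 1)).coeff ((k : ℕ) + 1)

theorem reparam_pow (e : ℕ) (s : ℝ) (j : ℕ) :
    (X + C s * X ^ (e + 1) : ℝ[X]) ^ j = X ^ j * (1 + C s * X ^ e) ^ j := by
  rw [← mul_pow]
  ring

/-- The `j`-th power of `t + s t^(e+1)` begins with `t^j`, so the matrix is triangular with unit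
diagonal. Its adjugate is therefore its inverse, and depends continuously on `s`. -/
theorem det_reparamMatrix (n : ℕ) {e : ℕ} (he : 1 ≤ e) (s : ℝ) :
    (reparamMatrix n e s).det = 1 := by
  rw [Matrix.det_of_isLowerTriangular]
  · refine Finset.prod_eq_one fun k _ => ?_
    rw [reparamMatrix, Matrix.of_apply, reparam_pow, coeff_X_pow_mul', if_pos le_rfl, Nat.sub_self,
      coeff_zero_eq_eval_zero]
    simp [show e ≠ 0 by omega]
  · intro k j hkj
    rw [reparamMatrix, Matrix.of_apply, reparam_pow, coeff_X_pow_mul', if_neg]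
    have : (k : ℕ) < j := hkj
    omega

theorem continuous_reparamMatrix (n e : ℕ) : Continuous (reparamMatrix n e) := by
  have h : ∀ j k, Continuous fun s : ℝ => ((X + C s * X ^ (e + 1) : ℝ[X]) ^ j).coeff k := by
    intro j
    induction j with
    | zero => intro k; simpa using continuous_const
    | succ j ih =>
      intro k
      simp only [pow_succ _ j, coeff_mul]
      refine continuous_finsetSum _ fun x _ => (ih _).mul ?_
      simp only [coeff_add, coeff_C_mul]
      fun_prop
  exact continuous_matrix fun k j => h (j + 1) (k + 1)

/-- The reparametrization of a truncated arc by `t ↦ t + s t^{e+1}`. -/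
def reparam {n d : ℕ} (e : ℕ) (s : ℝ) (a : Fin n → Fin d → ℝ) : Fin n → Fin d → ℝ :=
  reparamMatrix n e s * (Matrix.of a)

/-- The inverse of the reparametrization of truncated arcs. -/
def reparamInv {n d : ℕ} (e : ℕ) (s : ℝ) (a : Fin n → Fin d → ℝ) : Fin n → Fin d → ℝ :=
  (reparamMatrix n e s).adjugate * (Matrix.of a)

section Reparam

variable {n d e : ℕ}

theorem reparam_reparamInv (he : 1 ≤ e) (s : ℝ) (a : Fin n → Fin d → ℝ) :
    reparam e s (reparamInv e s a) = a := by
  change reparamMatrix n e s * ((reparamMatrix n e s).adjugate * Matrix.of a) = Matrix.of a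
  rw [← Matrix.mul_assoc, Matrix.mul_adjugate, det_reparamMatrix n he, one_smul, Matrix.one_mul]

theorem reparamInv_reparam (he : 1 ≤ e) (s : ℝ) (a : Fin n → Fin d → ℝ) :
    reparamInv e s (reparam e s a) = a := by
  change (reparamMatrix n e s).adjugate * (reparamMatrix n e s * Matrix.of a) = Matrix.of a
  rw [← Matrix.mul_assoc, Matrix.adjugate_mul, det_reparamMatrix n he, one_smul, Matrix.one_mul]

theorem continuous_reparam (e : ℕ) :
    Continuous fun p : ℝ × (Fin n → Fin d → ℝ) => reparam e p.1 p.2 :=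
  Continuous.matrix_mul ((continuous_reparamMatrix n e).comp continuous_fst) continuous_snd

theorem continuous_reparamInv (e : ℕ) :
    Continuous fun p : ℝ × (Fin n → Fin d → ℝ) => reparamInv e p.1 p.2 :=
  Continuous.matrix_mul ((continuous_reparamMatrix n e).matrix_adjugate.comp continuous_fst)
    continuous_snd

theorem coeff_arcPolynomial_reparam (s : ℝ) (a : Fin n → Fin d → ℝ) (i : Fin d) {k : ℕ}
    (hk : k ≤ n) : (arcPolynomial (reparam e s a) i).coeff k =
      ((arcPolynomial a i).comp (X + C s * X ^ (e + 1))).coeff k := by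
  have h : (arcPolynomial a i).comp (X + C s * X ^ (e + 1)) =
      ∑ j : Fin n, C (a j i) * (X + C s * X ^ (e + 1)) ^ ((j : ℕ) + 1) := by
    rw [arcPolynomial, comp_eq_aeval, map_sum]
    simp
  rw [h, finsetSum_coeff]
  cases k with
  | zero =>
    rw [coeff_arcPolynomial_zero]
    refine (Finset.sum_eq_zero fun j _ => ?_).symm
    rw [reparam_pow, coeff_C_mul, coeff_X_pow_mul', if_neg (by omega), mul_zero]
  | succ k =>
    rw [coeff_arcPolynomial_succ, dif_pos (by omega), reparam, Matrix.mul_apply]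
    refine Finset.sum_congr rfl fun j _ => ?_
    rw [coeff_C_mul, mul_comm]
    rfl

/-- Evaluating `F` commutes with reparametrizing the arc, so `X_pow_dvd_comp_sub` applies to `F`
along the arc. The bound `k ≤ n` is there because the reparametrized arc is truncated. -/
theorem arcCoeff_reparam (he : 1 ≤ e) {F : MvPolynomial (Fin d) ℝ} {a : Fin n → Fin d → ℝ} {i : ℕ}
    (ha : a ∈ arcsVanishing F n i) (s : ℝ) {k : ℕ} (hk : k ≤ n) (hki : k ≤ i + e) :
    arcCoeff F k (reparam e s a) =
      arcCoeff F k a + if k = i + e then s * i * arcCoeff F i a else 0 := by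
  let φ : ℝ[X] →ₐ[ℝ] ℝ[X] := aeval (X + C s * X ^ (e + 1))
  have h1 := MvPolynomial.comp_aeval_apply (arcPolynomial a) φ F
  have h2 : X ^ i ∣ MvPolynomial.aeval (arcPolynomial a) F := X_pow_dvd_iff.2 ha
  have h3 := X_pow_dvd_sub_iff.1 (X_pow_dvd_comp_sub he s h2) k (by omega)
  rw [arcCoeff, coeff_aeval_congr (fun j l hl => coeff_arcPolynomial_reparam s a j hl) F hk]
  rw [comp_eq_aeval] at h3
  refine (congrArg (fun p => coeff p k) h1.symm).trans (h3.trans ?_)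
  rw [coeff_add, coeff_C_mul_X_pow]
  rfl

/-- By induction on the order, as `arcCoeff_reparam` presupposes that lower coefficients of `a`
vanish. Since `e ≥ 1`, the first possibly nonzero coefficient is unaffected by the
reparametrization. -/
theorem mem_arcsVanishing_of_reparam (he : 1 ≤ e) {F : MvPolynomial (Fin d) ℝ}
    {a : Fin n → Fin d → ℝ} {s : ℝ} {i : ℕ} (hi : i ≤ n + 1)
    (ha : reparam e s a ∈ arcsVanishing F n i) : a ∈ arcsVanishing F n i := by
  induction i with
  | zero => exact fun k hk => absurd hk (Nat.not_lt_zero k)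
  | succ i ih =>
    have h1 := ih (by omega) fun k hk => ha k (by omega)
    have h2 := arcCoeff_reparam he h1 s (k := i) (by omega) (by omega)
    rw [ha i (by omega), if_neg (by omega), add_zero] at h2
    rw [arcsVanishing_succ]
    exact ⟨h1, h2.symm⟩

end Reparam

attribute [local irreducible] reparam reparamInv arcCoeff

section Product

variable {d₁ d₂ : ℕ} (F : MvPolynomial (Fin d₁) ℝ) (G : MvPolynomial (Fin d₂) ℝ) (n : ℕ)

/-- The pairs of arcs along which the coefficients of `F(x) + G(y)` of order less than `n` vanish
and the one of order `n` is non-negative. -/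
def arcPairs : Set ((Fin n → Fin d₁ → ℝ) × (Fin n → Fin d₂ → ℝ)) :=
  {p | (∀ k < n, arcCoeff F k p.1 + arcCoeff G k p.2 = 0) ∧
    0 ≤ arcCoeff F n p.1 + arcCoeff G n p.2}

theorem continuous_arcCoeff_fst (k : ℕ) : Continuous fun p :
    (Fin n → Fin d₁ → ℝ) × (Fin n → Fin d₂ → ℝ) => arcCoeff F k p.1 :=
  (continuous_arcCoeff F k).comp continuous_fst

theorem continuous_arcCoeff_snd (k : ℕ) : Continuous fun p :
    (Fin n → Fin d₁ → ℝ) × (Fin n → Fin d₂ → ℝ) => arcCoeff G k p.2 :=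
  (continuous_arcCoeff G k).comp continuous_snd

theorem isClosed_arcPairs : IsClosed (arcPairs F G n) := by
  have h := fun k => (continuous_arcCoeff_fst (d₂ := d₂) F n k).add
    (continuous_arcCoeff_snd (d₁ := d₁) G n k)
  have e : arcPairs F G n = (⋂ k, ⋂ _ : k < n, {p | arcCoeff F k p.1 + arcCoeff G k p.2 = 0}) ∩
      {p | 0 ≤ arcCoeff F n p.1 + arcCoeff G n p.2} := by
    ext p
    simp [arcPairs]
  rw [e]
  refine IsClosed.inter ?_ (isClosed_le continuous_const (h n))
  exact isClosed_iInter fun k => isClosed_iInter fun _ => isClosed_eq (h k) continuous_const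

/-- Splitting arcs in a product. -/
def arcPairHomeo (d₁ d₂ n : ℕ) : (Fin n → Fin (d₁ + d₂) → ℝ) ≃ₜ
    (Fin n → Fin d₁ → ℝ) × (Fin n → Fin d₂ → ℝ) where
  toFun c := (fun j i => c j (Fin.castAdd d₂ i), fun j i => c j (Fin.natAdd d₁ i))
  invFun p := fun j => Fin.append (p.1 j) (p.2 j)
  left_inv c := funext fun j => Fin.append_castAdd_natAdd
  right_inv p := by
    refine Prod.ext ?_ ?_ <;> funext j i
    · exact Fin.append_left _ _ _
    · exact Fin.append_right _ _ _
  continuous_toFun := by fun_prop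
  continuous_invFun := continuous_pi fun j =>
    (Fin.appendHomeomorph (X := ℝ) d₁ d₂).continuous.comp
      (f := fun p : (Fin n → Fin d₁ → ℝ) × (Fin n → Fin d₂ → ℝ) => (p.1 j, p.2 j)) (by fun_prop)

/-- Arcs along which `F(x) + G(y)` is non-negative are pairs of arcs. -/
def arcsNonnegJoinHomeo : arcsNonneg (F.joinSum G) n ≃ₜ arcPairs F G n :=
  (arcPairHomeo d₁ d₂ n).sets (by
    ext c
    simp only [arcsNonneg, arcsVanishing, arcPairs, arcCoeff_joinSum]
    rfl)

/-- The pairs of arcs whose first component has order `i < n` do not contribute. -/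
theorem eulerCharC_arcPairs_order {i : ℕ} (hF : MvPolynomial.constantCoeff F = 0) (hi : i < n) :
    HasEulerCharC (arcPairs F G n ∩ {p | p.1 ∈ arcsOfOrder F n i} : Set _) ∧
      eulerCharC (arcPairs F G n ∩ {p | p.1 ∈ arcsOfOrder F n i} : Set _) = 0 := by
  rcases Nat.eq_zero_or_pos i with rfl | hi0
  · have : IsEmpty (arcPairs F G n ∩ {p | p.1 ∈ arcsOfOrder F n 0} : Set _) :=
      ⟨fun p => p.2.2.2 (arcCoeff_zero hF _)⟩
    exact ⟨hasEulerCharC_of_isEmpty _, eulerCharC_of_isEmpty _⟩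
  -- With `e = n - i` the coefficient at `n` is the first one to be moved.
  obtain ⟨e, hn⟩ := Nat.exists_eq_add_of_le hi.le
  have he : 1 ≤ e := by omega
  have cF := fun k => continuous_arcCoeff_fst (d₂ := d₂) F n k
  have cG := fun k => continuous_arcCoeff_snd (d₁ := d₁) G n k
  have hi' : (i : ℝ) ≠ 0 := Nat.cast_ne_zero.2 hi0.ne'
  -- `r` is the coordinate along the half-lines and `u` its speed in the parameter `s`. As `u` is
  -- constant along an orbit, the parameter value `r / u` normalizes the speed to 1, and `r = 0` is
  -- the base.
  let r : (Fin n → Fin d₁ → ℝ) × (Fin n → Fin d₂ → ℝ) → ℝ :=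
    fun p => arcCoeff F n p.1 + arcCoeff G n p.2
  let u : (Fin n → Fin d₁ → ℝ) × (Fin n → Fin d₂ → ℝ) → ℝ := fun p => i * arcCoeff F i p.1
  have cr : Continuous r := (cF n).add (cG n)
  have cu : Continuous u := continuous_const.mul (cF i)
  let S := arcPairs F G n ∩ {p | p.1 ∈ arcsOfOrder F n i}
  have hu : ∀ p ∈ S, u p ≠ 0 := fun p hp => mul_ne_zero hi' hp.2.2
  let S₀ := S ∩ {p | r p = 0}
  have : LocallyCompactSpace S₀ := by
    refine IsLocallyClosed.locallyCompactSpace (IsLocallyClosed.inter (IsLocallyClosed.inter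
      (isClosed_arcPairs F G n).isLocallyClosed (IsLocallyClosed.preimage
      (IsLocallyClosed.inter (isClosed_arcsVanishing F n i).isLocallyClosed (isOpen_ne_fun
        (continuous_arcCoeff F i) continuous_const).isLocallyClosed) continuous_fst))
      (isClosed_eq cr continuous_const).isLocallyClosed)
  have key : ∀ (a : Fin n → Fin d₁ → ℝ) (s : ℝ), a ∈ arcsVanishing F n i →
      (∀ k < n, arcCoeff F k (reparam e s a) = arcCoeff F k a) ∧
      arcCoeff F n (reparam e s a) = arcCoeff F n a + s * i * arcCoeff F i a := by
    intro a s ha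
    refine ⟨fun k hk => ?_, ?_⟩
    · rw [arcCoeff_reparam he ha s hk.le (hk.le.trans hn.le), if_neg (hn ▸ hk.ne), add_zero]
    · rw [arcCoeff_reparam he ha s le_rfl hn.le, if_pos hn]
  have c1 : ContinuousOn (fun q : ((Fin n → Fin d₁ → ℝ) × (Fin n → Fin d₂ → ℝ)) × ℝ =>
      (reparam e (q.2 / u q.1) q.1.1, q.1.2)) (S₀ ×ˢ Set.univ) := by
    have h1 : ContinuousOn (fun q : ((Fin n → Fin d₁ → ℝ) × (Fin n → Fin d₂ → ℝ)) × ℝ =>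
        q.2 / u q.1) (S₀ ×ˢ Set.univ) :=
      continuous_snd.continuousOn.div (cu.comp continuous_fst).continuousOn
        fun q hq => hu _ hq.1.1
    have h2 := h1.prodMk (g := fun q => q.1.1)
      (continuous_fst.comp continuous_fst).continuousOn
    have h3 := (continuous_reparam (n := n) (d := d₁) e).comp_continuousOn h2
    exact h3.prodMk (continuous_snd.comp continuous_fst).continuousOn
  have c2 : ContinuousOn (fun p : (Fin n → Fin d₁ → ℝ) × (Fin n → Fin d₂ → ℝ) =>
      (reparamInv e (r p / u p) p.1, p.2)) S := by
    have h1 : ContinuousOn (fun p => r p / u p) S := cr.continuousOn.div cu.continuousOn hu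
    have h2 := h1.prodMk continuous_fst.continuousOn
    have h3 := (continuous_reparamInv (n := n) (d := d₁) e).comp_continuousOn h2
    exact h3.prodMk continuous_snd.continuousOn
  refine eulerCharC_eq_zero_of_halfLines (S := S) (S₀ := S₀) (r := r)
    (φ := fun q => (reparam e (q.2 / u q.1) q.1.1, q.1.2))
    (ψ := fun p => (reparamInv e (r p / u p) p.1, p.2)) cr.continuousOn ?_ ?_ ?_ ?_ ?_ ?_
  · exact c1
  · exact c2
  · exact fun p hp => hp.1.2
  · rintro ⟨a, b⟩ hp
    have hu' := hu _ hp
    obtain ⟨⟨h1, h2⟩, h3, h4⟩ := hp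
    dsimp only at h1 h2 h3 h4 ⊢
    -- `a` is rewritten as the reparametrization of its base point `a'`. The coefficient at `i`
    -- agrees on both, so passing to `a'` lowers `r` by `s * u`, that is, to 0.
    obtain ⟨a', s, hs, rfl, ha'⟩ : ∃ a' s, s = r (a, b) / u (a, b) ∧ a = reparam e s a' ∧
        reparamInv e (r (a, b) / u (a, b)) a = a' :=
      ⟨_, _, rfl, (reparam_reparamInv he _ a).symm, rfl⟩
    rw [ha']
    have h5 := mem_arcsVanishing_of_reparam he (by omega) h3
    obtain ⟨h6, h7⟩ := key a' s h5
    have h8 : r (reparam e s a', b) = s * u (reparam e s a', b) :=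
      ((eq_div_iff hu').1 hs).symm
    simp only [r, u, h6 i hi] at h8
    rw [h7] at h8
    have h9 : r (a', b) = 0 := by
      simp only [r]
      linarith
    refine ⟨⟨⟨fun k hk => ?_, h9.ge⟩, h5, ?_⟩, h9⟩
    · rw [← h6 k hk]
      exact h1 k hk
    · change arcCoeff F i a' ≠ 0
      rw [← h6 i hi]
      exact h4
  · rintro ⟨a, b⟩ hp
    refine Prod.ext ?_ rfl
    have h1 := reparam_reparamInv he (r (a, b) / u (a, b)) a
    have h2 := mem_arcsVanishing_of_reparam (a := reparamInv e (r (a, b) / u (a, b)) a) he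
      (s := r (a, b) / u (a, b)) (i := i) (by omega) (by rw [h1]; exact hp.2.1)
    have h3 := (key _ (r (a, b) / u (a, b)) h2).1 i hi
    rw [h1] at h3
    have h4 : u (reparamInv e (r (a, b) / u (a, b)) a, b) = u (a, b) := by
      simp only [u]
      rw [← h3]
    dsimp only
    rw [h4, h1]
  · rintro ⟨a, b⟩ ⟨hp, hr⟩ s hs
    have hu' := hu _ hp
    obtain ⟨⟨h1, h2⟩, h3, h4⟩ := hp
    dsimp only at h1 h2 h3 h4 ⊢
    obtain ⟨h6, h7⟩ := key a (s / u (a, b)) h3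
    have h8 : r (reparam e (s / u (a, b)) a, b) = s := by
      have h9 : s / u (a, b) * i * arcCoeff F i a = s := by
        rw [mul_assoc]
        exact div_mul_cancel₀ s hu'
      have hr : arcCoeff F n a + arcCoeff G n b = 0 := hr
      simp only [r, h7, h9]
      linarith
    have h10 : u (reparam e (s / u (a, b)) a, b) = u (a, b) := by
      simp only [u, h6 i hi]
    refine ⟨⟨⟨fun k hk => ?_, h8.ge.trans' hs⟩, fun k hk => ?_, ?_⟩, h8, ?_⟩
    · rw [h6 k hk]
      exact h1 k hk
    · rw [h6 k (hk.trans hi)]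
      exact h3 k hk
    · change arcCoeff F i _ ≠ 0
      rw [h6 i hi]
      exact h4
    · rw [h8, h10, reparamInv_reparam he]

/-- The pairs of arcs along which `F` and `G` have order `n`, with leading coefficients of opposite
signs and non-negative sum. -/
def arcPairsOpposite : Set ((Fin n → Fin d₁ → ℝ) × (Fin n → Fin d₂ → ℝ)) :=
  {p | p.1 ∈ arcsVanishing F n n ∧ p.2 ∈ arcsVanishing G n n ∧
    arcCoeff G n p.2 < 0 ∧ 0 ≤ arcCoeff F n p.1 + arcCoeff G n p.2}

/-- The pairs of arcs on which the leading coefficients have opposite signs do not contribute. -/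
theorem eulerCharC_arcPairsOpposite (hn : n ≠ 0) :
    HasEulerCharC (arcPairsOpposite F G n) ∧ eulerCharC (arcPairsOpposite F G n) = 0 := by
  set S := arcPairsOpposite F G n with hS
  have cF := fun k => continuous_arcCoeff_fst (d₂ := d₂) F n k
  have cG := fun k => continuous_arcCoeff_snd (d₁ := d₁) G n k
  have hn' : (n : ℝ) ≠ 0 := Nat.cast_ne_zero.2 hn
  let S₀ := S ∩ {p | arcCoeff F n p.1 + arcCoeff G n p.2 = 0}
  have : LocallyCompactSpace S₀ := by
    refine IsLocallyClosed.locallyCompactSpace (IsLocallyClosed.inter (IsLocallyClosed.inter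
      ((isClosed_arcsVanishing F n n).preimage continuous_fst).isLocallyClosed
      (IsLocallyClosed.inter
        ((isClosed_arcsVanishing G n n).preimage continuous_snd).isLocallyClosed
        (IsLocallyClosed.inter (isOpen_lt (cG n) continuous_const).isLocallyClosed
          (isClosed_le continuous_const ((cF n).add (cG n))).isLocallyClosed)))
      (isClosed_eq ((cF n).add (cG n)) continuous_const).isLocallyClosed)
  -- The ratio of the two opposite coefficients: it equals 1 on the base `S₀` and is at least 1 on
  -- `S`.
  let v : (Fin n → Fin d₁ → ℝ) × (Fin n → Fin d₂ → ℝ) → ℝ :=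
    fun p => arcCoeff F n p.1 / (-arcCoeff G n p.2)
  have hv : ∀ p ∈ S, 1 ≤ v p := by
    rintro p ⟨-, -, h1, h2⟩
    rw [one_le_div (by linarith)]
    linarith
  have cv : ContinuousOn v S :=
    (cF n).continuousOn.div (cG n).neg.continuousOn fun p hp => (neg_pos.2 hp.2.2.1).ne'
  -- Rescaling `t ↦ c t` multiplies the coefficient at order `n` by `c ^ n`; with `c = exp s` the
  -- half-line coordinate is thus `log v / n`, which needs `n ≠ 0`.
  let r : (Fin n → Fin d₁ → ℝ) × (Fin n → Fin d₂ → ℝ) → ℝ := fun p => Real.log (v p) / n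
  have hr : ∀ p ∈ S, Real.exp (r p) ^ n = v p := by
    intro p hp
    rw [← Real.exp_nat_mul, mul_div_cancel₀ _ hn', Real.exp_log (by linarith [hv p hp])]
  have cr : ContinuousOn r S :=
    (cv.log fun p hp => (zero_lt_one.trans_le (hv p hp)).ne').div_const _
  let m : ℝ → (Fin n → Fin d₁ → ℝ) → Fin n → Fin d₁ → ℝ :=
    fun c a j i => c ^ ((j : ℕ) + 1) * a j i
  have cm : Continuous fun p : ℝ × (Fin n → Fin d₁ → ℝ) => m p.1 p.2 := by
    refine continuous_pi fun j => continuous_pi fun i => ?_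
    fun_prop
  have mm : ∀ c c' a, m c (m c' a) = m (c * c') a := by
    intro c c' a
    funext j i
    simp only [m, mul_pow]
    ring
  have m1 : ∀ a, m 1 a = a := by
    intro a
    funext j i
    simp [m]
  have hm : ∀ k c a, arcCoeff F k (m c a) = c ^ k * arcCoeff F k a := fun k c a =>
    arcCoeff_smul F k c a
  refine eulerCharC_eq_zero_of_halfLines (S := S) (S₀ := S₀) (r := r)
    (φ := fun q => (m (Real.exp q.2) q.1.1, q.1.2))
    (ψ := fun p => (m (Real.exp (-r p)) p.1, p.2)) cr ?_ ?_ ?_ ?_ ?_ ?_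
  · refine Continuous.continuousOn (Continuous.prodMk (cm.comp (Continuous.prodMk
      (Real.continuous_exp.comp continuous_snd) (by fun_prop))) (by fun_prop))
  · exact ContinuousOn.prodMk (cm.comp_continuousOn
      (ContinuousOn.prodMk (Real.continuous_exp.comp_continuousOn cr.neg) (by fun_prop)))
      (by fun_prop)
  · exact fun p hp => div_nonneg (Real.log_nonneg (hv p hp)) (Nat.cast_nonneg n)
  · rintro ⟨a, b⟩ hp
    have h1 := hr _ hp
    have h2 := hv _ hp
    obtain ⟨h3, h4, h5, h6⟩ := hp
    dsimp only at h3 h4 h5 h6 ⊢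
    have h7 : arcCoeff F n (m (Real.exp (-r (a, b))) a) + arcCoeff G n b = 0 := by
      rw [hm, Real.exp_neg, inv_pow, h1]
      have h8 : arcCoeff F n a = v (a, b) * (-arcCoeff G n b) :=
        (div_mul_cancel₀ _ (neg_pos.2 h5).ne').symm
      rw [h8, inv_mul_cancel_left₀ (zero_lt_one.trans_le h2).ne']
      ring
    refine ⟨⟨fun k hk => ?_, h4, h5, h7.ge⟩, h7⟩
    rw [hm, h3 k hk, mul_zero]
  · rintro ⟨a, b⟩ hp
    dsimp only
    rw [mm, ← Real.exp_add, add_neg_cancel, Real.exp_zero, m1]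
  · rintro ⟨a, b⟩ ⟨⟨h3, h4, h5, h6⟩, h7⟩ s hs
    have h7 : arcCoeff F n a + arcCoeff G n b = 0 := h7
    dsimp only at h3 h4 h5 h6 ⊢
    have h8 : v (m (Real.exp s) a, b) = Real.exp s ^ n := by
      simp only [v, hm]
      rw [mul_div_assoc, eq_neg_of_add_eq_zero_left h7, div_self (neg_pos.2 h5).ne', mul_one]
    have h9 : r (m (Real.exp s) a, b) = s := by
      simp only [r, h8, Real.log_pow, Real.log_exp]
      rw [mul_div_cancel_left₀ _ hn']
    refine ⟨⟨fun k hk => ?_, h4, h5, ?_⟩, h9, ?_⟩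
    · rw [hm, h3 k hk, mul_zero]
    · dsimp only
      rw [hm, eq_neg_of_add_eq_zero_left h7]
      have h10 : 1 ≤ Real.exp s ^ n := one_le_pow₀ (Real.one_le_exp hs)
      nlinarith
    · rw [h9, mm, ← Real.exp_add, neg_add_cancel, Real.exp_zero, m1]

end Product

end

/-! ### Assembling the product formula -/

noncomputable section

open TopologicalSpace

theorem eulerCharC_eq_inter_of_diff_eq_zero {E : Type} [TopologicalSpace E] [MetrizableSpace E]
    [LocallyCompactSpace E] {S C : Set E} (hS : IsClosed S) (hC : IsClosed C) {c : ℤ}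
    (h1 : HasEulerCharC (S ∩ C : Set E) ∧ eulerCharC (S ∩ C : Set E) = c)
    (h2 : HasEulerCharC (S \ C : Set E) ∧ eulerCharC (S \ C : Set E) = 0) :
    HasEulerCharC S ∧ eulerCharC S = c := by
  have := hS.locallyCompactSpace
  refine ⟨HasEulerCharC.of_inter_of_diff hC h1.1 h2.1, ?_⟩
  rw [eulerCharC_eq_inter_add_diff hC h1.1 h2.1, h1.2, h2.2, add_zero]

variable {d₁ d₂ : ℕ} (F : MvPolynomial (Fin d₁) ℝ) (G : MvPolynomial (Fin d₂) ℝ) {n : ℕ}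

theorem isClosed_fst_mem_arcsVanishing (j : ℕ) :
    IsClosed {p : (Fin n → Fin d₁ → ℝ) × (Fin n → Fin d₂ → ℝ) | p.1 ∈ arcsVanishing F n j} :=
  (isClosed_arcsVanishing F n j).preimage continuous_fst

/-- Once the coefficients of `F` below `n` vanish, so do those of `G`, and only the two coefficients
at `n` with non-negative sum matter. Both being non-negative gives the product; otherwise exactly
one is negative, and those two regions contribute 0. -/
theorem eulerCharC_arcPairs_vanishing (hn : n ≠ 0) :
    HasEulerCharC (arcPairs F G n ∩ {p | p.1 ∈ arcsVanishing F n n} : Set _) ∧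
      eulerCharC (arcPairs F G n ∩ {p | p.1 ∈ arcsVanishing F n n} : Set _) =
        eulerCharC (arcsNonneg F n) * eulerCharC (arcsNonneg G n) := by
  have hC1 : IsClosed {p : (Fin n → Fin d₁ → ℝ) × (Fin n → Fin d₂ → ℝ) | 0 ≤ arcCoeff F n p.1} :=
    isClosed_le continuous_const (continuous_arcCoeff_fst F n n)
  have hC2 : IsClosed {p : (Fin n → Fin d₁ → ℝ) × (Fin n → Fin d₂ → ℝ) | 0 ≤ arcCoeff G n p.2} :=
    isClosed_le continuous_const (continuous_arcCoeff_snd G n n)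
  have hT := (isClosed_arcPairs F G n).inter (isClosed_fst_mem_arcsVanishing (d₂ := d₂) F (n := n) n)
  have hmem : ∀ p : (Fin n → Fin d₁ → ℝ) × (Fin n → Fin d₂ → ℝ),
      p ∈ arcPairs F G n ∩ {p | p.1 ∈ arcsVanishing F n n} ↔ p.1 ∈ arcsVanishing F n n ∧
        p.2 ∈ arcsVanishing G n n ∧ 0 ≤ arcCoeff F n p.1 + arcCoeff G n p.2 := by
    intro p
    constructor
    · rintro ⟨⟨h1, h2⟩, h3⟩
      refine ⟨h3, fun k hk => ?_, h2⟩
      have := h1 k hk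
      rwa [h3 k hk, zero_add] at this
    · rintro ⟨h1, h2, h3⟩
      exact ⟨⟨fun k hk => by rw [h1 k hk, h2 k hk, add_zero], h3⟩, h1⟩
  refine eulerCharC_eq_inter_of_diff_eq_zero hT hC1
    (eulerCharC_eq_inter_of_diff_eq_zero (hT.inter hC1) hC2 ?_ ?_) ?_
  · have := (isClosed_arcsNonneg G n).locallyCompactSpace
    have h1 := eulerMultiplicative_arcsNonneg F n _
      (eulerMultiplicative_arcsNonneg G n).hasEulerCharC
    let e : arcsNonneg F n × arcsNonneg G n ≃ₜ
        (arcPairs F G n ∩ {p | p.1 ∈ arcsVanishing F n n} ∩ {p | 0 ≤ arcCoeff F n p.1} ∩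
          {p | 0 ≤ arcCoeff G n p.2} : Set _) :=
      (Homeomorph.Set.prod _ _).symm.trans (Homeomorph.setCongr (by
        ext p
        rw [Set.mem_inter_iff, Set.mem_inter_iff, hmem]
        constructor
        · rintro ⟨⟨h1, h2⟩, h3, h4⟩
          exact ⟨⟨⟨h1, h3, add_nonneg h2 h4⟩, h2⟩, h4⟩
        · rintro ⟨⟨⟨h1, h3, -⟩, h2⟩, h4⟩
          exact ⟨⟨h1, h2⟩, h3, h4⟩))
    exact ⟨h1.1.congr e, by rw [← eulerCharC_congr e, h1.2]⟩
  · have e : (arcPairs F G n ∩ {p | p.1 ∈ arcsVanishing F n n} ∩ {p | 0 ≤ arcCoeff F n p.1}) \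
        {p | 0 ≤ arcCoeff G n p.2} = arcPairsOpposite F G n := by
      ext p
      rw [Set.mem_sdiff, Set.mem_inter_iff, hmem]
      constructor
      · rintro ⟨⟨⟨h1, h2, h3⟩, -⟩, h4⟩
        exact ⟨h1, h2, not_le.1 h4, h3⟩
      · rintro ⟨h1, h2, h3, h4⟩
        exact ⟨⟨⟨h1, h2, h4⟩, by change 0 ≤ arcCoeff F n p.1; linarith⟩, not_le.2 h3⟩
    rw [e]
    exact eulerCharC_arcPairsOpposite F G n hn
  -- The region where the coefficient of `F` is negative, with the roles of `F` and `G` exchanged.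
  · let e : arcPairsOpposite G F n ≃ₜ
        ((arcPairs F G n ∩ {p | p.1 ∈ arcsVanishing F n n}) \ {p | 0 ≤ arcCoeff F n p.1} : Set _) :=
      (Homeomorph.prodComm _ _).sets (by
        ext p
        rw [Set.mem_preimage, Set.mem_sdiff, hmem]
        constructor
        · rintro ⟨h1, h2, h3, h4⟩
          exact ⟨⟨h2, h1, (add_comm _ _).le.trans' h4⟩, not_le.2 h3⟩
        · rintro ⟨⟨h1, h2, h3⟩, h4⟩
          exact ⟨h2, h1, not_le.1 h4, (add_comm _ _).le.trans' h3⟩)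
    obtain ⟨h1, h2⟩ := eulerCharC_arcPairsOpposite G F n hn
    exact ⟨h1.congr e, by rw [← eulerCharC_congr e, h2]⟩

/-- The Euler characteristic of the pairs of arcs along which `F(x) + G(y)` is non-negative is a
product. -/
theorem eulerCharC_arcPairs (hF : MvPolynomial.constantCoeff F = 0) (hn : n ≠ 0) :
    eulerCharC (arcPairs F G n) = eulerCharC (arcsNonneg F n) * eulerCharC (arcsNonneg G n) := by
  -- Descending induction on the order required of `F`: at `m = 0` it is `n`, and at `m = n` no
  -- condition is left. Each step adds the stratum of one exact order below `n`, which contributes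
  -- 0.
  have key : ∀ m ≤ n, HasEulerCharC (arcPairs F G n ∩ {p | p.1 ∈ arcsVanishing F n (n - m)} : Set _) ∧
      eulerCharC (arcPairs F G n ∩ {p | p.1 ∈ arcsVanishing F n (n - m)} : Set _) =
        eulerCharC (arcsNonneg F n) * eulerCharC (arcsNonneg G n) := by
    intro m hm
    induction m with
    | zero => exact eulerCharC_arcPairs_vanishing F G hn
    | succ m ih =>
      have ih := ih (by omega)
      obtain ⟨j, hj⟩ : ∃ j, j = n - (m + 1) := ⟨_, rfl⟩
      rw [show n - m = j + 1 by omega, arcsVanishing_succ] at ih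
      rw [← hj]
      have hS := (isClosed_arcPairs F G n).inter
        (isClosed_fst_mem_arcsVanishing (d₂ := d₂) F (n := n) j)
      have hC : IsClosed {p : (Fin n → Fin d₁ → ℝ) × (Fin n → Fin d₂ → ℝ) |
          arcCoeff F j p.1 = 0} :=
        isClosed_eq (continuous_arcCoeff_fst F n j) continuous_const
      refine eulerCharC_eq_inter_of_diff_eq_zero hS hC ?_ ?_
      · rw [Set.inter_assoc]
        exact ih
      · rw [Set.inter_sdiff_assoc]
        exact eulerCharC_arcPairs_order F G n hF (by omega)
  have h := (key n le_rfl).2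
  rw [Nat.sub_self] at h
  rw [← h]
  refine eulerCharC_congr (Homeomorph.setCongr (Set.inter_eq_left.2 fun p _ k hk => ?_).symm)
  exact absurd hk (Nat.not_lt_zero k)

theorem coeff_modifiedZetaPos_thomSebastianiSum {f : (Fin d₁ → ℝ) → ℝ} {g : (Fin d₂ → ℝ) → ℝ}
    (hf : AnalyticAt ℝ f 0) (hf0 : f 0 = 0) (hg : AnalyticAt ℝ g 0) (hg0 : g 0 = 0) (hn : 1 ≤ n) :
    PowerSeries.coeff n (modifiedZetaPos (thomSebastianiSum f g)) =
      PowerSeries.coeff n (modifiedZetaPos f) * PowerSeries.coeff n (modifiedZetaPos g) := by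
  obtain ⟨F, hF⟩ := hf.exists_approximatedBy n
  obtain ⟨G, hG⟩ := hg.exists_approximatedBy n
  have h0 : thomSebastianiSum f g 0 = 0 := by
    change f 0 + g 0 = 0
    rw [hf0, hg0, add_zero]
  rw [(hF.thomSebastianiSum hG).coeff_modifiedZetaPos (hf.thomSebastianiSum hg) h0 hn,
    hF.coeff_modifiedZetaPos hf hf0 hn, hG.coeff_modifiedZetaPos hg hg0 hn,
    eulerCharC_congr (arcsNonnegJoinHomeo F G n),
    eulerCharC_arcPairs F G (hF.constantCoeff hf0) (by omega)]
  -- The signs agree because the exponent `n * (d₁ + d₂)` is additive.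
  ring

end

theorem mainTheorem5 {d₁ d₂ : ℕ} (f : (Fin d₁ → ℝ) → ℝ) (g : (Fin d₂ → ℝ) → ℝ)
    (hf : AnalyticAt ℝ f 0) (hf0 : f 0 = 0) (hg : AnalyticAt ℝ g 0) (hg0 : g 0 = 0) :
    ZetaDefined f ∧ ZetaDefined g ∧ ZetaDefined (thomSebastianiSum f g) ∧
    ∀ n : ℕ, 1 ≤ n →
      PowerSeries.coeff n (modifiedZetaPos (thomSebastianiSum f g)) =
          PowerSeries.coeff n (modifiedZetaPos f) * PowerSeries.coeff n (modifiedZetaPos g) ∧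
        PowerSeries.coeff n (modifiedZetaNeg (thomSebastianiSum f g)) =
          PowerSeries.coeff n (modifiedZetaNeg f) * PowerSeries.coeff n (modifiedZetaNeg g) := by
  refine ⟨hf.zetaDefined, hg.zetaDefined, (hf.thomSebastianiSum hg).zetaDefined, fun n hn =>
    ⟨coeff_modifiedZetaPos_thomSebastianiSum hf hf0 hg hg0 hn, ?_⟩⟩
  -- Negation commutes with the sum, which reduces the negative formula to the positive one for `-f`
  -- and `-g`.
  have h : -thomSebastianiSum f g = thomSebastianiSum (-f) (-g) := by
    funext z
    simp only [thomSebastianiSum, Pi.neg_apply, neg_add]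
  rw [modifiedZetaNeg_eq, modifiedZetaNeg_eq, modifiedZetaNeg_eq, h]
  exact coeff_modifiedZetaPos_thomSebastianiSum hf.neg (by simp [hf0]) hg.neg (by simp [hg0]) hn
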